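/- \textbf{Formulas and semantics.} Formulas of the modal $\mu$-calculus are generated by $\varphi ::= p \mid \neg p \mid x \mid \bigvee\Gamma \mid \bigwedge\Gamma \mid \nabla\Gamma \mid \mu x\,\varphi \mid \nu x\,\varphi$, with $x$ a variable, $p$ a propositional constant and $\Gamma$ a finite set of formulas. They are interpreted as usual in frames $S=(S,R,\Lambda)$ ($S\neq\emptyset$, $R\subseteq S\times S$, $\Lambda$ mapping propositional constants to subsets of $S$; $R[s]$ is the set of successors of $s$), where $\nabla\Gamma$ holds at $s$ iff some $\gamma\in\Gamma$ holds at all $r\in R[s]$, or all $\gamma\in\Gamma$ hold at some common $r\in R[s]$. For closed $\varphi$, $[\![\varphi]\!]^S$ denotes the set of states where $\varphi$ holds. A tree is a frame with a root $\rho$ such that every state is reachable from $\rho$, $\rho$ has no predecessor, and no state has two different predecessors. \textbf{Conjunctive systems.} An equation system $(X,E)$ consists of a finite set $X$ of variables and, for each $x\in X$, a formula $E(x)$ built from variables in $X$, closed formulas and literals by $\bigvee,\bigwedge,\nabla$, with all variables of $X$ in the scope of a modality. It is conjunctive if each $E(x)$ has the form $\bigwedge_{i<k}(\bigvee\Gamma_i\vee\nabla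 Y_i)$ with $\Gamma_i$ a finite set of closed formulas and $Y_i\subseteq X$. $\mathrm{Clos}(X,E)$ is the smallest set of formulas that contains $X$ and all $E(x)$, contains the elements of $\Gamma$ whenever it contains $\bigvee\Gamma$, $\bigwedge\Gamma$ or $\nabla\Gamma$, and contains $\psi(\sigma x\,\psi/x)$ whenever it contains $\sigma x\,\psi$, $\sigma\in\{\mu,\nu\}$. \textbf{Annotations.} An annotated formula $\varphi^\alpha$ is a pair of a formula and an ordinal $\alpha<\omega_1$. For a set $\Theta$ of annotated formulas, $\Theta^-$ is the set of its underlying formulas; for a set $\Gamma$ of formulas, $\Gamma^\alpha=\{\varphi^\alpha:\varphi\in\Gamma\}$. Write $\Theta\preceq\Xi$ if for every $\varphi^\alpha\in\Xi$ there is $\beta\le\alpha$ with $\varphi^\beta\in\Theta$. A well-annotation of a frame $S$ for $(X,E)$ assigns to each state $s$ a set $\Theta_s$ of annotated formulas from $\mathrm{Clos}(X,E)$ such that for all $s$: (1) if $\varphi^\alpha\in\Theta_s$ and $\varphi$ is closed, then $s\in[\![\varphi]\!]^S$; (2) if $x^\alpha\in\Theta_s$ with $x\in X$, then $E(x)^\beta\in\Theta_s$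 for some $\beta<\alpha$; (3) if $(\bigvee\Gamma)^\alpha\in\Theta_s$, then $\Gamma^\beta\cap\Theta_s\ne\emptyset$ for some $\beta\le\alpha$; (4) if $(\bigwedge\Gamma)^\alpha\in\Theta_s$, then $\Theta_s\preceq\Gamma^\alpha$; (5) if $(\nabla\Gamma)^\alpha\in\Theta_s$, then either $\Theta_r\preceq\Gamma^\alpha$ for some $r\in R[s]$, or there is $\varphi\in\Gamma$ with $\Theta_r\preceq\{\varphi^\alpha\}$ for all $r\in R[s]$. A well-annotation $\Theta$ of $S$ is conservative if at every state each formula carries at most one annotation, and $\Theta_s\preceq\Theta'_s$ for every well-annotation $\Theta'$ of $S$ and every state $s$. \textbf{The measure $O$.} For $\varphi\in\mathrm{Clos}(X,E)$ and $\Gamma\subseteq\mathrm{Clos}(X,E)$, let $O(\varphi,\Gamma)$ be the supremum of the ordinals $\kappa<\omega_1$ for which there is a conservative well-annotation $\Theta$ of a tree with root $\rho$ such that $\Gamma=\Theta_\rho^-$ and $\varphi^\kappa\in\Theta_\rho$ (with $\sup\emptyset=0$). \textbf{Second pumping lemma.} Let $(X,E)$ be a conjunctive equation system. For all $\kappa<\omega_1$,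 all $\Gamma\subseteq\mathrm{Clos}(X,E)$ and all $x\in X$: if $O(x,\Gamma)\le\kappa$, then $O(x,\Gamma)<\omega^2$. -/

import Mathlib

open Set

namespace MuCalc

universe u v

/-! ## Syntax of the modal mu-calculus -/

/-- Formulas of the modal mu-calculus over variables `Var` and propositional constants `P`.
A finite set of formulas, as argument of a connective, is presented by a finite family
`Γ : Fin n → Formula Var P`; everything below depends only on the range of that family. -/
inductive Formula (Var : Type u) (P : Type v) : Type (max u v)
  | prop (p : P) : Formula Var P
  | nprop (p : P) : Formula Var P
  | var (x : Var) : Formula Var P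
  | disj {n : ℕ} (Γ : Fin n → Formula Var P) : Formula Var P
  | conj {n : ℕ} (Γ : Fin n → Formula Var P) : Formula Var P
  | nabla {n : ℕ} (Γ : Fin n → Formula Var P) : Formula Var P
  | mu (x : Var) (φ : Formula Var P) : Formula Var P
  | nu (x : Var) (φ : Formula Var P) : Formula Var P

namespace Formula

variable {Var : Type u} {P : Type v}

/-- Binary disjunction. -/
def or (φ ψ : Formula Var P) : Formula Var P := disj ![φ, ψ]

/-- Free variables. -/
def freeVars : Formula Var P → Set Var
  | prop _ => ∅
  | nprop _ => ∅
  | var x => {x}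
  | disj Γ => ⋃ i, freeVars (Γ i)
  | conj Γ => ⋃ i, freeVars (Γ i)
  | nabla Γ => ⋃ i, freeVars (Γ i)
  | mu x φ => freeVars φ \ {x}
  | nu x φ => freeVars φ \ {x}

/-- Closed formulas: no free variables. In particular, literals are closed. -/
def Closed (φ : Formula Var P) : Prop := φ.freeVars = ∅

/-- Variables with a free occurrence that is not in the scope of a modality. -/
def unguarded : Formula Var P → Set Var
  | prop _ => ∅
  | nprop _ => ∅
  | var x => {x}
  | disj Γ => ⋃ i, unguarded (Γ i)
  | conj Γ => ⋃ i, unguarded (Γ i)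
  | nabla _ => ∅
  | mu x φ => unguarded φ \ {x}
  | nu x φ => unguarded φ \ {x}

/-- Quantifier-free formulas over a set `F` of formulas: the closure of `F` and the literals
under the logical connectives and the modality. -/
inductive QF (F : Set (Formula Var P)) : Formula Var P → Prop
  | base {φ : Formula Var P} (h : φ ∈ F) : QF F φ
  | prop (p : P) : QF F (.prop p)
  | nprop (p : P) : QF F (.nprop p)
  | disj {n : ℕ} (Γ : Fin n → Formula Var P) (h : ∀ i, QF F (Γ i)) : QF F (.disj Γ)
  | conj {n : ℕ} (Γ : Fin n → Formula Var P) (h : ∀ i, QF F (Γ i)) : QF F (.conj Γ)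
  | nabla {n : ℕ} (Γ : Fin n → Formula Var P) (h : ∀ i, QF F (Γ i)) : QF F (.nabla Γ)

open Classical in
/-- `subst x χ ψ` replaces the free occurrences of `x` in `ψ` by `χ`. It is used only with a
closed `χ` (see `EqSystem.closed_of_mu_mem_clos`), for which no capture can occur. -/
noncomputable def subst (x : Var) (χ : Formula Var P) : Formula Var P → Formula Var P
  | prop p => prop p
  | nprop p => nprop p
  | var y => if y = x then χ else var y
  | disj Γ => disj fun i => subst x χ (Γ i)
  | conj Γ => conj fun i => subst x χ (Γ i)
  | nabla Γ => nabla fun i => subst x χ (Γ i)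
  | mu y φ => if y = x then mu y φ else mu y (subst x χ φ)
  | nu y φ => if y = x then nu y φ else nu y (subst x χ φ)

end Formula

/-! ## Semantics -/

/-- Kripke frames: a nonempty set of states, an accessibility relation, and a labelling. -/
structure Frame (P : Type v) where
  State : Type
  nonempty : Nonempty State
  R : State → State → Prop
  label : P → Set State

namespace Frame

variable {P : Type v}

/-- The set of successors of a state. -/
def succs (S : Frame P) (s : S.State) : Set S.State := {t | S.R s t}

/-- The semantic counterpart of the modality: either all successors lie in one member of `𝒰`,
or some successor lies in all members of `𝒰`. -/
def nablaOp (S : Frame P) (𝒰 : Set (Set S.State)) : Set S.State :=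
  {v | ∃ U ∈ 𝒰, S.succs v ⊆ U} ∪ {v | (⋂₀ 𝒰 ∩ S.succs v).Nonempty}

/-- `S` is a tree with root `ρ`: every state is reachable from `ρ`, the root has no predecessor,
and no state has two predecessors. -/
structure IsTree (S : Frame P) (ρ : S.State) : Prop where
  reachable : ∀ s, Relation.ReflTransGen S.R ρ s
  root : ∀ s, ¬ S.R s ρ
  unique_pred : ∀ s t r, S.R s r → S.R t r → s = t

end Frame

open Classical in
/-- The denotation of a formula in a frame relative to a valuation. -/
noncomputable def Formula.den {Var : Type u} {P : Type v} (S : Frame P) :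
    Formula Var P → (Var → Set S.State) → Set S.State
  | .prop p, _ => S.label p
  | .nprop p, _ => (S.label p)ᶜ
  | .var x, V => V x
  | .disj Γ, V => ⋃ i, (Γ i).den S V
  | .conj Γ, V => ⋂ i, (Γ i).den S V
  | .nabla Γ, V => S.nablaOp (range fun i => (Γ i).den S V)
  | .mu x φ, V => ⋂₀ {U | φ.den S (Function.update V x U) ⊆ U}
  | .nu x φ, V => ⋃₀ {U | U ⊆ φ.den S (Function.update V x U)}

/-! ## Equation systems -/

/-- Equation systems: a finite set of variables `X` and, for each of them, a quantifier-free
formula over `X` and the closed formulas in which every variable is in the scope of a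
modality. -/
structure EqSystem (Var : Type u) (P : Type v) where
  X : Finset Var
  E : X → Formula Var P
  qf : ∀ x, Formula.QF ({φ | φ.Closed} ∪ {φ | ∃ y ∈ X, φ = .var y}) (E x)
  guarded : ∀ x, (E x).unguarded = ∅

namespace EqSystem

variable {Var : Type u} {P : Type v}

/-- Conjunctive systems: each right-hand side is a finite conjunction of formulas
`(⋁ Γᵢ) ∨ ∇ Yᵢ`, where `Γᵢ` is a finite set of closed formulas and `Yᵢ ⊆ X`. -/
def IsConjunctive (A : EqSystem Var P) : Prop :=
  ∀ x : A.X, ∃ (k : ℕ) (n m : Fin k → ℕ)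
    (Γ : (i : Fin k) → Fin (n i) → Formula Var P) (Y : (i : Fin k) → Fin (m i) → A.X),
    (∀ i j, (Γ i j).Closed) ∧
    A.E x = .conj fun i => (Formula.disj (Γ i)).or (.nabla fun j => .var (Y i j : Var))

/-- The (Fischer-Ladner) closure of an equation system: the smallest set containing the
variables of the system and the right-hand sides, and closed under passing from `⋁ Γ`, `⋀ Γ`,
`∇ Γ` to the elements of `Γ` and under unfolding of quantified formulas. -/
inductive Clos (A : EqSystem Var P) : Set (Formula Var P)
  | var (x : A.X) : Clos A (.var (x : Var))
  | eqn (x : A.X) : Clos A (A.E x)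
  | disj {n : ℕ} {Γ : Fin n → Formula Var P} (h : Clos A (.disj Γ)) (i : Fin n) : Clos A (Γ i)
  | conj {n : ℕ} {Γ : Fin n → Formula Var P} (h : Clos A (.conj Γ)) (i : Fin n) : Clos A (Γ i)
  | nabla {n : ℕ} {Γ : Fin n → Formula Var P} (h : Clos A (.nabla Γ)) (i : Fin n) : Clos A (Γ i)
  | mu {x : Var} {ψ : Formula Var P} (h : Clos A (.mu x ψ)) :
      Clos A (Formula.subst x (.mu x ψ) ψ)
  | nu {x : Var} {ψ : Formula Var P} (h : Clos A (.nu x ψ)) :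
      Clos A (Formula.subst x (.nu x ψ) ψ)

end EqSystem

/-! Substitution in the closure never meets variable capture. -/

theorem Formula.freeVars_subst {Var : Type u} {P : Type v} (x : Var) (χ : Formula Var P)
    (ψ : Formula Var P) : (subst x χ ψ).freeVars ⊆ (ψ.freeVars \ {x}) ∪ χ.freeVars := by
  induction ψ with
  | prop p => simp [subst, freeVars]
  | nprop p => simp [subst, freeVars]
  | var y => by_cases h : y = x <;> simp [subst, freeVars, h]
  | disj Γ ih | conj Γ ih | nabla Γ ih =>
    simp only [subst, freeVars]
    refine iUnion_subset fun i => (ih i).trans ?_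
    exact union_subset_union_left _
      (sdiff_subset_sdiff_left (subset_iUnion (fun j => (Γ j).freeVars) i))
  | mu y φ ih | nu y φ ih =>
    by_cases h : y = x
    · subst h; simp [subst, freeVars]
    · simp only [subst, h, if_false, freeVars]
      rintro z ⟨hz, hzy⟩
      rcases ih hz with ⟨h1, h2⟩ | h1
      · exact Or.inl ⟨⟨h1, hzy⟩, h2⟩
      · exact Or.inr h1

theorem EqSystem.qf_of_mem_clos {Var : Type u} {P : Type v} (A : EqSystem Var P)
    {φ : Formula Var P} (h : φ ∈ A.Clos) :
    Formula.QF ({φ | φ.Closed} ∪ {φ | ∃ y ∈ A.X, φ = .var y}) φ := by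
  have key : ∀ {x : Var} {χ ψ : Formula Var P}, χ.Closed → ψ.freeVars \ {x} = ∅ →
      (Formula.subst x χ ψ).Closed := by
    intro x χ ψ h1 h2
    have := Formula.freeVars_subst x χ ψ
    rw [h2, h1] at this
    exact subset_empty_iff.1 (by simpa using this)
  induction h with
  | var x => exact .base (Or.inr ⟨x, x.2, rfl⟩)
  | eqn x => exact A.qf x
  | disj _ i ih =>
    cases ih with
    | base h =>
      rcases h with h | ⟨y, _, h⟩
      · exact .base (Or.inl (iUnion_eq_empty.1 h i))
      · cases h
    | disj _ h => exact h i
  | conj _ i ih =>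
    cases ih with
    | base h =>
      rcases h with h | ⟨y, _, h⟩
      · exact .base (Or.inl (iUnion_eq_empty.1 h i))
      · cases h
    | conj _ h => exact h i
  | nabla _ i ih =>
    cases ih with
    | base h =>
      rcases h with h | ⟨y, _, h⟩
      · exact .base (Or.inl (iUnion_eq_empty.1 h i))
      · cases h
    | nabla _ h => exact h i
  | @mu x ψ _ ih | @nu x ψ _ ih =>
    cases ih with
    | base h =>
      rcases h with h | ⟨y, _, h⟩
      · exact .base (Or.inl (key (ψ := ψ) h h))
      · cases h

/-- Quantified formulas in the closure are closed. -/
theorem EqSystem.closed_of_mu_mem_clos {Var : Type u} {P : Type v} (A : EqSystem Var P)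
    {x : Var} {ψ : Formula Var P} :
    (Formula.mu x ψ ∈ A.Clos → (Formula.mu x ψ).Closed) ∧
    (Formula.nu x ψ ∈ A.Clos → (Formula.nu x ψ).Closed) := by
  constructor <;> intro h <;> cases A.qf_of_mem_clos h with
  | base h =>
    rcases h with h | ⟨y, _, h⟩
    · exact h
    · cases h

/-! ## Well-annotations -/

/-- A set of annotated formulas `φ ^ α`. -/
abbrev AnnSet (Var : Type u) (P : Type v) := Set (Formula Var P × Ordinal.{0})

namespace AnnSet

variable {Var : Type u} {P : Type v}

/-- The underlying formulas. -/
def forget (Θ : AnnSet Var P) : Set (Formula Var P) := {φ | ∃ α, (φ, α) ∈ Θ}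

/-- `Γ ^ α`: all formulas in `Γ`, annotated by `α`. -/
def ann (Γ : Set (Formula Var P)) (α : Ordinal.{0}) : AnnSet Var P := {p | p.1 ∈ Γ ∧ p.2 = α}

/-- The relation `Θ ≼ Ξ` between sets of annotated formulas. -/
def Le (Θ Ξ : AnnSet Var P) : Prop :=
  ∀ φ α, (φ, α) ∈ Ξ → ∃ β ≤ α, (φ, β) ∈ Θ

end AnnSet

open AnnSet

variable {Var : Type u} {P : Type v}

/-- Well-annotations of the frame `S` for the equation system `A`. The annotating ordinals are
countable and the annotated formulas belong to the closure of `A`. -/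
structure IsWellAnnotation (A : EqSystem Var P) (S : Frame P)
    (Θ : S.State → AnnSet Var P) : Prop where
  countable : ∀ s φ α, (φ, α) ∈ Θ s → α < Ordinal.omega 1
  mem_clos : ∀ s φ α, (φ, α) ∈ Θ s → φ ∈ A.Clos
  /-- The denotation of a closed formula does not depend on the valuation. -/
  closed : ∀ s φ α, (φ, α) ∈ Θ s → φ.Closed → s ∈ φ.den S (fun _ => ∅)
  var : ∀ s (x : A.X) α, (Formula.var (x : Var), α) ∈ Θ s → ∃ β < α, (A.E x, β) ∈ Θ s
  disj : ∀ s (n : ℕ) (Γ : Fin n → Formula Var P) α, (Formula.disj Γ, α) ∈ Θ s →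
    ∃ β ≤ α, (ann (range Γ) β ∩ Θ s).Nonempty
  conj : ∀ s (n : ℕ) (Γ : Fin n → Formula Var P) α, (Formula.conj Γ, α) ∈ Θ s →
    Le (Θ s) (ann (range Γ) α)
  nabla : ∀ s (n : ℕ) (Γ : Fin n → Formula Var P) α, (Formula.nabla Γ, α) ∈ Θ s →
    (∃ r ∈ S.succs s, Le (Θ r) (ann (range Γ) α)) ∨
    (∃ φ ∈ range Γ, ∀ r ∈ S.succs s, Le (Θ r) (ann {φ} α))

/-- Conservative well-annotations: each formula is annotated at most once at each state, and
the annotation is `≼`-below every well-annotation of the same frame. -/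
structure IsConservative (A : EqSystem Var P) (S : Frame P)
    (Θ : S.State → AnnSet Var P) : Prop where
  wellAnnotation : IsWellAnnotation A S Θ
  unique : ∀ s φ α β, (φ, α) ∈ Θ s → (φ, β) ∈ Θ s → α = β
  minimal : ∀ Θ' : S.State → AnnSet Var P, IsWellAnnotation A S Θ' → ∀ s, Le (Θ s) (Θ' s)

/-- `O A φ Γ` is the supremum of the countable ordinals that annotate `φ` at the root of a
conservative well-annotation of a tree whose set of underlying formulas at the root is `Γ`.
(The set is bounded by the first uncountable ordinal; the supremum of the empty set is `0`.) -/
noncomputable def O (A : EqSystem Var P) (φ : Formula Var P) (Γ : Set (Formula Var P)) :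
    Ordinal.{0} :=
  sSup {κ | κ < Ordinal.omega 1 ∧ ∃ (T : Frame P) (ρ : T.State) (Θ : T.State → AnnSet Var P),
    T.IsTree ρ ∧ IsConservative A T Θ ∧ Γ = (Θ ρ).forget ∧ (φ, κ) ∈ Θ ρ}

end MuCalc

/-!
Raising annotations. In a conjunctive system the annotation of a variable `x` at a state is
determined by the *ranks* of the conjuncts `⋁ Γᵢ ∨ ∇ Yᵢ` of its right-hand side, where the rank of
a conjunct is the least annotation of `∇ Yᵢ` in the greatest well-annotation (`ConjData.rank`,
`ConjData.ann_var_iff_rank`); the least annotations of the greatest well-annotation form the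
unique conservative one (`IsConservative.mem_iff`). The set of annotated formulas at a state
depends only on its finite *type*: the true closed formulas of the closure and the conjuncts of
countable rank. There is a number `L`, computed from the system, such that for every state `s`,
every conjunct `ι` of countable rank at least `ω * (L + 1)` at `s` and every `κ < ω_ 1`, some tree
has a root of the same type as `s` at which `ι` has rank at least `κ` (`Coding.exists_tree`). If
`O x Γ` were at least `ω ^ 2`, some tree with root set `Γ` would annotate `x` above `ω * (L + 1)`,
so a conjunct would have such a rank, and raising it beyond `κ` would give `O x Γ > κ`.

The new tree unravels a graph of copies of the states of the given frame, in which some conjuncts,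
the active obligations, carry *new ranks* `v` (`Arena.St`, `Arena.Edge`). The old rank `u` serves
as fuel: a limit below `u` persists along every edge (`PreArena.pers_spec`), so that an inherited
new rank costs nothing, and a request for a new rank `β < v ι` is answered along some edge by an
obligation whose old rank is at least any prescribed ordinal below `u ι` (`PreArena.birth_spec`), at
the cost of one multiple of `ω`. As there is fuel only for `L` such births in a row, the states
have to be revisited. Active obligations are organised by nested names, as in the determinization of
automata on infinite words. When all members of a name have become members of later names, the name
*flashes*. After a flash the tree may continue at an earlier state of the same shape instead of the
actual one; there are only finitely many shapes, and the levels of the obligations, which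
measure the fuel still needed, do not increase by persistence and decrease by births (`Names.lev_step`, `Arena.exists_step`).

Two things may go wrong with such jumps. Closed formulas have to keep their truth values, so no
infinite branch of the new tree may carry a bad chain of claims about fixpoints. This is ensured by
positional strategies in the truth game (`SetGame.determinacy`) and the ranks of claims that
witness them: each name carries an anchor, a state against which the ranks of the present state
are compared. A flash makes the new ranks of the members of a name smaller than a bound attached to
the name, hence on every infinite branch the anchors at some index are renewed infinitely often
(`Arena.exists_segments`), and the ranks of a bad chain would decrease forever
(`Claims.not_parWin`). Moreover, conjuncts of countable rank have to keep a countable rank, although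
jumps may increase it; the ranks at the anchors, together with the bounds of the names, form
lexicographically decreasing sequences of countable ordinals along the traces of the new tree
(`Arena.exists_trace_rank`). For this, an obligation requested by a conjunct of uncountable rank,
whose new rank may be any countable ordinal, stays *frozen*, without a name and with a larger
supply of fuel, until all traces that pass the moment of the request have ended.
-/

/-! ### Positional determinacy of parity games in effectivity form -/

namespace SetGame

open Filter

universe w

variable {V : Type w}

/-- The game of the opponent: if `𝒜 v` is the upwards closed family of the sets into which the
first player can force the play from `v`, then `dual 𝒜 v` is that of the second player. -/
def dual (𝒜 : V → Set (Set V)) : V → Set (Set V) := fun v => {D | Dᶜ ∉ 𝒜 v}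

/-- The least priority occurring infinitely often along `z` has parity `e`. -/
def ParWin (Ω : V → ℕ) (e : ℕ) (z : ℕ → V) : Prop :=
  ∃ m, m % 2 = e ∧ (∃ᶠ n in atTop, Ω (z n) = m) ∧ ∀ᶠ n in atTop, m ≤ Ω (z n)

/-- `Z` is a positional strategy that keeps the play inside `U` and makes every infinite play
satisfy `good`. -/
structure Dominion (𝒜 : V → Set (Set V)) (good : (ℕ → V) → Prop) (U : Set V)
    (Z : V → Set V) : Prop where
  mem : ∀ v ∈ U, Z v ∈ 𝒜 v
  sub : ∀ v ∈ U, Z v ⊆ U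
  good : ∀ z : ℕ → V, z 0 ∈ U → (∀ n, z (n + 1) ∈ Z (z n)) → good z

theorem ParWin.of_tail {Ω : V → ℕ} {e : ℕ} {z : ℕ → V} (k : ℕ)
    (h : ParWin Ω e fun n => z (n + k)) : ParWin Ω e z := by
  obtain ⟨m, hm, h1, h2⟩ := h
  refine ⟨m, hm, ?_, ?_⟩
  · rw [frequently_atTop] at h1 ⊢
    intro a
    obtain ⟨b, hb, hb'⟩ := h1 a
    exact ⟨b + k, by omega, hb'⟩
  · rw [eventually_atTop] at h2 ⊢
    obtain ⟨a, ha⟩ := h2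
    refine ⟨a + k, fun b hb => ?_⟩
    have h := ha (b - k) (by omega)
    simpa only [Nat.sub_add_cancel (show k ≤ b by omega)] using h

/-- There is a greatest dominion: the union of all dominions is one, with the strategy that
follows the least dominion containing the current position. -/
theorem exists_greatest_dominion (𝒜 : V → Set (Set V)) (good : (ℕ → V) → Prop)
    (tail : ∀ z k, good (fun n => z (n + k)) → good z) :
    ∃ U Z, Dominion 𝒜 good U Z ∧ ∀ U' Z', Dominion 𝒜 good U' Z' → U' ⊆ U := by
  classical
  let D : Set (Set V × (V → Set V)) := {q | Dominion 𝒜 good q.1 q.2}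
  let r : (Set V × (V → Set V)) → (Set V × (V → Set V)) → Prop := WellOrderingRel
  have wf : WellFounded r := WellOrderingRel.isWellOrder.toIsWellFounded.wf
  let U : Set V := {v | ∃ q ∈ D, v ∈ q.1}
  let pick : V → Set V × (V → Set V) := fun v =>
    if h : ({q | q ∈ D ∧ v ∈ q.1} : Set _).Nonempty then wf.min {q | q ∈ D ∧ v ∈ q.1} h
      else (∅, fun _ => ∅)
  have pick_spec : ∀ v ∈ U, pick v ∈ D ∧ v ∈ (pick v).1 := by
    rintro v ⟨q, hq, hv⟩
    have h : ({q | q ∈ D ∧ v ∈ q.1} : Set _).Nonempty := ⟨q, hq, hv⟩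
    simp only [pick, dif_pos h]
    exact wf.min_mem _ h
  have pick_min : ∀ v q, q ∈ D → v ∈ q.1 → ¬ r q (pick v) := by
    intro v q hq hv
    have h : ({q | q ∈ D ∧ v ∈ q.1} : Set _).Nonempty := ⟨q, hq, hv⟩
    simp only [pick, dif_pos h]
    exact wf.not_lt_min (s := {q | q ∈ D ∧ v ∈ q.1}) ⟨hq, hv⟩
  have dom : Dominion 𝒜 good U (fun v => (pick v).2 v) := by
    refine ⟨fun v hv => ?_, fun v hv => ?_, fun z h0 hz => ?_⟩
    · exact (pick_spec v hv).1.mem v (pick_spec v hv).2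
    · intro x hx
      exact ⟨pick v, (pick_spec v hv).1, (pick_spec v hv).1.sub v (pick_spec v hv).2 hx⟩
    · have hU : ∀ n, z n ∈ U := by
        intro n
        induction n with
        | zero => exact h0
        | succ n ih =>
          exact ⟨pick (z n), (pick_spec _ ih).1,
            (pick_spec _ ih).1.sub _ (pick_spec _ ih).2 (hz n)⟩
      have hmem : ∀ n, z (n + 1) ∈ (pick (z n)).1 := fun n =>
        (pick_spec _ (hU n)).1.sub _ (pick_spec _ (hU n)).2 (hz n)
      obtain ⟨q, ⟨n0, rfl⟩, hmin⟩ := wf.has_min (range fun n => pick (z n)) ⟨_, 0, rfl⟩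
      have hconst : ∀ k, pick (z (k + n0)) = pick (z n0) := by
        intro k
        induction k with
        | zero => simp
        | succ k ih =>
          have h1 : ¬ r (pick (z n0)) (pick (z (k + 1 + n0))) := by
            rw [← ih]
            refine pick_min _ _ (pick_spec _ (hU _)).1 ?_
            have := hmem (k + n0)
            rwa [show k + n0 + 1 = k + 1 + n0 by omega] at this
          have h2 := hmin _ ⟨k + 1 + n0, rfl⟩
          rcases trichotomous_of WellOrderingRel (pick (z (k + 1 + n0))) (pick (z n0)) with h | h | h
          · exact absurd h h2
          · exact h
          · exact absurd h h1
      -- the chosen dominions decrease in the well-order, so they are eventually constant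
      refine tail z n0 ((pick_spec _ (hU n0)).1.good (fun n => z (n + n0)) ?_ fun n => ?_)
      · simpa using (pick_spec _ (hU n0)).2
      · have := hz (n + n0)
        rw [hconst n] at this
        rwa [show n + n0 + 1 = n + 1 + n0 by omega] at this
  exact ⟨U, _, dom, fun U' Z' h v hv => ⟨(U', Z'), h, hv⟩⟩

/-- The greatest dominion contains every position from which it can be entered. -/
theorem mem_greatest_dominion {𝒜 : V → Set (Set V)} {good : (ℕ → V) → Prop}
    (tail : ∀ z k, good (fun n => z (n + k)) → good z) {U : Set V} {Z : V → Set V}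
    (hU : Dominion 𝒜 good U Z) (hmax : ∀ U' Z', Dominion 𝒜 good U' Z' → U' ⊆ U)
    {v : V} {Y : Set V} (hY : Y ∈ 𝒜 v) (hYU : Y ⊆ U) : v ∈ U := by
  classical
  by_contra hv
  refine hv (hmax (insert v U) (Function.update Z v Y) ⟨?_, ?_, ?_⟩ (mem_insert _ _))
  · intro w hw
    rcases eq_or_ne w v with rfl | h
    · simpa using hY
    · rw [Function.update_of_ne h]
      exact hU.mem w (hw.resolve_left h)
  · intro w hw
    rcases eq_or_ne w v with rfl | h
    · simpa using hYU.trans (subset_insert _ _)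
    · rw [Function.update_of_ne h]
      exact (hU.sub w (hw.resolve_left h)).trans (subset_insert _ _)
  · intro z h0 hz
    have key : ∀ z : ℕ → V, z 0 ∈ U → (∀ n, z (n + 1) ∈ Function.update Z v Y (z n)) →
        good z := by
      intro z h0 hz
      have hne : ∀ n, z n ∈ U := by
        intro n
        induction n with
        | zero => exact h0
        | succ n ih =>
          have := hz n
          rw [Function.update_of_ne (fun h => hv (by rw [← h]; exact ih))] at this
          exact hU.sub _ ih this
      refine hU.good z h0 fun n => ?_
      have := hz n
      rwa [Function.update_of_ne (fun h => hv (by rw [← h]; exact hne n))] at this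
    rcases h0 with h0 | h0
    · refine tail z 1 (key _ ?_ fun n => hz (n + 1))
      have := hz 0
      rw [h0, Function.update_self] at this
      exact hYU this
    · exact key z h0 hz

/-- Positional determinacy: the positions split into a dominion of the player who owns the parity
of the most significant priority `d` and one of the opponent. The opponent gets his greatest
dominion `U`. The rest of the positions outside `U` from which priority `d` cannot be forced is a
game with fewer priorities, in which the opponent wins nowhere because `U` is greatest. -/
theorem determinacy (k : ℕ) : ∀ (d : ℕ) (V : Type w) (𝒜 : V → Set (Set V)) (Ω : V → ℕ),
    (∀ v Y Y', Y ∈ 𝒜 v → Y ⊆ Y' → Y' ∈ 𝒜 v) → (∀ v, d ≤ Ω v ∧ Ω v < d + k) →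
    ∃ W Z D, Dominion 𝒜 (ParWin Ω (d % 2)) W Z ∧
      Dominion (dual 𝒜) (ParWin Ω ((d + 1) % 2)) Wᶜ D := by
  classical
  induction k with
  | zero =>
    intro d V 𝒜 Ω _ hΩ
    have : IsEmpty V := ⟨fun v => by have := hΩ v; omega⟩
    exact ⟨∅, isEmptyElim, isEmptyElim, ⟨isEmptyElim, isEmptyElim, fun z => isEmptyElim (z 0)⟩,
      ⟨isEmptyElim, isEmptyElim, fun z => isEmptyElim (z 0)⟩⟩
  | succ k ih =>
    intro d V 𝒜 Ω mono hΩ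
    have tailP : ∀ e (z : ℕ → V) k, ParWin Ω e (fun n => z (n + k)) → ParWin Ω e z :=
      fun e z k h => h.of_tail k
    obtain ⟨U, D, hU, hUmax⟩ := exists_greatest_dominion (dual 𝒜) (ParWin Ω ((d + 1) % 2))
      (tailP _)
    have hUin : ∀ v Y, Y ∈ dual 𝒜 v → Y ⊆ U → v ∈ U := fun v Y h1 h2 =>
      mem_greatest_dominion (tailP _) hU hUmax h1 h2
    have hB : ∀ v ∉ U, Uᶜ ∈ 𝒜 v := by
      intro v hv
      by_contra h
      exact hv (hUin v U h subset_rfl)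
    -- the attractor of the positions of priority `d`, inside the complement of `U`
    let N : Set V := {v | v ∉ U ∧ Ω v = d}
    let 𝒩 : V → Set (Set V) := fun v => {Y | v ∈ N ∨ (v ∉ U ∧ Y ∈ 𝒜 v)}
    have tailN : ∀ (z : ℕ → V) k, (∃ n, z (n + k) ∈ N) → ∃ n, z n ∈ N :=
      fun z k ⟨n, hn⟩ => ⟨n + k, hn⟩
    obtain ⟨At, ZA, hAt, hAmax⟩ := exists_greatest_dominion 𝒩 (fun z => ∃ n, z n ∈ N) tailN
    have hAU : At ⊆ Uᶜ := fun v hv => (hAt.mem v hv).elim (fun h => h.1) fun h => h.1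
    have hNA : N ⊆ At := fun v hv =>
      mem_greatest_dominion tailN hAt hAmax (Y := At) (Or.inl hv) subset_rfl
    have hAin : ∀ v ∉ U, At ∈ 𝒜 v → v ∈ At := fun v hv h =>
      mem_greatest_dominion tailN hAt hAmax (Y := At) (Or.inr ⟨hv, h⟩) subset_rfl
    let B : Set V := {v | v ∉ U ∧ v ∉ At}
    -- the game on the rest, with the roles of the players exchanged
    let 𝒟 : B → Set (Set B) := fun v => {Y | Subtype.val '' Y ∪ U ∈ dual 𝒜 v}
    have dmono : ∀ v Y Y', Y ∈ dual 𝒜 v → Y ⊆ Y' → Y' ∈ dual 𝒜 v := by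
      intro v Y Y' h hs h'
      exact h (mono v _ _ h' (compl_subset_compl.2 hs))
    obtain ⟨W1, Z1, D1, hW1, hD1⟩ := ih (d + 1) B 𝒟 (fun v => Ω v)
      (fun v Y Y' h hs => dmono _ _ _ h (union_subset_union_left _ (image_mono hs)))
      (fun v => by
        have h1 := hΩ v
        have h2 : Ω v ≠ d := fun h => v.2.2 (hNA ⟨v.2.1, h⟩)
        omega)
    have hW1e : W1 = ∅ := by
      have key : Dominion (dual 𝒜) (ParWin Ω ((d + 1) % 2)) (Subtype.val '' W1 ∪ U)
          (fun v => if h : v ∈ B then (Subtype.val '' Z1 ⟨v, h⟩ ∪ U) else D v) := by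
        have hBU : ∀ v ∈ U, v ∉ B := fun v hv h => h.1 hv
        refine ⟨?_, ?_, ?_⟩
        · rintro v (⟨w, hw, rfl⟩ | hv)
          · simp only [w.2, dif_pos]
            exact hW1.mem w hw
          · simp only [hBU v hv, dif_neg, not_false_iff]
            exact hU.mem v hv
        · rintro v (⟨w, hw, rfl⟩ | hv)
          · simp only [w.2, dif_pos]
            exact union_subset_union_left _ (image_mono (hW1.sub w hw))
          · simp only [hBU v hv, dif_neg, not_false_iff]
            exact (hU.sub v hv).trans subset_union_right
        · intro z h0 hz
          by_cases hex : ∃ n, z n ∈ U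
          · obtain ⟨n, hn⟩ := hex
            refine (hU.good (fun m => z (m + n)) (by simpa using hn) ?_).of_tail n
            have hin : ∀ m, z (m + n) ∈ U := by
              intro m
              induction m with
              | zero => simpa using hn
              | succ m ihm =>
                have := hz (m + n)
                simp only [hBU _ ihm, dif_neg, not_false_iff] at this
                rw [show m + 1 + n = m + n + 1 by omega]
                exact hU.sub _ ihm this
            intro m
            have := hz (m + n)
            simp only [hBU _ (hin m), dif_neg, not_false_iff] at this
            rwa [show m + 1 + n = m + n + 1 by omega]
          · push Not at hex
            have hin : ∀ m, ∃ w ∈ W1, (w : V) = z m := by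
              intro m
              induction m with
              | zero => exact h0.resolve_right (hex 0)
              | succ m ihm =>
                obtain ⟨w, hw, hwz⟩ := ihm
                have := hz m
                rw [← hwz] at this
                simp only [w.2, dif_pos] at this
                obtain ⟨w', hw', h'⟩ := this.resolve_right (hex _)
                exact ⟨w', hW1.sub w hw hw', h'⟩
            choose y hy hyz using hin
            have := hW1.good y (hy 0) fun n => by
              have := hz n
              rw [← hyz n] at this
              simp only [(y n).2, dif_pos] at this
              obtain ⟨w', hw', h'⟩ := this.resolve_right (hex _)
              have : w' = y (n + 1) := Subtype.ext (h'.trans (hyz _).symm)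
              exact this ▸ hw'
            obtain ⟨m, hm, h1, h2⟩ := this
            exact ⟨m, hm, by simpa only [hyz] using h1, by simpa only [hyz] using h2⟩
      have := hUmax _ _ key
      by_contra hne
      obtain ⟨w, hw⟩ := nonempty_iff_ne_empty.2 hne
      exact w.2.1 (this (Or.inl ⟨w, hw, rfl⟩))
    subst hW1e
    have hD1mem : ∀ (v : V) (h : v ∈ B), Subtype.val '' D1 ⟨v, h⟩ ∪ At ∈ 𝒜 v := by
      intro v h
      have := hD1.mem ⟨v, h⟩ (by simp)
      have h2 : ¬ (Subtype.val '' (D1 ⟨v, h⟩)ᶜ ∪ U ∈ dual 𝒜 v) := this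
      simp only [dual, mem_ofPred_eq, not_not] at h2
      refine mono _ _ _ h2 ?_
      intro x hx
      simp only [compl_union, mem_inter_iff, mem_compl_iff] at hx
      by_cases hxA : x ∈ At
      · exact Or.inr hxA
      · refine Or.inl ⟨⟨x, hx.2, hxA⟩, ?_, rfl⟩
        by_contra hc
        exact hx.1 ⟨_, hc, rfl⟩
    -- after priority `d` any move inside `Uᶜ` will do, in `At` priority `d` is approached
    refine ⟨Uᶜ, fun v => if v ∈ N then Uᶜ else if v ∈ At then ZA v else
      if h : v ∈ B then Subtype.val '' D1 ⟨v, h⟩ ∪ At else ∅, D, ⟨?_, ?_, ?_⟩, by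
        simpa using hU⟩
    · intro v hv
      by_cases h1 : v ∈ N
      · simpa [h1] using hB v hv
      by_cases h2 : v ∈ At
      · simpa [h1, h2] using ((hAt.mem v h2).resolve_left h1).2
      · have h3 : v ∈ B := ⟨hv, h2⟩
        simpa only [h1, h2, h3, if_false, dif_pos] using hD1mem v h3
    · intro v hv
      by_cases h1 : v ∈ N
      · simp [h1]
      by_cases h2 : v ∈ At
      · simpa [h1, h2] using (hAt.sub v h2).trans hAU
      · have h3 : v ∈ B := ⟨hv, h2⟩
        simp only [h1, h2, h3, if_false, dif_pos]
        refine union_subset ?_ hAU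
        rintro _ ⟨w, -, rfl⟩
        exact w.2.1
    · intro z h0 hz
      by_cases hf : ∃ᶠ n in atTop, z n ∈ N
      · exact ⟨d, rfl, hf.mono fun n hn => hn.2, Eventually.of_forall fun n => (hΩ _).1⟩
      rw [not_frequently, eventually_atTop] at hf
      obtain ⟨n0, hn0⟩ := hf
      have hUc : ∀ n, z n ∈ Uᶜ := by
        intro n
        induction n with
        | zero => exact h0
        | succ n ihn =>
          have := hz n
          by_cases h1 : z n ∈ N
          · simpa [h1] using this
          by_cases h2 : z n ∈ At
          · simp only [h1, h2, if_false, if_true] at this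
            exact hAU (hAt.sub _ h2 this)
          · have h3 : z n ∈ B := ⟨ihn, h2⟩
            simp only [h1, h2, h3, if_false, dif_pos] at this
            rcases this with ⟨w, -, hw⟩ | h
            · exact hw ▸ w.2.1
            · exact hAU h
      have hnA : ∀ n ≥ n0, z n ∉ At := by
        intro n hn hA
        have hin : ∀ m, z (m + n) ∈ At := by
          intro m
          induction m with
          | zero => simpa using hA
          | succ m ihm =>
            have := hz (m + n)
            simp only [hn0 (m + n) (by omega), ihm, if_false, if_true] at this
            rw [show m + 1 + n = m + n + 1 by omega]
            exact hAt.sub _ ihm this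
        obtain ⟨m, hm⟩ := hAt.good (fun m => z (m + n)) (by simpa using hA) fun m => by
          have := hz (m + n)
          simp only [hn0 (m + n) (by omega), hin m, if_false, if_true] at this
          rwa [show m + 1 + n = m + n + 1 by omega]
        exact hn0 (m + n) (by omega) hm
      have hBn : ∀ n, z (n + n0) ∈ B := fun n => ⟨hUc _, hnA _ (by omega)⟩
      have := hD1.good (fun n => ⟨z (n + n0), hBn n⟩) (by simp) fun n => by
        have := hz (n + n0)
        simp only [hn0 (n + n0) (by omega), (hBn n).2, hBn n, if_false, dif_pos] at this
        rcases this with ⟨w, hw, hw'⟩ | h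
        · have : w = ⟨z (n + 1 + n0), hBn (n + 1)⟩ :=
            Subtype.ext (hw'.trans (by rw [show n + n0 + 1 = n + 1 + n0 by omega]))
          exact this ▸ hw
        · exact absurd h (hnA _ (by omega))
      have h' : ParWin Ω (d % 2) (fun n => z (n + n0)) := by
        obtain ⟨m, hm, h1, h2⟩ := this
        exact ⟨m, by omega, h1, h2⟩
      exact h'.of_tail n0

end SetGame

/-! ### Nested name sets and their normalisation -/

namespace Names

variable {I : Type}

/-- `Norm R L e fl N L'`: the sequence `N` of name sets (of length `L'`) results from the raw
sequence `R` (whose names of index `≥ L` are new) by repairing it from the first index `e` at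
which the name has no owner, that is, all its members belong to later names. If that name is
nonempty (`fl`), it is kept and its members lose their later names. All names beyond are made
disjoint and moved down. -/
structure Norm (R : ℕ → Set I) (L e : ℕ) (fl : Prop) (N : ℕ → Set I) (L' : ℕ) : Prop where
  le : e ≤ L
  lt : fl → e < L
  eq : ∀ i < e, N i = R i
  eq_flash : fl → N e = R e
  nonempty : fl → (R e).Nonempty
  /-- A flashing name has no owner. -/
  flash : fl → ∀ t ∈ R e, ∃ j > e, t ∈ R j
  owner : ∀ i < L', ∃ t ∈ N i, ∀ j > i, t ∉ N j
  empty : ∀ i ≥ L', N i = ∅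
  le' : e ≤ L'
  lt' : fl → e < L'
  disj : ∀ i ≥ e, ∀ t ∈ N i, ∀ j > i, t ∉ N j
  of_mem : ∀ i ≥ e, ∀ t ∈ N i, ∃ k ≥ e, t ∈ R k
  /-- No element is lost: it belongs to the flashing name or moves down, strictly so from an old
  name if a name has died. -/
  mem : ∀ t k, t ∈ R k → e ≤ k → (fl ∧ t ∈ R e) ∨
    ∃ j, e ≤ j ∧ j ≤ k ∧ t ∈ N j ∧ (¬ fl → k < L → j < k)

theorem add_count_le {p : ℕ → Prop} [DecidablePred p] {c m : ℕ} (h : ∀ m, p m → c ≤ m)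
    (hm : c ≤ m) : c + Nat.count p m ≤ m := by
  induction m, hm using Nat.le_induction with
  | base =>
    have : Nat.count p c = 0 := by
      rw [Nat.count_eq_card_filter_range, Finset.card_eq_zero, Finset.filter_eq_empty_iff]
      intro x hx hp
      exact absurd (h x hp) (by simpa using hx)
    omega
  | succ m hm ih =>
    rw [Nat.count_succ]
    split_ifs <;> omega

/-- Every sequence of names can be repaired: beyond the index of the event an element stays in its
first name only, and empty names are removed. -/
theorem exists_norm (R : ℕ → Set I) (L B : ℕ) (hB : ∀ i ≥ B, R i = ∅) :
    ∃ e fl N L', Norm R L e fl N L' := by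
  classical
  have hex : ∃ i, L ≤ i ∨ ∀ t ∈ R i, ∃ j > i, t ∈ R j := ⟨L, Or.inl le_rfl⟩
  obtain ⟨e, he, hmin⟩ : ∃ e, (L ≤ e ∨ ∀ t ∈ R e, ∃ j > e, t ∈ R j) ∧
      ∀ i < e, i < L ∧ ∃ t ∈ R i, ∀ j > i, t ∉ R j := by
    refine ⟨Nat.find hex, Nat.find_spec hex, fun i hi => ?_⟩
    have := Nat.find_min hex hi
    push Not at this
    exact this
  have heL : e ≤ L := by
    by_contra h
    exact absurd (hmin L (by omega)).1 (lt_irrefl _)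
  obtain ⟨fl, hfl⟩ : ∃ fl, fl = (e < L ∧ (R e).Nonempty) := ⟨_, rfl⟩
  obtain ⟨e0, he0⟩ : ∃ e0, e0 = if fl then e + 1 else e := ⟨_, rfl⟩
  have he0' : e ≤ e0 := by rw [he0]; split_ifs <;> omega
  -- the elements to be placed from `e0` on, and the first raw name `kf t` of each of them; it
  -- becomes the name with the number `lv t` among the nonempty names from `e0` on
  let rest : I → Prop := fun t => (∃ k, e0 ≤ k ∧ t ∈ R k) ∧ ¬ (fl ∧ t ∈ R e)
  let kf : I → ℕ := fun t => sInf {k | e0 ≤ k ∧ t ∈ R k}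
  have kf_mem : ∀ t, rest t → e0 ≤ kf t ∧ t ∈ R (kf t) := fun t h => Nat.sInf_mem h.1
  have kf_le : ∀ t k, e0 ≤ k → t ∈ R k → kf t ≤ k := fun t k h1 h2 => Nat.sInf_le ⟨h1, h2⟩
  let pl : ℕ → Prop := fun m => ∃ t, rest t ∧ kf t = m
  have pl_le : ∀ m, pl m → e0 ≤ m := by
    rintro m ⟨t, ht, rfl⟩
    exact (kf_mem t ht).1
  have kf_lt : ∀ t, rest t → kf t < B := by
    intro t ht
    by_contra h
    have := (kf_mem t ht).2
    rw [hB _ (not_lt.1 h)] at this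
    exact this
  let lv : I → ℕ := fun t => Nat.count pl (kf t)
  have lv_lt : ∀ t, rest t → lv t < Nat.count pl B := fun t ht =>
    Nat.count_strict_mono ⟨t, ht, rfl⟩ (kf_lt t ht)
  refine ⟨e, fl, fun i => {t | (i < e0 ∧ t ∈ R i) ∨ (rest t ∧ i = e0 + lv t)},
    e0 + Nat.count pl B, ?_⟩
  have hlow : ∀ i < e0, {t | (i < e0 ∧ t ∈ R i) ∨ (rest t ∧ i = e0 + lv t)} = R i := by
    intro i hi
    ext t
    simp only [mem_ofPred_eq, hi, true_and]
    exact ⟨fun h => h.elim id fun h => by omega, Or.inl⟩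
  have hdisj : ∀ i ≥ e, ∀ t, ((i < e0 ∧ t ∈ R i) ∨ (rest t ∧ i = e0 + lv t)) → ∀ j > i,
      ¬ ((j < e0 ∧ t ∈ R j) ∨ (rest t ∧ j = e0 + lv t)) := by
    rintro i hi t ht j hj (⟨h1, h2⟩ | ⟨h1, h2⟩)
    · rw [he0] at h1
      split_ifs at h1 <;> omega
    · rcases ht with ⟨h3, h4⟩ | ⟨h3, h4⟩
      · by_cases f : fl
        · rw [he0, if_pos f] at h3
          obtain rfl : i = e := by omega
          exact h1.2 ⟨f, h4⟩
        · rw [he0, if_neg f] at h3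
          omega
      · omega
  refine ⟨heL, fun f => (hfl ▸ f).1, fun i hi => hlow i (by omega), fun f => hlow e ?_,
    fun f => (hfl ▸ f).2, fun f => ?_, ?_, ?_, by omega, fun f => ?_, ?_, ?_, ?_⟩
  · rw [he0, if_pos f]; omega
  · have : e < L := (hfl ▸ f).1
    exact he.resolve_left (by omega)
  · intro i hi
    by_cases h1 : i < e
    · obtain ⟨-, t, ht, htj⟩ := hmin i h1
      refine ⟨t, Or.inl ⟨by omega, ht⟩, ?_⟩
      rintro j hj (⟨_, h⟩ | ⟨⟨⟨k, hk, h⟩, _⟩, _⟩)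
      · exact htj j hj h
      · exact htj k (by omega) h
    · have hi' : e ≤ i := by omega
      suffices h : ∃ t, (i < e0 ∧ t ∈ R i) ∨ (rest t ∧ i = e0 + lv t) by
        obtain ⟨t, ht⟩ := h
        exact ⟨t, ht, hdisj i hi' t ht⟩
      by_cases h2 : i < e0
      · have f : fl := by
          by_contra f
          rw [he0, if_neg f] at h2
          omega
        rw [he0, if_pos f] at h2
        obtain rfl : i = e := by omega
        obtain ⟨t, ht⟩ := (hfl ▸ f).2
        exact ⟨t, Or.inl ⟨by rw [he0, if_pos f]; omega, ht⟩⟩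
      · obtain ⟨m, rfl⟩ := Nat.exists_eq_add_of_le (not_lt.1 h2)
        have hm : m < Nat.count pl B := by omega
        have hp : ∀ hf : (Set.ofPred pl).Finite, m < hf.toFinset.card := by
          intro hf
          exact lt_of_lt_of_le hm (Nat.count_le_card hf B)
        obtain ⟨t, ht, htm⟩ := Nat.nth_mem m hp
        refine ⟨t, Or.inr ⟨ht, ?_⟩⟩
        have : Nat.count pl (kf t) = m := by rw [htm]; exact Nat.count_nth hp
        show e0 + m = e0 + Nat.count pl (kf t)
        rw [this]
  · intro i hi
    refine eq_empty_of_forall_notMem ?_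
    rintro t (⟨h1, -⟩ | ⟨h1, h2⟩)
    · omega
    · have := lv_lt t h1
      omega
  · rw [he0, if_pos f]; omega
  · exact hdisj
  · rintro i hi t (⟨-, h⟩ | ⟨⟨⟨k, hk, h⟩, _⟩, _⟩)
    · exact ⟨i, hi, h⟩
    · exact ⟨k, by omega, h⟩
  · intro t k hk hek
    by_cases hf : fl ∧ t ∈ R e
    · exact Or.inl hf
    have hk0 : e0 ≤ k := by
      rw [he0]
      split_ifs with f
      · rcases hek.eq_or_lt with rfl | h
        · exact absurd ⟨f, hk⟩ hf
        · omega
      · exact hek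
    have hr : rest t := ⟨⟨k, hk0, hk⟩, hf⟩
    have h1 : e0 + lv t ≤ kf t := add_count_le pl_le (kf_mem t hr).1
    have h2 := kf_le t k hk0 hk
    refine Or.inr ⟨e0 + lv t, by omega, by omega, Or.inr ⟨hr, rfl⟩, fun f hkL => ?_⟩
    -- without a flash the name `e` is dropped, so that all later ones move down
    have hempty : R e = ∅ := by
      by_contra h
      exact f (hfl ▸ ⟨by omega, nonempty_iff_ne_empty.2 h⟩)
    have hgt : ∀ t, rest t → e0 + 1 ≤ kf t := by
      intro t ht
      have h3 := kf_mem t ht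
      rcases h3.1.eq_or_lt with h | h
      · rw [← h, he0, if_neg f, hempty] at h3
        exact absurd h3.2 (notMem_empty t)
      · omega
    have h3 : e0 + 1 + lv t ≤ kf t := add_count_le
      (by rintro m ⟨t, ht, rfl⟩; exact hgt t ht) (hgt t hr)
    omega

/-- A sequence of names with owners is not longer than the number of elements. -/
theorem length_le [Fintype I] {M : ℕ → Set I} {L : ℕ}
    (h : ∀ i < L, ∃ t ∈ M i, ∀ j > i, t ∉ M j) : L ≤ Fintype.card I := by
  choose t ht hj using h
  have : Function.Injective fun i : Fin L => t i i.2 := by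
    intro i j hij
    by_contra hne
    rcases lt_or_gt_of_ne hne with h | h
    · exact hj i i.2 j h (by rw [show t i i.2 = t j j.2 from hij]; exact ht j j.2)
    · exact hj j j.2 i h (by rw [← show t i i.2 = t j j.2 from hij]; exact ht i i.2)
  simpa using Fintype.card_le_of_injective _ this

/-! #### Keys -/

/-- The number with base-`B` digits `y 0, …, y (n - 1)`, most significant digit first. -/
def digits (B : ℕ) (y : ℕ → ℕ) : ℕ → ℕ
  | 0 => 0
  | n + 1 => digits B y n * B + y n

theorem digits_congr {B : ℕ} {y y' : ℕ → ℕ} {n : ℕ} (h : ∀ j < n, y' j = y j) :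
    digits B y' n = digits B y n := by
  induction n with
  | zero => rfl
  | succ n ih => simp only [digits, ih fun j hj => h j (by omega), h n (by omega)]

theorem digits_lt {B : ℕ} {y y' : ℕ → ℕ} {n i : ℕ} (hB : ∀ j, y' j < B) (hi : i < n)
    (h : ∀ j < i, y' j = y j) (hlt : y' i < y i) : digits B y' n < digits B y n := by
  induction n with
  | zero => omega
  | succ n ih =>
    simp only [digits]
    rcases (Nat.lt_succ_iff.1 hi).eq_or_lt with rfl | h'
    · rw [digits_congr h]; omega
    · have h1 := ih h'
      have h2 := hB n
      calc digits B y' n * B + y' n < (digits B y' n + 1) * B := by rw [add_mul]; omega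
        _ ≤ digits B y n * B := Nat.mul_le_mul_right _ h1
        _ ≤ _ := Nat.le_add_right _ _

theorem digits_lt_pow {B : ℕ} {y : ℕ → ℕ} (hB : ∀ j, y j < B) (n : ℕ) :
    digits B y n < B ^ n := by
  induction n with
  | zero => simp [digits]
  | succ n ih =>
    have h2 := hB n
    calc digits B y n * B + y n < (digits B y n + 1) * B := by rw [add_mul]; omega
      _ ≤ B ^ n * B := Nat.mul_le_mul_right _ ih
      _ = _ := (pow_succ _ _).symm

/-- The index of the first name from `i` on that contains `t`, or `K` if there is none. -/
noncomputable def next (K : ℕ) (M : ℕ → Set I) (t : I) (i : ℕ) : ℕ :=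
  sInf ({k | i ≤ k ∧ t ∈ M k} ∪ {K})

section next

variable {K : ℕ} {M : ℕ → Set I} {t : I} {i j k : ℕ}

theorem next_le : next K M t i ≤ K := Nat.sInf_le (Or.inr rfl)

theorem next_le_of_mem (h : i ≤ k) (ht : t ∈ M k) : next K M t i ≤ k :=
  Nat.sInf_le (Or.inl ⟨h, ht⟩)

theorem next_cases (K : ℕ) (M : ℕ → Set I) (t : I) (i : ℕ) :
    next K M t i = K ∨ (i ≤ next K M t i ∧ t ∈ M (next K M t i)) :=
  (Nat.sInf_mem (s := {k | i ≤ k ∧ t ∈ M k} ∪ {K}) ⟨K, Or.inr rfl⟩).symm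

theorem le_next (hK : j ≤ K) (h : ∀ k, i ≤ k → t ∈ M k → j ≤ k) : j ≤ next K M t i := by
  rcases next_cases K M t i with h' | ⟨h1, h2⟩
  · omega
  · exact h _ h1 h2

theorem next_mono (h : i ≤ j) : next K M t i ≤ next K M t j := by
  rcases next_cases K M t j with h' | ⟨h1, h2⟩
  · rw [h']; exact next_le
  · exact next_le_of_mem (h.trans h1) h2

end next

/-- The digits of the key of `t`: the next name containing `t`, refined by the counter `c` of
the current index. -/
noncomputable def key (K Q : ℕ) (M : ℕ → Set I) (c : ℕ → ℕ) (t : I) (i : ℕ) : ℕ :=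
  if next K M t i = K then K * (Q + 1) else next K M t i * (Q + 1) + c i

theorem key_lt {K Q : ℕ} {M : ℕ → Set I} {c : ℕ → ℕ} {t : I} (hc : ∀ i, c i ≤ Q) (i : ℕ) :
    key K Q M c t i < K * (Q + 1) + 1 := by
  unfold key
  split_ifs with h
  · omega
  · have h1 : next K M t i + 1 ≤ K := lt_of_le_of_ne next_le h
    have h2 := Nat.mul_le_mul_right (Q + 1) h1
    have := hc i
    rw [add_mul] at h2
    omega

/-- The level of an element: its key, as a number. -/
noncomputable def lev (K Q : ℕ) (M : ℕ → Set I) (c : ℕ → ℕ) (t : I) : ℕ :=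
  digits (K * (Q + 1) + 1) (key K Q M c t) (K + 1)

theorem lev_le {K Q : ℕ} {M : ℕ → Set I} {c : ℕ → ℕ} {t : I} (hc : ∀ i, c i ≤ Q) :
    lev K Q M c t ≤ (K * (Q + 1) + 1) ^ (K + 1) :=
  (digits_lt_pow (key_lt hc) _).le

/-- The level does not increase when `t` passes its old names on to `t'`, and decreases if `t'` is
also given a new one. The counter at the index of the event has to decrease in case of a flash. -/
theorem lev_step {K Q L e L' : ℕ} {fl : Prop} {M R N : ℕ → Set I} (hN : Norm R L e fl N L')
    (hL : L ≤ K) (hL' : L' ≤ K) (hM : ∀ i ≥ L, M i = ∅) {c c' : ℕ → ℕ}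
    (hc' : ∀ i, c' i ≤ Q) (hce : ∀ i < e, c' i = c i) (hcf : fl → c' e < c e) {t t' : I}
    (ht : ∀ i < L, t' ∈ R i ↔ t ∈ M i) :
    lev K Q N c' t' ≤ lev K Q M c t ∧
      ((∃ k ≥ L, t' ∈ R k) → lev K Q N c' t' < lev K Q M c t) := by
  have heL := hN.le
  have hlow : ∀ m < e, t' ∈ N m ↔ t ∈ M m := fun m hm => by
    rw [hN.eq m hm]; exact ht m (by omega)
  have hex : ∃ j, e ≤ next K M t j := ⟨e, le_next (by omega) fun k hk _ => hk⟩
  -- the first digit that refers to a name from `e` on; the digits before it are unchanged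
  obtain ⟨i0, hi0, hmin⟩ : ∃ i0, e ≤ next K M t i0 ∧ ∀ j < i0, next K M t j < e := by
    classical
    exact ⟨Nat.find hex, Nat.find_spec hex, fun j hj => not_le.1 (Nat.find_min hex hj)⟩
  have hi0e : i0 ≤ e := by
    by_contra h
    exact absurd (hmin e (by omega)) (not_lt.2 (le_next (by omega) fun k hk _ => hk))
  have hA : ∀ j < i0, key K Q N c' t' j = key K Q M c t j := by
    intro j hj
    have h1 := hmin j hj
    rcases next_cases K M t j with h2 | ⟨h2, h3⟩
    · omega
    have h4 : next K N t' j = next K M t j := by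
      apply le_antisymm
      · exact next_le_of_mem h2 ((hlow _ h1).2 h3)
      · rcases next_cases K N t' j with h5 | ⟨h5, h6⟩
        · omega
        · by_contra h
          exact h (next_le_of_mem h5 ((hlow _ (by omega)).1 h6))
    unfold key
    rw [h4, hce j (by omega)]
  have hBM : ∀ j, i0 ≤ j → j ≤ e → next K M t j = next K M t e := by
    intro j h1 h2
    refine le_antisymm (next_mono h2) ?_
    rcases next_cases K M t j with h5 | ⟨h5, h6⟩
    · rw [h5]; exact next_le
    · exact next_le_of_mem (hi0.trans (next_mono h1)) h6
  have hBN : ∀ j, i0 ≤ j → j ≤ e → next K N t' j = next K N t' e := by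
    intro j h1 h2
    refine le_antisymm (next_mono h2) ?_
    rcases next_cases K N t' j with h5 | ⟨h5, h6⟩
    · rw [h5]; exact next_le
    · refine next_le_of_mem (not_lt.1 fun h => ?_) h6
      have h7 := next_le_of_mem (K := K) h5 ((hlow _ h).1 h6)
      have h8 := hi0.trans (next_mono (K := K) (M := M) (t := t) h1)
      omega
  have hNK : ∀ j, t' ∈ N j → j < K := fun j hj => by
    by_contra h
    rw [hN.empty j (by omega)] at hj
    exact hj
  have hlt_of : ∀ i, i ≤ e → (∀ j < i, key K Q N c' t' j = key K Q M c t j) →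
      key K Q N c' t' i < key K Q M c t i → lev K Q N c' t' < lev K Q M c t :=
    fun i hi h1 h2 => digits_lt (key_lt hc') (by omega) h1 h2
  have hkle : next K N t' e ≤ next K M t e ∧
      (next K M t e < K → ¬ fl → next K N t' e < next K M t e) := by
    rcases next_cases K M t e with h | ⟨h1, h2⟩
    · rw [h]; exact ⟨next_le, fun h => absurd h (lt_irrefl _)⟩
    · have h3 : next K M t e < L := by
        by_contra h
        rw [hM _ (not_lt.1 h)] at h2
        exact h2
      rcases hN.mem t' _ ((ht _ h3).2 h2) h1 with ⟨f, h4⟩ | ⟨j, h4, h5, h6, h7⟩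
      · refine ⟨(next_le_of_mem le_rfl ?_).trans h1, fun _ h => absurd f h⟩
        rw [hN.eq_flash f]; exact h4
      · have h8 := next_le_of_mem (K := K) h4 h6
        exact ⟨h8.trans h5, fun _ f => h8.trans_lt (h7 f h3)⟩
  rcases hkle.1.lt_or_eq with hlt | heq
  · suffices h : lev K Q N c' t' < lev K Q M c t from ⟨h.le, fun _ => h⟩
    refine hlt_of i0 hi0e hA ?_
    have h1 : next K M t i0 = next K M t e := hBM i0 le_rfl hi0e
    have h2 : next K N t' i0 = next K N t' e := hBN i0 le_rfl hi0e
    have h3 : next K M t e ≤ K := next_le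
    unfold key
    rw [h1, h2, if_neg (by omega)]
    have h4 := hc' i0
    have h5 : (next K N t' e + 1) * (Q + 1) ≤ next K M t e * (Q + 1) :=
      Nat.mul_le_mul_right _ hlt
    rw [add_mul] at h5
    split_ifs with h6
    · rw [h6] at h5; omega
    · omega
  · rcases (next_le (K := K) (M := M) (t := t) (i := e)).lt_or_eq with hK | hK
    · have f : fl := by
        by_contra f
        have := hkle.2 hK f
        omega
      suffices h : lev K Q N c' t' < lev K Q M c t from ⟨h.le, fun _ => h⟩
      refine hlt_of e le_rfl (fun j hj => ?_) ?_
      · by_cases h1 : j < i0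
        · exact hA j h1
        · unfold key
          rw [hBM j (by omega) (by omega), hBN j (by omega) (by omega), heq, hce j hj]
      · unfold key
        rw [heq, if_neg (by omega), if_neg (by omega)]
        have := hcf f
        omega
    · refine ⟨(digits_congr fun j hj => ?_).le, ?_⟩
      · by_cases h1 : j < i0
        · exact hA j h1
        have h2 : next K M t j = K ∧ next K N t' j = K := by
          by_cases h2 : j ≤ e
          · rw [hBM j (by omega) h2, hBN j (by omega) h2]; omega
          · have h3 := next_mono (K := K) (M := M) (t := t) (i := e) (j := j) (by omega)
            have h4 := next_mono (K := K) (M := N) (t := t') (i := e) (j := j) (by omega)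
            exact ⟨le_antisymm next_le (by omega), le_antisymm next_le (by omega)⟩
        unfold key
        rw [if_pos h2.1, if_pos h2.2]
      · rintro ⟨k, hk, hkR⟩
        exfalso
        rcases hN.mem t' k hkR (by omega) with ⟨f, h4⟩ | ⟨j, h4, -, h6, -⟩
        · have h5 : t' ∈ N e := by rw [hN.eq_flash f]; exact h4
          have := next_le_of_mem (K := K) le_rfl h5
          have := hNK e h5
          omega
        · have := next_le_of_mem (K := K) h4 h6
          have := hNK j h6
          omega

end Names

/-! ### Arenas and guarded positions -/

open Ordinal in
/-- The abstract situation in which a tree is rebuilt. `S` is the set of states of a tree, `τ s`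
the type of `s`; `I` is the set of obligations, `Δ` selects those of countable rank `u s ι`;
`At T y` is the set of obligations into which `y` splits at states of type `T`, and `ι` demands
`Y ι`. `pers s r ι` inherits limit ranks from `s` to its successor `r`; `Tr s r` is one step of
a trace, along which ranks decrease. -/
structure PreArena (I X T : Type) where
  S : Type
  succ : S → S → Prop
  τ : S → T
  Δ : T → Set I
  Y : I → Set X
  At : T → X → I → Prop
  u : S → I → Ordinal.{0}
  pers : S → S → I → I
  Tr : S → S → I → I → Prop
  mem_Δ : ∀ s ι, ι ∈ Δ (τ s) ↔ u s ι < ω_ 1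
  u_le : ∀ s ι, u s ι ≤ ω_ 1
  pers_spec : ∀ s r ι l, succ s r → Order.IsSuccLimit l → l ≤ u s ι →
    (∃ y ∈ Y ι, At (τ r) y (pers s r ι)) ∧ l ≤ u r (pers s r ι)
  birth_spec : ∀ s ι y β, y ∈ Y ι → 0 < β → β < u s ι →
    ∃ r ι', succ s r ∧ At (τ r) y ι' ∧ β ≤ u r ι'
  tr_lt : ∀ s r ι ι', succ s r → Tr s r ι ι' → u r ι' < u s ι

/-- An arena with a finite set `G` of summaries of finite paths (with `one` for the empty path and
`ext` for prolongation by one edge); `Valid a g s` says that the state `s` is as good as the end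
of a path from `a` with summary `g`, and `tr g` is the trace relation of a path with that
summary. -/
structure Arena (I X T G : Type) extends PreArena I X T where
  one : G
  ext : G → S → S → G
  Valid : S → G → S → Prop
  tr : G → I → I → Prop
  valid_one : ∀ s, Valid s one s
  valid_ext : ∀ a g s r, Valid a g s → succ s r → Valid a (ext g s r) r
  tr_one : ∀ ι, tr one ι ι
  tr_ext : ∀ g s r ι ι' ι'', tr g ι ι' → Tr s r ι' ι'' → tr (ext g s r) ι ι''
  tr_le : ∀ a g s ι ι', Valid a g s → tr g ι ι' → u s ι' ≤ u a ι

/-- The origin of an obligation in a new state: none, inheritance from an old obligation, a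
request by an old obligation, or a request by an obligation of uncountable rank. -/
inductive Org (I : Type)
  | none
  | pers (ι : I)
  | born (ι : I)
  | base

namespace Org

/-- The old obligation from which an obligation originates. -/
def src {I : Type} : Org I → I → Prop
  | none, _ => False
  | pers ι, κ => ι = κ
  | born ι, κ => ι = κ
  | base, _ => False

theorem src_unique {I : Type} {o : Org I} {ι κ : I} (h : o.src ι) (h' : o.src κ) : ι = κ := by
  cases o <;> simp_all [src]

instance {I : Type} [Finite I] : Finite (Org I) := by
  refine Finite.of_injective (β := Option I ⊕ Option I) (fun o => match o with
    | none => .inl Option.none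
    | pers ι => .inl (some ι)
    | born ι => .inr (some ι)
    | base => .inr Option.none) ?_
  intro a b h
  cases a <;> cases b <;> simp_all

end Org

/-- A guarded position: a state `s` with its active obligations, which are frozen (with the
nonempty set `Z ι` of traces that have to end before `ι` is released) or belong to some of the
names `M 0, …, M (L - 1)`. Before the `i`-th name stands the anchor `a i`, a former state, and
the summary `g i` of the path since then. From index `L` on, the names are empty and the anchors
are `s` itself. -/
structure Pos (S I G : Type) where
  s : S
  Z : I → Set I
  L : ℕ
  M : ℕ → Set I
  a : ℕ → S
  g : ℕ → G

namespace Arena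

open Ordinal

variable {I X T G : Type} [Fintype I] (A : Arena I X T G)

/-- The finite part of a position. -/
abbrev Shape (I T G : Type) [Fintype I] : Type :=
  T × (I → Set I) × (Fin (Fintype.card I) → Set I) × (Fin (Fintype.card I) → G)

/-- The shape of a position: all of it except the concrete states. -/
def shape (p : Pos A.S I G) : Shape I T G := (A.τ p.s, p.Z, fun i => p.M i, fun i => p.g i)

/-- The number of shapes, which bounds the number of flashes between two resets. -/
noncomputable def shapes (I T G : Type) [Fintype I] : ℕ := Nat.card (Shape I T G)

/-- A bound on the levels. -/
noncomputable def levBound (I T G : Type) [Fintype I] : ℕ :=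
  (Fintype.card I * (shapes I T G + 1) + 1) ^ (Fintype.card I + 1)

/-- The level of an obligation at a position, with the sets `Sn i` of shapes seen so far. -/
noncomputable def lvl (p : Pos A.S I G) (Sn : ℕ → Set (Shape I T G)) (t : I) : ℕ :=
  Names.lev (Fintype.card I) (shapes I T G) p.M (fun i => shapes I T G - (Sn i).ncard) t

theorem lvl_le (p : Pos A.S I G) (Sn : ℕ → Set (Shape I T G)) (t : I) :
    A.lvl p Sn t ≤ levBound I T G := Names.lev_le fun _ => Nat.sub_le _ _

/-- Consistency of a position: ranks of active obligations are high enough for their level. -/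
structure Fit (p : Pos A.S I G) (Sn : ℕ → Set (Shape I T G)) : Prop where
  valid : ∀ i, A.Valid (p.a i) (p.g i) p.s
  anchor : ∀ i ≥ p.L, p.a i = p.s ∧ p.g i = A.one
  empty : ∀ i ≥ p.L, p.M i = ∅
  owner : ∀ i < p.L, ∃ t ∈ p.M i, ∀ j > i, t ∉ p.M j
  excl : ∀ i, ∀ t ∈ p.M i, p.Z t = ∅
  mem_Δ : ∀ i, ∀ t ∈ p.M i, t ∈ A.Δ (A.τ p.s)
  mem_Δ' : ∀ t, (p.Z t).Nonempty → t ∈ A.Δ (A.τ p.s)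
  /-- The fuel of a named obligation suffices for as many births as its level. -/
  named : ∀ i, ∀ t ∈ p.M i, ω * ((A.lvl p Sn t : Ordinal) + 1) ≤ A.u p.s t
  /-- The fuel of a frozen obligation suffices for any level, and for as many births as there can
  be edges before the traces in `Z t` have ended. -/
  frozen : ∀ t, (p.Z t).Nonempty → ∃ η, (∀ w ∈ p.Z t, A.u p.s w < η) ∧
    ω * ((levBound I T G : Ordinal) + 1 + η) ≤ A.u p.s t

/-- A position with sets of shapes is good if it is consistent and every shape recorded at an
index belongs to a good position with the same anchors up to that index. The definition is
coinductive. -/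
def Good (p : Pos A.S I G) (Sn : ℕ → Set (Shape I T G)) : Prop :=
  ∃ 𝒵 : Set (Pos A.S I G × (ℕ → Set (Shape I T G))), (p, Sn) ∈ 𝒵 ∧ ∀ x ∈ 𝒵, A.Fit x.1 x.2 ∧
    ∀ i, ∀ F ∈ x.2 i, ∃ y ∈ 𝒵, A.shape y.1 = F ∧ (∀ j ≤ i, y.1.a j = x.1.a j) ∧
      ∀ j > i, y.1.a j = y.1.s

variable {A}

theorem Good.fit {p : Pos A.S I G} {Sn : ℕ → Set (Shape I T G)} (h : A.Good p Sn) :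
    A.Fit p Sn := by
  obtain ⟨𝒵, h1, h2⟩ := h
  exact (h2 _ h1).1

theorem Good.stored {p : Pos A.S I G} {Sn : ℕ → Set (Shape I T G)} (h : A.Good p Sn) {i : ℕ}
    {F : Shape I T G} (hF : F ∈ Sn i) : ∃ q Sq, A.Good q Sq ∧ A.shape q = F ∧
      (∀ j ≤ i, q.a j = p.a j) ∧ ∀ j > i, q.a j = q.s := by
  obtain ⟨𝒵, h1, h2⟩ := h
  obtain ⟨⟨q, Sq⟩, h3, h4, h5, h6⟩ := (h2 _ h1).2 i F hF
  exact ⟨q, Sq, ⟨𝒵, h3, h2⟩, h4, h5, h6⟩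

/-- The coinduction rule for good positions. -/
theorem Good.intro {p : Pos A.S I G} {Sn : ℕ → Set (Shape I T G)} (hf : A.Fit p Sn)
    (h : ∀ i, ∀ F ∈ Sn i, ∃ q Sq, ((q = p ∧ Sq = Sn) ∨ A.Good q Sq) ∧ A.shape q = F ∧
      (∀ j ≤ i, q.a j = p.a j) ∧ ∀ j > i, q.a j = q.s) : A.Good p Sn := by
  refine ⟨insert (p, Sn) {x | A.Good x.1 x.2}, mem_insert _ _, ?_⟩
  rintro x (rfl | hx)
  · refine ⟨hf, fun i F hF => ?_⟩
    obtain ⟨q, Sq, h1, h2⟩ := h i F hF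
    refine ⟨(q, Sq), h1.elim (fun h => Or.inl (by rw [h.1, h.2])) Or.inr, h2⟩
  · refine ⟨Good.fit hx, fun i F hF => ?_⟩
    obtain ⟨q, Sq, h1, h2⟩ := Good.stored hx hF
    exact ⟨(q, Sq), Or.inr h1, h2⟩

theorem Fit.length_le {p : Pos A.S I G} {Sn : ℕ → Set (Shape I T G)} (h : A.Fit p Sn) :
    p.L ≤ Fintype.card I := Names.length_le h.owner

variable (A)

/-- A position is admissible if it is good for some history. -/
def Adm (p : Pos A.S I G) : Prop := ∃ Sn, A.Good p Sn

/-- Active obligations. -/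
def Thread (p : Pos A.S I G) (ι : I) : Prop := (∃ i, ι ∈ p.M i) ∨ (p.Z ι).Nonempty

/-- The traces that keep an obligation frozen after an edge. -/
def newZ (p : Pos A.S I G) (r : A.S) (org : I → Org I) (t : I) : Set I :=
  {w' | t ∈ A.Δ (A.τ r) ∧ ((∃ ι, (org t).src ι ∧ ∃ w ∈ p.Z ι, A.Tr p.s r w w') ∨
    (org t = .base ∧ ∃ w ∈ A.Δ (A.τ p.s), A.Tr p.s r w w'))}

/-- Obligations that get a name of their own. -/
def IsNew (p : Pos A.S I G) (r : A.S) (org : I → Org I) (t : I) : Prop :=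
  (∃ ι i, org t = .born ι ∧ ι ∈ p.M i) ∨
    (A.newZ p r org t = ∅ ∧ ((∃ ι, (org t).src ι ∧ (p.Z ι).Nonempty) ∨ org t = .base))

/-- The names after an edge, before normalisation. -/
noncomputable def raw (p : Pos A.S I G) (r : A.S) (org : I → Org I) (i : ℕ) : Set I :=
  {t | t ∈ A.Δ (A.τ r) ∧ ((i < p.L ∧ ∃ ι ∈ p.M i, (org t).src ι) ∨
    (i = p.L + Fintype.equivFin I t ∧ A.IsNew p r org t))}

/-- The conditions on origins under which an edge leads to an admissible position. -/
structure OrgOK (p : Pos A.S I G) (Sn : ℕ → Set (Shape I T G)) (r : A.S) (org : I → Org I) :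
    Prop where
  pers : ∀ t ι, org t = .pers ι → A.pers p.s r ι = t
  born : ∀ t ι i, org t = .born ι → ι ∈ p.M i → ω * (A.lvl p Sn ι : Ordinal) ≤ A.u r t
  born' : ∀ t ι, org t = .born ι → (p.Z ι).Nonempty → ∃ η, (∀ w ∈ p.Z ι, A.u p.s w ≤ η) ∧
    ω * ((levBound I T G : Ordinal) + 1 + η) ≤ A.u r t
  base : ∀ t, org t = .base → ∃ η, (∀ w ∈ A.Δ (A.τ p.s), A.u p.s w ≤ η) ∧
    ω * ((levBound I T G : Ordinal) + 1 + η) ≤ A.u r t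

open Classical in
/-- The position chosen as the response to a flash: it depends only on the shape to be attained,
the index of the flash and the anchors up to that index. -/
noncomputable def resp (F : Shape I T G) (e : ℕ) (α : ℕ → A.S) : Option (Pos A.S I G) :=
  if h : ∃ q, A.Adm q ∧ A.shape q = F ∧ (∀ j ≤ e, q.a j = α j) ∧ ∀ j > e, q.a j = q.s then
    some h.choose else none

/-- The sequence `a` cut off after the index `e`: a normal form for its restriction to the indices
up to `e`. -/
def cut {S : Type} (a : ℕ → S) (e j : ℕ) : S := if j ≤ e then a j else a 0

/-- The position `q` results from `p` by the edge to `r` with the given origins; the event at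
index `e` is a flash if `fl`. After a flash, `q` may be at another state of the type of `r`. The
anchors before the event are kept, the others are renewed. -/
structure Step (p : Pos A.S I G) (r : A.S) (org : I → Org I) (e : ℕ) (fl : Prop)
    (q : Pos A.S I G) : Prop where
  adm : A.Adm q
  norm : ∃ L', Names.Norm (A.raw p r org) p.L e fl q.M L'
  Z : q.Z = A.newZ p r org
  type : A.τ q.s = A.τ r
  kept : ∀ i, (i < e ∨ fl ∧ i = e) → q.a i = p.a i ∧ q.g i = A.ext (p.g i) p.s r
  fresh : ∀ i, ¬ (i < e ∨ fl ∧ i = e) → q.a i = q.s ∧ q.g i = A.one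
  state : ¬ fl → q.s = r
  canon : fl → ∃ F, A.resp F e (cut p.a e) = some q

variable {A}

theorem isSuccLimit_omega_mul {o : Ordinal} (h : 0 < o) : Order.IsSuccLimit (ω * o) :=
  isSuccLimit_mul_left isSuccLimit_omega0 h

/-- Every edge of the given tree leads to an admissible position. At a flash whose shape has been
recorded at the same index, a position with that shape is revisited; any other flash records its
shape, which lowers the counter of its index. -/
theorem exists_step [Finite T] [Finite G] {p : Pos A.S I G} {Sn : ℕ → Set (Shape I T G)}
    {r : A.S} {org : I → Org I} (hp : A.Good p Sn) (hr : A.succ p.s r)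
    (ho : A.OrgOK p Sn r org) : ∃ e fl q, A.Step p r org e fl q := by
  classical
  have fit := hp.fit
  obtain ⟨e, fl, N, L', hN⟩ := Names.exists_norm (A.raw p r org) p.L
    (p.L + Fintype.card I) (by
      intro i hi
      refine eq_empty_of_forall_notMem ?_
      rintro t ⟨-, h | h⟩
      · omega
      · have := (Fintype.equivFin I t).2
        omega)
  have hL' : L' ≤ Fintype.card I := Names.length_le hN.owner
  let q : Pos A.S I G := ⟨r, A.newZ p r org, L', N,
    fun i => if i < e ∨ fl ∧ i = e then p.a i else r,
    fun i => if i < e ∨ fl ∧ i = e then A.ext (p.g i) p.s r else A.one⟩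
  have hraw : ∀ i, ∀ t ∈ q.M i, ∃ k, t ∈ A.raw p r org k := by
    intro i t ht
    by_cases h : i < e
    · exact ⟨i, by rw [← hN.eq i h]; exact ht⟩
    · obtain ⟨k, -, hk⟩ := hN.of_mem i (not_lt.1 h) t ht
      exact ⟨k, hk⟩
  have hsrc : ∀ t ι i, t ∈ A.Δ (A.τ r) → (org t).src ι → i < p.L →
      (t ∈ A.raw p r org i ↔ ι ∈ p.M i) := by
    intro t ι i htΔ hs hi
    constructor
    · rintro ⟨-, ⟨-, κ, hκ, h⟩ | h⟩
      · rwa [Org.src_unique hs h]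
      · omega
    · exact fun h => ⟨htΔ, Or.inl ⟨hi, ι, h, hs⟩⟩
  have hMlt : ∀ ι i, ι ∈ p.M i → i < p.L := by
    intro ι i h
    by_contra hi
    rw [fit.empty i (not_lt.1 hi)] at h
    exact h
  have htr : ∀ w w', A.Tr p.s r w w' → A.u r w' < A.u p.s w := fun w w' => A.tr_lt _ _ _ _ hr
  -- an active obligation outside all old names has a rank beyond all levels
  have hfrozen : ∀ t, t ∈ A.Δ (A.τ r) → ((∃ ι, (org t).src ι ∧ (p.Z ι).Nonempty) ∨
      org t = .base) → ∃ η, (∀ w ∈ q.Z t, A.u r w < η) ∧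
        ω * ((levBound I T G : Ordinal) + 1 + η) ≤ A.u r t := by
    rintro t - (⟨ι, hs, hZ⟩ | hb)
    · have hZ' : ∀ w' ∈ q.Z t, ∃ w ∈ p.Z ι, A.Tr p.s r w w' := by
        rintro w' ⟨-, ⟨κ, h1, h2⟩ | ⟨h1, -⟩⟩
        · rwa [Org.src_unique hs h1]
        · rw [h1] at hs; exact hs.elim
      cases horg : org t with
      | none => rw [horg] at hs; exact hs.elim
      | base => rw [horg] at hs; exact hs.elim
      | pers κ =>
        rw [horg] at hs
        obtain rfl : κ = ι := hs
        obtain ⟨η, h1, h2⟩ := fit.frozen κ hZ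
        refine ⟨η, fun w' hw' => ?_, ?_⟩
        · obtain ⟨w, hw, hww⟩ := hZ' w' hw'
          exact (htr _ _ hww).trans (h1 w hw)
        · have := (A.pers_spec p.s r κ _ hr (isSuccLimit_omega_mul
            (zero_lt_one.trans_le (le_add_self.trans le_self_add))) h2).2
          rwa [ho.pers t κ horg] at this
      | born κ =>
        rw [horg] at hs
        obtain rfl : κ = ι := hs
        obtain ⟨η, h1, h2⟩ := ho.born' t κ horg hZ
        refine ⟨η, fun w' hw' => ?_, h2⟩
        obtain ⟨w, hw, hww⟩ := hZ' w' hw'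
        exact (htr _ _ hww).trans_le (h1 w hw)
    · obtain ⟨η, h1, h2⟩ := ho.base t hb
      refine ⟨η, ?_, h2⟩
      rintro w' ⟨-, ⟨κ, h3, -⟩ | ⟨-, w, hw, hww⟩⟩
      · rw [hb] at h3; exact h3.elim
      · exact (htr _ _ hww).trans_le (h1 w hw)
  -- the levels do not increase, so the fuel suffices at the new position
  have hfit : ∀ Sq : ℕ → Set (Shape I T G), (∀ i < e, Sq i = Sn i) →
      (fl → shapes I T G - (Sq e).ncard < shapes I T G - (Sn e).ncard) → A.Fit q Sq := by
    intro Sq hSq hSe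
    refine ⟨?_, ?_, hN.empty, hN.owner, ?_, ?_, ?_, ?_, ?_⟩
    · intro i
      by_cases h : i < e ∨ fl ∧ i = e
      · simp only [q, if_pos h]
        exact A.valid_ext _ _ _ _ (fit.valid i) hr
      · simp only [q, if_neg h]
        exact A.valid_one r
    · intro i hi
      have h : ¬ (i < e ∨ fl ∧ i = e) := by
        have h1 := hN.le'
        have h2 : i ≥ L' := hi
        rintro (h | ⟨f, h⟩)
        · omega
        · have := hN.lt' f
          omega
      simp only [q, if_neg h, and_self]
    · intro i t ht
      obtain ⟨k, htΔ, ⟨hk, ι, hι, hs⟩ | ⟨-, ⟨ι, j, hb, hj⟩ | ⟨h, -⟩⟩⟩ := hraw i t ht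
      · refine eq_empty_of_forall_notMem ?_
        rintro w' ⟨-, ⟨κ, h1, w, hw, -⟩ | ⟨h1, -⟩⟩
        · rw [← Org.src_unique hs h1, fit.excl k ι hι] at hw
          exact hw
        · rw [h1] at hs; exact hs.elim
      · refine eq_empty_of_forall_notMem ?_
        rintro w' ⟨-, ⟨κ, h1, w, hw, -⟩ | ⟨h1, -⟩⟩
        · rw [hb] at h1
          rw [← show ι = κ from h1, fit.excl j ι hj] at hw
          exact hw
        · rw [h1] at hb; cases hb
      · exact h
    · intro i t ht
      obtain ⟨k, htΔ, -⟩ := hraw i t ht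
      exact htΔ
    · rintro t ⟨w, hw, -⟩
      exact hw
    · intro i t ht
      obtain ⟨k, htk⟩ := hraw i t ht
      have hlev : ∀ ι, (org t).src ι → A.lvl q Sq t ≤ A.lvl p Sn ι ∧
          ((∃ k ≥ p.L, t ∈ A.raw p r org k) → A.lvl q Sq t < A.lvl p Sn ι) := by
        intro ι hs
        refine Names.lev_step hN fit.length_le hL' fit.empty (fun _ => Nat.sub_le _ _) ?_ hSe
          (fun i hi => hsrc t ι i htk.1 hs hi)
        intro i hi
        simp only [hSq i hi]
      have hcase : (∃ ι j, (org t).src ι ∧ ι ∈ p.M j) ∨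
          ((∃ ι, (org t).src ι ∧ (p.Z ι).Nonempty) ∨ org t = .base) := by
        obtain ⟨-, ⟨hk, ι, hι, hs⟩ | ⟨-, ⟨ι, j, hb, hj⟩ | ⟨-, h⟩⟩⟩ := htk
        · exact Or.inl ⟨ι, k, hs, hι⟩
        · exact Or.inl ⟨ι, j, by rw [hb]; rfl, hj⟩
        · exact Or.inr h
      rcases hcase with ⟨ι, j, hs, hj⟩ | hcase
      · cases horg : org t with
        | none => rw [horg] at hs; exact hs.elim
        | base => rw [horg] at hs; exact hs.elim
        | pers κ =>
          have hs' := hs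
          rw [horg] at hs'
          obtain rfl : κ = ι := hs'
          have h1 := (A.pers_spec p.s r κ _ hr (isSuccLimit_omega_mul
            (zero_lt_one.trans_le le_add_self)) (fit.named j κ hj)).2
          rw [ho.pers t κ horg] at h1
          refine le_trans ?_ h1
          have := (hlev κ hs).1
          gcongr
        | born κ =>
          have hs' := hs
          rw [horg] at hs'
          obtain rfl : κ = ι := hs'
          refine le_trans ?_ (ho.born t κ j horg hj)
          have := (hlev κ hs).2 ⟨p.L + Fintype.equivFin I t, by omega, htk.1,
            Or.inr ⟨rfl, Or.inl ⟨κ, j, horg, hj⟩⟩⟩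
          have h2 : ((A.lvl q Sq t : ℕ) : Ordinal) + 1 ≤ (A.lvl p Sn κ : Ordinal) := by
            exact_mod_cast this
          gcongr
      · obtain ⟨η, -, h⟩ := hfrozen t htk.1 hcase
        refine le_trans ?_ h
        have h1 := A.lvl_le q Sq t
        have h2 : ((A.lvl q Sq t : ℕ) : Ordinal) + 1 ≤ (levBound I T G : Ordinal) + 1 + η := by
          refine le_trans ?_ le_self_add
          gcongr
        gcongr
    · intro t ht
      have h1 : t ∈ A.Δ (A.τ r) := by
        obtain ⟨w, hw, -⟩ := ht
        exact hw
      refine hfrozen t h1 ?_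
      obtain ⟨w', -, ⟨ι, h2, w, hw, -⟩ | ⟨h2, -⟩⟩ := ht
      · exact Or.inl ⟨ι, h2, w, hw⟩
      · exact Or.inr h2
  -- the position itself is admissible unless its shape has been recorded at the same index
  have hself : ¬ (fl ∧ A.shape q ∈ Sn e) → A.Adm q := by
    intro hnot
    let Sq : ℕ → Set (Shape I T G) := fun i => if i < e then Sn i else
      if fl ∧ i = e then insert (A.shape q) (Sn e) else ∅
    refine ⟨Sq, Good.intro (hfit Sq (fun i hi => by simp only [Sq, if_pos hi]) ?_) ?_⟩
    · intro f
      have h1 : Sq e = insert (A.shape q) (Sn e) := by simp [Sq, f]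
      have h2 : A.shape q ∉ Sn e := fun h => hnot ⟨f, h⟩
      have h3 : (insert (A.shape q) (Sn e)).ncard ≤ shapes I T G := by
        rw [shapes, ← ncard_univ]
        exact ncard_le_ncard (subset_univ _) (toFinite _)
      rw [h1]
      rw [ncard_insert_of_notMem h2 (toFinite _)] at h3 ⊢
      omega
    · intro i F hF
      by_cases h1 : i < e
      · simp only [Sq, if_pos h1] at hF
        obtain ⟨q', Sq', h2, h3, h4, h5⟩ := hp.stored hF
        refine ⟨q', Sq', Or.inr h2, h3, fun j hj => ?_, h5⟩
        have h6 : j < e ∨ fl ∧ j = e := Or.inl (by omega)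
        simp only [q, if_pos h6]
        exact h4 j hj
      · simp only [Sq, if_neg h1] at hF
        split_ifs at hF with h2
        · obtain ⟨f, rfl⟩ := h2
          rcases hF with rfl | hF
          · refine ⟨q, Sq, Or.inl ⟨rfl, rfl⟩, rfl, fun j _ => rfl, fun j hj => ?_⟩
            have h6 : ¬ (j < i ∨ fl ∧ j = i) := by omega
            simp only [q, if_neg h6]
          · obtain ⟨q', Sq', h2, h3, h4, h5⟩ := hp.stored hF
            refine ⟨q', Sq', Or.inr h2, h3, fun j hj => ?_, h5⟩
            have h6 : j < i ∨ fl ∧ j = i := by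
              rcases hj.lt_or_eq with h | h
              · exact Or.inl h
              · exact Or.inr ⟨f, h⟩
            simp only [q, if_pos h6]
            exact h4 j hj
        · exact hF.elim
  by_cases f : fl
  · have hex : ∃ q', A.Adm q' ∧ A.shape q' = A.shape q ∧ (∀ j ≤ e, q'.a j = cut p.a e j) ∧
        ∀ j > e, q'.a j = q'.s := by
      by_cases hS : A.shape q ∈ Sn e
      · obtain ⟨q', Sq', h2, h3, h4, h5⟩ := hp.stored hS
        exact ⟨q', ⟨Sq', h2⟩, h3, fun j hj => by rw [cut, if_pos hj]; exact h4 j hj, h5⟩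
      · refine ⟨q, hself fun h => hS h.2, rfl, fun j hj => ?_, fun j hj => ?_⟩
        · have h6 : j < e ∨ fl ∧ j = e := by
            rcases hj.lt_or_eq with h | h
            · exact Or.inl h
            · exact Or.inr ⟨f, h⟩
          simp only [q, if_pos h6, cut, if_pos hj]
        · have h6 : ¬ (j < e ∨ fl ∧ j = e) := by omega
          simp only [q, if_neg h6]
    have hresp : A.resp (A.shape q) e (cut p.a e) = some hex.choose := dif_pos hex
    obtain ⟨h1, h2, h3, h4⟩ := hex.choose_spec
    generalize hex.choose = q' at hresp h1 h2 h3 h4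
    obtain ⟨Sq', hq'⟩ := h1
    have fit' := hq'.fit
    have hL'' := fit'.length_le
    simp only [shape, Prod.mk.injEq, funext_iff] at h2
    obtain ⟨h5, h6, h7, h8⟩ := h2
    have hM : q'.M = N := by
      funext i
      by_cases hi : i < Fintype.card I
      · exact h7 ⟨i, hi⟩
      · rw [fit'.empty i (by omega), hN.empty i (by omega)]
    have hg : ∀ i, q'.g i = q.g i := by
      intro i
      by_cases hi : i < Fintype.card I
      · exact h8 ⟨i, hi⟩
      · rw [(fit'.anchor i (by omega)).2]
        have := hN.lt' f
        have h6 : ¬ (i < e ∨ fl ∧ i = e) := by omega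
        simp only [q, if_neg h6]
    refine ⟨e, fl, q', ⟨Sq', hq'⟩, ⟨L', by rw [hM]; exact hN⟩, funext h6, h5, fun i hi => ?_,
      fun i hi => ?_, fun h => absurd f h, fun _ => ⟨_, hresp⟩⟩
    · rw [hg i]
      simp only [q, if_pos hi, and_true]
      have hi' : i ≤ e := by omega
      rw [h3 i hi', cut, if_pos hi']
    · rw [hg i]
      simp only [q, if_neg hi, and_true]
      refine h4 i ?_
      by_contra h
      rcases (not_lt.1 h).lt_or_eq with h | h
      · exact hi (Or.inl h)
      · exact hi (Or.inr ⟨f, h⟩)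
  · refine ⟨e, fl, q, hself fun h => f h.1, ⟨L', hN⟩, rfl, rfl, fun i hi => ?_, fun i hi => ?_,
      fun _ => rfl, fun h => absurd h f⟩
    · simp only [q, if_pos hi, and_self]
    · simp only [q, if_neg hi, and_self]

end Arena

/-! ### Ranks below the first uncountable ordinal -/

section Rank

open Ordinal

theorem isSuccLimit_omega_one : Order.IsSuccLimit (ω_ 1) := by
  rw [← Cardinal.ord_aleph]
  exact Cardinal.isSuccLimit_ord (Cardinal.aleph0_le_aleph 1)

/-- The ordinals up to the first uncountable one, as a small type, since the states of a frame form
a type in the lowest universe. -/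
abbrev COrd : Type := Shrink.{0} (Iic (ω_ 1 : Ordinal.{0}))

/-- The ordinal represented by an element of `COrd`. -/
noncomputable def COrd.val (a : COrd) : Ordinal.{0} := ((equivShrink _).symm a).1

theorem COrd.val_le (a : COrd) : a.val ≤ ω_ 1 := ((equivShrink _).symm a).2

theorem COrd.exists_val {o : Ordinal.{0}} (h : o ≤ ω_ 1) : ∃ a : COrd, a.val = o :=
  ⟨equivShrink _ ⟨o, h⟩, by simp [COrd.val]⟩

/-- The ordinal with base-`B` digits `y 0, …, y (n - 1)`, most significant digit first. -/
noncomputable def odigits (B : Ordinal.{0}) (y : ℕ → Ordinal.{0}) : ℕ → Ordinal.{0}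
  | 0 => 0
  | n + 1 => B * odigits B y n + y n

theorem odigits_congr {B : Ordinal} {y y' : ℕ → Ordinal} {n : ℕ} (h : ∀ j < n, y' j = y j) :
    odigits B y' n = odigits B y n := by
  induction n with
  | zero => rfl
  | succ n ih => simp only [odigits, ih fun j hj => h j (by omega), h n (by omega)]

theorem odigits_lt {B : Ordinal} {y y' : ℕ → Ordinal} {n i : ℕ} (hB : ∀ j, y' j < B) (hi : i < n)
    (h : ∀ j < i, y' j = y j) (hlt : y' i < y i) : odigits B y' n < odigits B y n := by
  induction n with
  | zero => omega
  | succ n ih =>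
    simp only [odigits]
    rcases (Nat.lt_succ_iff.1 hi).eq_or_lt with rfl | h'
    · rw [odigits_congr h]
      gcongr
    · have h1 := ih h'
      calc B * odigits B y' n + y' n < B * odigits B y' n + B := by gcongr; exact hB n
        _ = B * (odigits B y' n + 1) := by rw [mul_add, mul_one]
        _ ≤ B * odigits B y n := by gcongr; exact Order.add_one_le_of_lt h1
        _ ≤ _ := le_self_add

theorem odigits_lt_omega_one {B : Ordinal} {y : ℕ → Ordinal} (hB : B < ω_ 1)
    (hy : ∀ j, y j < B) (n : ℕ) : odigits B y n < ω_ 1 := by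
  induction n with
  | zero => exact (omega_pos 1)
  | succ n ih =>
    exact isPrincipal_add_omega 1 (isPrincipal_mul_omega 1 hB ih) ((hy n).trans hB)

/-- A relation has ranks below `ω_ 1` if each point can be assigned a countable ordinal in such
a way that this assignment can be continued decreasingly along the relation. -/
theorem exists_rank {α : Type} (D : α → Prop) (R : α → α → Prop)
    (h : ∀ y0, D y0 → ∃ (Inv : α → Ordinal.{0} → Prop) (z0 : Ordinal.{0}), z0 < ω_ 1 ∧
      Inv y0 z0 ∧ ∀ y z y', Inv y z → R y y' → ∃ z' < z, Inv y' z') :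
    ∃ h : α → Ordinal.{0}, (∀ y, D y → h y < ω_ 1) ∧ ∀ y y', D y → R y y' → h y' < h y := by
  classical
  -- the rank in the well-founded part of the converse of `R`
  let r : α → α → Prop := fun y' y => R y y'
  have key : ∀ (Inv : α → Ordinal.{0} → Prop),
      (∀ y z y', Inv y z → R y y' → ∃ z' < z, Inv y' z') →
      ∀ z y, Inv y z → ∃ hy : Acc r y, hy.rank ≤ z := by
    intro Inv hInv z
    induction z using WellFoundedLT.induction with
    | ind z ih =>
      intro y hyz
      have hacc : Acc r y := by
        refine ⟨_, fun y' hy' => ?_⟩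
        obtain ⟨z', hz', h'⟩ := hInv y z y' hyz hy'
        exact (ih z' hz' y' h').1
      refine ⟨hacc, ?_⟩
      rw [Acc.rank_eq]
      refine Ordinal.iSup_le fun ⟨y', hy'⟩ => ?_
      obtain ⟨z', hz', h'⟩ := hInv y z y' hyz hy'
      obtain ⟨_, h2⟩ := ih z' hz' y' h'
      exact Order.succ_le_of_lt (h2.trans_lt hz')
  refine ⟨fun y => if hy : Acc r y then hy.rank else 0, fun y hy => ?_, fun y y' hy hyy' => ?_⟩
  · obtain ⟨Inv, z0, hz0, h1, h2⟩ := h y hy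
    obtain ⟨h3, h4⟩ := key Inv h2 z0 y h1
    beta_reduce
    rw [dif_pos h3]
    exact h4.trans_lt hz0
  · obtain ⟨Inv, z0, hz0, h1, h2⟩ := h y hy
    obtain ⟨h3, -⟩ := key Inv h2 z0 y h1
    beta_reduce
    rw [dif_pos h3, dif_pos (h3.inv hyy')]
    exact Acc.rank_lt_of_rel h3 hyy'

end Rank

/-! ### The graph of annotated positions -/

namespace Arena

open Ordinal Filter

variable {I X T G : Type} [Fintype I] (A : Arena I X T G)

/-- An annotated position: an admissible position, the state to which the last edge leads in
the given tree, and the new ranks of the obligations. -/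
structure St where
  p : Pos A.S I G
  r : A.S
  f : I → COrd

variable {A}

/-- The new rank of an obligation. -/
noncomputable def St.v (x : A.St) (t : I) : Ordinal.{0} := (x.f t).val

/-- Invariants of annotated positions. -/
structure St.OK (x : A.St) : Prop where
  adm : A.Adm x.p
  off : ∀ t ∉ A.Δ (A.τ x.p.s), x.v t = ω_ 1
  lt : ∀ t ∈ A.Δ (A.τ x.p.s), x.v t < ω_ 1
  thread : ∀ t ∈ A.Δ (A.τ x.p.s), x.v t ≠ 0 → A.Thread x.p t

/-- An edge between annotated positions: inherited ranks persist, requested ones are smaller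
than those of the obligation that requests them. -/
structure EdgeAt (x x' : A.St) (org : I → Org I) (e : ℕ) (fl : Prop) : Prop where
  succ : A.succ x.p.s x'.r
  step : A.Step x.p x'.r org e fl x'.p
  off : ∀ t ∉ A.Δ (A.τ x'.r), x'.v t = ω_ 1
  none : ∀ t ∈ A.Δ (A.τ x'.r), org t = .none → x'.v t = 0
  pers : ∀ t ∈ A.Δ (A.τ x'.r), ∀ ι, org t = .pers ι → x'.v t = x.v ι
  born : ∀ t ∈ A.Δ (A.τ x'.r), ∀ ι, org t = .born ι → x'.v t < x.v ι
  base : ∀ t ∈ A.Δ (A.τ x'.r), org t = .base → x'.v t < ω_ 1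
  src : ∀ t ι, (org t).src ι → A.Thread x.p ι
  max : ∀ ι, A.Thread x.p ι → A.pers x.p.s x'.r ι ∈ A.Δ (A.τ x'.r) →
    x.v ι ≤ x'.v (A.pers x.p.s x'.r ι)

/-- The edge relation between annotated positions. -/
def Edge (x x' : A.St) : Prop := ∃ org e fl, EdgeAt x x' org e fl

theorem Thread.mem_Δ {p : Pos A.S I G} (h : A.Adm p) {t : I} (ht : A.Thread p t) :
    t ∈ A.Δ (A.τ p.s) := by
  obtain ⟨Sn, h⟩ := h
  rcases ht with ⟨i, hi⟩ | hZ
  · exact h.fit.mem_Δ i t hi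
  · exact h.fit.mem_Δ' t hZ

section Step

variable {p q : Pos A.S I G} {r : A.S} {org : I → Org I} {e : ℕ} {fl : Prop}

theorem Step.exists_mem (h : A.Step p r org e fl q) {k : ℕ} {t : I}
    (ht : t ∈ A.raw p r org k) : ∃ j, t ∈ q.M j := by
  obtain ⟨L', hN⟩ := h.norm
  by_cases hk : k < e
  · exact ⟨k, by rw [hN.eq k hk]; exact ht⟩
  · rcases hN.mem t k ht (not_lt.1 hk) with ⟨f, h1⟩ | ⟨j, -, -, h1, -⟩
    · exact ⟨e, by rw [hN.eq_flash f]; exact h1⟩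
    · exact ⟨j, h1⟩

theorem Step.exists_raw (h : A.Step p r org e fl q) {k : ℕ} {t : I}
    (ht : t ∈ q.M k) : ∃ j, t ∈ A.raw p r org j := by
  obtain ⟨L', hN⟩ := h.norm
  by_cases hk : k < e
  · exact ⟨k, by rw [← hN.eq k hk]; exact ht⟩
  · obtain ⟨j, -, h1⟩ := hN.of_mem k (not_lt.1 hk) t ht
    exact ⟨j, h1⟩

theorem Step.thread (hp : A.Adm p) (h : A.Step p r org e fl q) {t : I} (ht : t ∈ A.Δ (A.τ r))
    (ho : (∃ ι, (org t).src ι ∧ A.Thread p ι) ∨ org t = .base) : A.Thread q t := by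
  obtain ⟨Sn, hp⟩ := hp
  have hnew : A.IsNew p r org t → A.Thread q t := fun hn =>
    Or.inl (h.exists_mem (k := p.L + Fintype.equivFin I t) ⟨ht, Or.inr ⟨rfl, hn⟩⟩)
  rcases (A.newZ p r org t).eq_empty_or_nonempty with hZ | hZ
  · rcases ho with ⟨ι, h1, ⟨i, hi⟩ | h2⟩ | h1
    · refine Or.inl (h.exists_mem (k := i) ⟨ht, Or.inl ⟨?_, ι, hi, h1⟩⟩)
      by_contra hc
      rw [hp.fit.empty i (not_lt.1 hc)] at hi
      exact hi
    · exact hnew (Or.inr ⟨hZ, Or.inl ⟨ι, h1, h2⟩⟩)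
    · exact hnew (Or.inr ⟨hZ, Or.inr h1⟩)
  · exact Or.inr (by rw [h.Z]; exact hZ)

theorem Step.of_thread (h : A.Step p r org e fl q) {t : I} (ht : A.Thread q t) :
    t ∈ A.Δ (A.τ r) ∧ ((∃ ι, (org t).src ι) ∨ org t = .base) := by
  rcases ht with ⟨i, hi⟩ | hZ
  · obtain ⟨j, h0, ⟨-, ι, -, h1⟩ | ⟨-, ⟨ι, -, h1, -⟩ | ⟨-, ⟨ι, h1, -⟩ | h1⟩⟩⟩ :=
      h.exists_raw hi
    · exact ⟨h0, Or.inl ⟨ι, h1⟩⟩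
    · exact ⟨h0, Or.inl ⟨ι, by rw [h1]; rfl⟩⟩
    · exact ⟨h0, Or.inl ⟨ι, h1⟩⟩
    · exact ⟨h0, Or.inr h1⟩
  · rw [h.Z] at hZ
    obtain ⟨w, h0, ⟨ι, h1, -⟩ | ⟨h1, -⟩⟩ := hZ
    · exact ⟨h0, Or.inl ⟨ι, h1⟩⟩
    · exact ⟨h0, Or.inr h1⟩

/-- A member of an old name that also belongs to a later name did so before or was born. -/
theorem raw_raw {Sn : ℕ → Set (Shape I T G)} (hp : A.Fit p Sn) {i k : ℕ} {t : I} (hi : i < p.L)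
    (h : t ∈ A.raw p r org i) (h' : t ∈ A.raw p r org k) :
    ∃ ι ∈ p.M i, (org t).src ι ∧ (ι ∈ p.M k ∨ org t = .born ι) := by
  obtain ⟨-, ⟨-, ι, hι, hs⟩ | ⟨h1, -⟩⟩ := h
  · refine ⟨ι, hι, hs, ?_⟩
    obtain ⟨-, ⟨-, κ, hκ, hs'⟩ | ⟨-, ⟨κ, j, hb, -⟩ | ⟨-, ⟨κ, hs', hZ⟩ | hb⟩⟩⟩ := h'
    · exact Or.inl (by rwa [Org.src_unique hs hs'])
    · refine Or.inr ?_
      rw [hb] at hs ⊢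
      rw [show κ = ι from hs]
    · rw [← Org.src_unique hs hs', hp.excl i ι hι] at hZ
      exact absurd hZ not_nonempty_empty
    · rw [hb] at hs; exact hs.elim
  · omega

end Step

theorem EdgeAt.ok {x x' : A.St} {org : I → Org I} {e : ℕ} {fl : Prop} (hx : x.OK)
    (h : EdgeAt x x' org e fl) : x'.OK := by
  refine ⟨h.step.adm, ?_, ?_, ?_⟩
  · rw [h.step.type]; exact h.off
  · rw [h.step.type]
    intro t ht
    cases horg : org t with
    | none => rw [h.none t ht horg]; exact omega_pos 1
    | base => exact h.base t ht horg
    | pers ι =>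
      rw [h.pers t ht ι horg]
      exact hx.lt ι (Thread.mem_Δ hx.adm (h.src t ι (by rw [horg]; rfl)))
    | born ι => exact (h.born t ht ι horg).trans_le (COrd.val_le _)
  · rw [h.step.type]
    intro t ht hv
    refine h.step.thread hx.adm ht ?_
    cases horg : org t with
    | none => exact absurd (h.none t ht horg) hv
    | base => exact Or.inr rfl
    | pers ι => exact Or.inl ⟨ι, rfl, h.src t ι (by rw [horg]; rfl)⟩
    | born ι => exact Or.inl ⟨ι, rfl, h.src t ι (by rw [horg]; rfl)⟩

/-- The bound for the rank of an active obligation that is a limit. -/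
theorem Thread.exists_limit {p : Pos A.S I G} {Sn : ℕ → Set (Shape I T G)} (hp : A.Fit p Sn)
    {t : I} (ht : A.Thread p t) : ∃ l, Order.IsSuccLimit l ∧ l ≤ A.u p.s t := by
  rcases ht with ⟨i, hi⟩ | hZ
  · exact ⟨_, isSuccLimit_omega_mul (zero_lt_one.trans_le le_add_self), hp.named i t hi⟩
  · obtain ⟨η, -, h⟩ := hp.frozen t hZ
    exact ⟨_, isSuccLimit_omega_mul (zero_lt_one.trans_le (le_add_self.trans le_self_add)), h⟩

/-- New ranks persist along edges. -/
theorem EdgeAt.persist {x x' : A.St} {org : I → Org I} {e : ℕ} {fl : Prop} (hx : x.OK)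
    (h : EdgeAt x x' org e fl) {ι : I} (hι : 0 < x.v ι) :
    ∃ y ∈ A.Y ι, ∃ ι', A.At (A.τ x'.p.s) y ι' ∧ x.v ι ≤ x'.v ι' := by
  rw [h.step.type]
  by_cases hΔ : ι ∈ A.Δ (A.τ x.p.s)
  · have ht := hx.thread ι hΔ hι.ne'
    obtain ⟨Sn, hp⟩ := hx.adm
    obtain ⟨l, hl, hl'⟩ := ht.exists_limit hp.fit
    obtain ⟨⟨y, hy, h1⟩, -⟩ := A.pers_spec _ _ ι l h.succ hl hl'
    refine ⟨y, hy, _, h1, ?_⟩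
    by_cases h2 : A.pers x.p.s x'.r ι ∈ A.Δ (A.τ x'.r)
    · exact h.max ι ht h2
    · rw [h.off _ h2]; exact COrd.val_le _
  · have hu : ω_ 1 ≤ A.u x.p.s ι := not_lt.1 fun h => hΔ ((A.mem_Δ _ _).2 h)
    obtain ⟨⟨y, hy, h1⟩, h2⟩ := A.pers_spec _ _ ι _ h.succ isSuccLimit_omega_one hu
    refine ⟨y, hy, _, h1, ?_⟩
    rw [h.off]
    · exact COrd.val_le _
    · rw [A.mem_Δ]; exact not_lt.2 h2

/-- The edges to `r`, with the option of a request `o0` for the new rank `β` of `t0`: every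
obligation takes the origin that gives it the greatest new rank. -/
theorem exists_edge_aux [Finite T] [Finite G] {x : A.St}
    {Sn : ℕ → Set (Shape I T G)} (hp : A.Good x.p Sn) {r : A.S} (hr : A.succ x.p.s r) (t0 : I)
    (o0 : Org I) (β : Ordinal) (hβ : β < ω_ 1) (h1 : ∀ ι, o0.src ι → A.Thread x.p ι)
    (h2 : ∀ ι, o0 ≠ .pers ι)
    (h3 : ∀ ι i, o0 = .born ι → ι ∈ x.p.M i → ω * (A.lvl x.p Sn ι : Ordinal) ≤ A.u r t0)
    (h4 : ∀ ι, o0 = .born ι → (x.p.Z ι).Nonempty → ∃ η, (∀ w ∈ x.p.Z ι, A.u x.p.s w ≤ η) ∧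
      ω * ((levBound I T G : Ordinal) + 1 + η) ≤ A.u r t0)
    (h5 : o0 = .base → ∃ η, (∀ w ∈ A.Δ (A.τ x.p.s), A.u x.p.s w ≤ η) ∧
      ω * ((levBound I T G : Ordinal) + 1 + η) ≤ A.u r t0)
    (h6 : ∀ ι, o0 = .born ι → β < x.v ι) :
    ∃ x', Edge x x' ∧ x'.r = r ∧ (o0 ≠ .none → β ≤ x'.v t0) := by
  classical
  -- the new ranks that the possible origins `Cand t` of `t` would give to it
  let w : Org I → Ordinal := fun o => match o with
    | .none => 0
    | .pers ι => x.v ι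
    | .born _ => β
    | .base => β
  let Cand : I → Set (Org I) := fun t =>
    {o | o = .none ∨ (∃ ι, o = .pers ι ∧ A.Thread x.p ι ∧ A.pers x.p.s r ι = t) ∨
      (t = t0 ∧ o = o0)}
  have hmax : ∀ t, ∃ o ∈ Cand t, ∀ o' ∈ Cand t, w o' ≤ w o := fun t =>
    Set.exists_max_image (Cand t) w (toFinite _) ⟨.none, Or.inl rfl⟩
  choose org horg hle using hmax
  have hw : ∀ o, w o ≤ ω_ 1 := by
    intro o
    cases o with
    | none => exact zero_le
    | pers ι => exact COrd.val_le _
    | born _ => exact hβ.le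
    | base => exact hβ.le
  have hpers : ∀ t ι, org t = .pers ι → A.Thread x.p ι ∧ A.pers x.p.s r ι = t := by
    intro t ι h
    rcases horg t with h' | ⟨κ, h', h''⟩ | ⟨-, h'⟩
    · rw [h] at h'; cases h'
    · rw [h] at h'; cases h'; exact h''
    · exact absurd (h'.symm.trans h) (h2 ι)
  have hother : ∀ t, org t ≠ .none → (∀ ι, org t ≠ .pers ι) → t = t0 ∧ org t = o0 := by
    intro t h h'
    rcases horg t with h1 | ⟨κ, h1, -⟩ | h1
    · exact absurd h1 h
    · exact absurd h1 (h' κ)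
    · exact h1
  have hborn : ∀ t ι, org t = .born ι → t = t0 ∧ o0 = .born ι := by
    intro t ι h
    obtain ⟨h1, h2⟩ := hother t (by rw [h]; simp) (by rw [h]; simp)
    exact ⟨h1, by rw [← h2, h]⟩
  have hbase : ∀ t, org t = .base → t = t0 ∧ o0 = .base := by
    intro t h
    obtain ⟨h1, h2⟩ := hother t (by rw [h]; simp) (by rw [h]; simp)
    exact ⟨h1, by rw [← h2, h]⟩
  have hsrc : ∀ t ι, (org t).src ι → A.Thread x.p ι := by
    intro t ι h
    cases ho : org t with
    | none => rw [ho] at h; exact h.elim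
    | base => rw [ho] at h; exact h.elim
    | pers κ =>
      rw [ho] at h
      obtain rfl : κ = ι := h
      exact (hpers t κ ho).1
    | born κ =>
      rw [ho] at h
      obtain rfl : κ = ι := h
      exact h1 κ (by rw [(hborn t κ ho).2]; rfl)
  have hok : A.OrgOK x.p Sn r org := by
    refine ⟨fun t ι h => (hpers t ι h).2, ?_, ?_, ?_⟩
    · intro t ι i h hi
      obtain ⟨rfl, h'⟩ := hborn t ι h
      exact h3 ι i h' hi
    · intro t ι h hZ
      obtain ⟨rfl, h'⟩ := hborn t ι h
      exact h4 ι h' hZ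
    · intro t h
      obtain ⟨rfl, h'⟩ := hbase t h
      exact h5 h'
  obtain ⟨e, fl, q, hq⟩ := exists_step hp hr hok
  have hf : ∀ t, ∃ a : COrd, a.val = if t ∈ A.Δ (A.τ r) then w (org t) else ω_ 1 := by
    intro t
    refine COrd.exists_val ?_
    split_ifs
    · exact hw _
    · exact le_rfl
  choose f hf using hf
  let x' : A.St := ⟨q, r, f⟩
  have hv : ∀ t ∈ A.Δ (A.τ r), x'.v t = w (org t) := fun t ht => by
    show (f t).val = _
    rw [hf, if_pos ht]
  have hv' : ∀ t ∉ A.Δ (A.τ r), x'.v t = ω_ 1 := fun t ht => by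
    show (f t).val = _
    rw [hf, if_neg ht]
  refine ⟨x', ⟨org, e, fl, hr, hq, hv', ?_, ?_, ?_, ?_, hsrc, ?_⟩, rfl, ?_⟩
  · intro t ht h
    rw [hv t ht, h]
  · intro t ht ι h
    rw [hv t ht, h]
  · intro t ht ι h
    rw [hv t ht, h]
    exact h6 ι (hborn t ι h).2
  · intro t ht h
    rw [hv t ht, h]
    exact hβ
  · intro ι hι ht
    rw [hv _ ht]
    exact hle _ (.pers ι) (Or.inr (Or.inl ⟨ι, rfl, hι, rfl⟩))
  · intro ho
    by_cases ht : t0 ∈ A.Δ (A.τ r)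
    · rw [hv _ ht]
      refine le_trans ?_ (hle t0 o0 (Or.inr (Or.inr ⟨rfl, rfl⟩)))
      cases o0 with
      | none => exact absurd rfl ho
      | pers ι => exact absurd rfl (h2 ι)
      | born _ => exact le_rfl
      | base => exact le_rfl
    · rw [hv' _ ht]; exact hβ.le

/-- All successors of the state are reached by edges. -/
theorem exists_edge [Finite T] [Finite G] {x : A.St} (hx : x.OK) {r : A.S}
    (hr : A.succ x.p.s r) : ∃ x', Edge x x' ∧ x'.r = r := by
  obtain ⟨Sn, hp⟩ := hx.adm
  rcases isEmpty_or_nonempty I with hI | ⟨⟨t0⟩⟩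
  · have hok : A.OrgOK x.p Sn r (isEmptyElim : I → Org I) :=
      ⟨isEmptyElim, isEmptyElim, isEmptyElim, isEmptyElim⟩
    obtain ⟨e, fl, q, hq⟩ := exists_step hp hr hok
    exact ⟨⟨q, r, isEmptyElim⟩, ⟨isEmptyElim, e, fl, hr, hq, isEmptyElim, isEmptyElim,
      isEmptyElim, isEmptyElim, isEmptyElim, isEmptyElim, isEmptyElim⟩, rfl⟩
  · obtain ⟨x', h1, h2, -⟩ := exists_edge_aux hp hr t0 .none 0 (omega_pos 1)
      (by rintro _ ⟨⟩) (by simp) (by simp) (by simp) (by simp) (by simp)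
    exact ⟨x', h1, h2⟩

/-- Requests of ranks are answered along some edge. -/
theorem exists_edge_birth [Finite T] [Finite G] {x : A.St} (hx : x.OK) {ι : I} {y : X}
    (hy : y ∈ A.Y ι) {β : Ordinal} (hβ : 0 < β) (hβ' : β < x.v ι) :
    ∃ x', Edge x x' ∧ ∃ ι', A.At (A.τ x'.p.s) y ι' ∧ β ≤ x'.v ι' := by
  obtain ⟨Sn, hp⟩ := hx.adm
  have hβω : β < ω_ 1 := hβ'.trans_le (COrd.val_le _)
  have hpos : ∀ o : Ordinal, 0 < ω * ((levBound I T G : Ordinal) + 1 + o) := fun o =>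
    mul_pos omega0_pos (zero_lt_one.trans_le (le_add_self.trans le_self_add))
  suffices h : ∃ r t0 x', Edge x x' ∧ x'.r = r ∧ A.At (A.τ r) y t0 ∧ β ≤ x'.v t0 by
    obtain ⟨r, t0, x', h1, rfl, h2, h3⟩ := h
    obtain ⟨org, e, fl, h4⟩ := h1
    exact ⟨x', ⟨org, e, fl, h4⟩, t0, by rw [h4.step.type]; exact h2, h3⟩
  by_cases hΔ : ι ∈ A.Δ (A.τ x.p.s)
  · rcases hx.thread ι hΔ (hβ.trans hβ').ne' with ⟨i, hi⟩ | hZ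
    · have h1 := hp.fit.named i ι hi
      have h2 : ω * (A.lvl x.p Sn ι : Ordinal) + 1 < A.u x.p.s ι := by
        refine lt_of_lt_of_le ?_ h1
        rw [mul_add, mul_one]
        gcongr
        exact one_lt_omega0
      obtain ⟨r, t0, hr, hAt, hu⟩ := A.birth_spec _ _ y _ hy
        (zero_lt_one.trans_le le_add_self) h2
      obtain ⟨x', h3, h4, h5⟩ := exists_edge_aux hp hr t0 (.born ι) β hβω
        (by rintro _ ⟨rfl⟩; exact Or.inl ⟨i, hi⟩) (by simp)
        (by rintro _ _ ⟨rfl⟩ -; exact le_self_add.trans hu)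
        (by
          rintro _ ⟨rfl⟩ hZ
          rw [hp.fit.excl i ι hi] at hZ
          exact absurd hZ not_nonempty_empty)
        (by simp) (by rintro _ ⟨rfl⟩; exact hβ')
      exact ⟨r, t0, x', h3, h4, hAt, h5 (by simp)⟩
    · obtain ⟨η, h1, h2⟩ := hp.fit.frozen ι hZ
      obtain ⟨w0, hw0, hmax⟩ := Set.exists_max_image _ (A.u x.p.s) (toFinite (x.p.Z ι)) hZ
      have h3 : ω * ((levBound I T G : Ordinal) + 1 + A.u x.p.s w0) < A.u x.p.s ι := by
        refine lt_of_lt_of_le ?_ h2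
        have := h1 w0 hw0
        exact mul_lt_mul_of_pos_left (by gcongr) omega0_pos
      obtain ⟨r, t0, hr, hAt, hu⟩ := A.birth_spec _ _ y _ hy (hpos _) h3
      obtain ⟨x', h3, h4, h5⟩ := exists_edge_aux hp hr t0 (.born ι) β hβω
        (by rintro _ ⟨rfl⟩; exact Or.inr hZ) (by simp)
        (by
          rintro _ i ⟨rfl⟩ hi
          rw [hp.fit.excl i ι hi] at hZ
          exact absurd hZ not_nonempty_empty)
        (by rintro _ ⟨rfl⟩ -; exact ⟨_, hmax, hu⟩)
        (by simp) (by rintro _ ⟨rfl⟩; exact hβ')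
      exact ⟨r, t0, x', h3, h4, hAt, h5 (by simp)⟩
  · have hu : A.u x.p.s ι = ω_ 1 :=
      le_antisymm (A.u_le _ _) (not_lt.1 fun h => hΔ ((A.mem_Δ _ _).2 h))
    obtain ⟨η, hη, hη'⟩ : ∃ η, (∀ w ∈ A.Δ (A.τ x.p.s), A.u x.p.s w ≤ η) ∧ η < ω_ 1 := by
      refine ⟨⨆ w : A.Δ (A.τ x.p.s), A.u x.p.s w, fun w hw => ?_, ?_⟩
      · exact Ordinal.le_iSup (fun w : A.Δ (A.τ x.p.s) => A.u x.p.s w) ⟨w, hw⟩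
      · exact iSup_lt_omega_one fun w => (A.mem_Δ _ _).1 w.2
    -- the obligation of uncountable rank grants any countable amount of fuel
    have h3 : ω * ((levBound I T G : Ordinal) + 1 + η) < A.u x.p.s ι := by
      rw [hu]
      refine isPrincipal_mul_omega 1 omega0_lt_omega_one (isPrincipal_add_omega 1 ?_ hη')
      refine lt_trans ?_ omega0_lt_omega_one
      exact_mod_cast natCast_lt_omega0 (levBound I T G + 1)
    obtain ⟨r, t0, hr, hAt, hu⟩ := A.birth_spec _ _ y _ hy (hpos _) h3
    obtain ⟨x', h3, h4, h5⟩ := exists_edge_aux hp hr t0 .base β hβω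
      (by rintro _ ⟨⟩) (by simp) (by simp) (by simp) (fun _ => ⟨η, hη, hu⟩) (by simp)
    exact ⟨r, t0, x', h3, h4, hAt, h5 (by simp)⟩

/-- A state with an obligation of positive new rank and a nonempty demand has a successor. -/
theorem St.OK.exists_edge_of_pos [Finite T] [Finite G] {x : A.St} (hx : x.OK) {ι : I} {y : X}
    (hy : y ∈ A.Y ι) (hι : 0 < x.v ι) : ∃ x', Edge x x' := by
  obtain ⟨l, hl, hl'⟩ : ∃ l, Order.IsSuccLimit l ∧ l ≤ A.u x.p.s ι := by
    by_cases hΔ : ι ∈ A.Δ (A.τ x.p.s)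
    · obtain ⟨Sn, hp⟩ := hx.adm
      exact (hx.thread ι hΔ hι.ne').exists_limit hp.fit
    · exact ⟨_, isSuccLimit_omega_one, not_lt.1 fun h => hΔ ((A.mem_Δ _ _).2 h)⟩
  obtain ⟨r, -, hr, -⟩ := A.birth_spec _ _ y (Order.succ 0) hy (Order.lt_succ 0)
    ((hl.succ_lt hl.bot_lt).trans_le hl')
  obtain ⟨x', h, -⟩ := exists_edge hx hr
  exact ⟨x', h⟩

end Arena

/-! ### Well-foundedness along branches and traces -/

namespace Arena

open Ordinal Filter

variable {I X T G : Type} [Fintype I] {A : Arena I X T G}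

theorem Step.le_card {p q : Pos A.S I G} {r : A.S} {org : I → Org I} {e : ℕ} {fl : Prop}
    (hp : A.Adm p) (h : A.Step p r org e fl q) : e ≤ Fintype.card I := by
  obtain ⟨Sn, hp⟩ := hp
  obtain ⟨L', hN⟩ := h.norm
  exact hN.le.trans hp.fit.length_le

/-- `b i` bounds the ranks of the members of the `i`-th name, strictly for those that belong to
later names as well. -/
def Bounds (x : A.St) (b : ℕ → Ordinal.{0}) : Prop :=
  ∀ i, ∀ t ∈ x.p.M i, x.v t ≤ b i ∧ ((∃ j > i, t ∈ x.p.M j) → x.v t < b i)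

/-- The bounds before the index of the event are kept by an edge, and the bound of a name that
flashes decreases. -/
theorem Bounds.step {x x' : A.St} {org : I → Org I} {e : ℕ} {fl : Prop} {b : ℕ → Ordinal.{0}}
    (hx : x.OK) (h : EdgeAt x x' org e fl) (hb : Bounds x b) :
    ∃ b', Bounds x' b' ∧ (∀ i < e, b' i = b i) ∧ (fl → b' e < b e) ∧
      ∀ i ≥ e, ∀ B, (∀ t ∈ x'.p.M i, x'.v t ≤ B) → b' i ≤ B := by
  classical
  obtain ⟨L', hN⟩ := h.step.norm
  obtain ⟨Sn, hp⟩ := hx.adm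
  have fit := hp.fit
  have hval : ∀ t i ι, t ∈ A.raw x.p x'.r org i → ι ∈ x.p.M i → (org t).src ι →
      x'.v t ≤ x.v ι ∧ (org t = .born ι → x'.v t < x.v ι) := by
    intro t i ι ht hι hs
    cases ho : org t with
    | none => rw [ho] at hs; exact hs.elim
    | base => rw [ho] at hs; exact hs.elim
    | pers κ =>
      rw [ho] at hs
      obtain rfl : κ = ι := hs
      exact ⟨(h.pers t ht.1 κ ho).le, by simp⟩
    | born κ =>
      rw [ho] at hs
      obtain rfl : κ = ι := hs
      have := h.born t ht.1 κ ho
      exact ⟨this.le, fun _ => this⟩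
  have hraw : ∀ i < x.p.L, ∀ t ∈ A.raw x.p x'.r org i, x'.v t ≤ b i ∧
      ((∃ j > i, t ∈ A.raw x.p x'.r org j) → x'.v t < b i) := by
    intro i hi t ht
    constructor
    · obtain ⟨-, ⟨-, ι, hι, hs⟩ | ⟨h1, -⟩⟩ := id ht
      · exact (hval t i ι ht hι hs).1.trans (hb i ι hι).1
      · omega
    · rintro ⟨j, hj, hj'⟩
      obtain ⟨ι, hι, hs, h1 | h1⟩ := raw_raw fit hi ht hj'
      · exact (hval t i ι ht hι hs).1.trans_lt ((hb i ι hι).2 ⟨j, hj, h1⟩)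
      · exact ((hval t i ι ht hι hs).2 h1).trans_le (hb i ι hι).1
  refine ⟨fun i => if i < e then b i else
    (Finset.univ.filter fun t => t ∈ x'.p.M i).sup x'.v, ?_, fun i hi => if_pos hi, ?_, ?_⟩
  · intro i t ht
    have heL := hN.le
    by_cases hi : i < e
    · simp only [if_pos hi]
      have ht' := ht
      rw [hN.eq i hi] at ht'
      refine ⟨(hraw i (by omega) t ht').1, ?_⟩
      rintro ⟨j, hj, hj'⟩
      refine (hraw i (by omega) t ht').2 ?_
      by_cases hje : j < e
      · exact ⟨j, hj, by rw [← hN.eq j hje]; exact hj'⟩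
      · obtain ⟨k, hk, hk'⟩ := hN.of_mem j (not_lt.1 hje) t hj'
        exact ⟨k, by omega, hk'⟩
    · simp only [if_neg hi]
      refine ⟨Finset.le_sup (f := x'.v) (by simpa using ht), ?_⟩
      rintro ⟨j, hj, hj'⟩
      exact absurd hj' (hN.disj i (not_lt.1 hi) t ht j hj)
  · intro f
    simp only [lt_irrefl, if_false]
    have hlt : ∀ t ∈ x'.p.M e, x'.v t < b e := by
      intro t ht
      rw [hN.eq_flash f] at ht
      exact (hraw e (hN.lt f) t ht).2 (hN.flash f t ht)
    obtain ⟨t, ht⟩ := hN.nonempty f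
    rw [← hN.eq_flash f] at ht
    rw [Finset.sup_lt_iff (by simpa using bot_le.trans_lt (hlt t ht))]
    intro t ht
    exact hlt t (by simpa using ht)
  · intro i hi B hB
    simp only [if_neg (not_lt.2 hi)]
    exact Finset.sup_le fun t ht => hB t (by simpa using ht)

/-- The summary of a segment of a branch. -/
def seg (x : ℕ → A.St) (a : ℕ) : ℕ → G
  | 0 => A.one
  | k + 1 => A.ext (seg x a k) (x (a + k)).p.s (x (a + k + 1)).r

/-- Every infinite branch splits into segments at whose ends the states are valid. The segments end
at the events at the least index `E` that has infinitely many of them, as far as they are not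
flashes; in between, the anchor at `E` is kept. -/
theorem exists_segments {x : ℕ → A.St} (h0 : (x 0).OK) (h : ∀ n, Edge (x n) (x (n + 1))) :
    ∃ t : ℕ → ℕ, StrictMono t ∧
      ∀ j, A.Valid (x (t j)).p.s (seg x (t j) (t (j + 1) - t j)) (x (t (j + 1))).p.s := by
  classical
  have hok : ∀ n, (x n).OK := by
    intro n
    induction n with
    | zero => exact h0
    | succ n ih =>
      obtain ⟨org, e, fl, h'⟩ := h n
      exact h'.ok ih
  choose org e fl hE using h
  have hex : ∃ E, ∃ᶠ n in atTop, e n ≤ E :=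
    ⟨Fintype.card I, (Eventually.of_forall fun n => (hE n).step.le_card (hok n).adm).frequently⟩
  obtain ⟨E, hE1, hE2⟩ : ∃ E, (∃ᶠ n in atTop, e n = E) ∧ ∀ᶠ n in atTop, E ≤ e n := by
    have h1 := Nat.find_spec hex
    have h2 : ∀ᶠ n in atTop, Nat.find hex ≤ e n := by
      rcases Nat.eq_zero_or_pos (Nat.find hex) with h3 | h3
      · rw [h3]; exact Eventually.of_forall fun n => Nat.zero_le _
      · have h4 := Nat.find_min hex (Nat.sub_lt h3 one_pos)
        rw [not_frequently] at h4
        exact h4.mono fun n hn => by omega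
    exact ⟨Nat.find hex, (h1.and_eventually h2).mono fun n hn => le_antisymm hn.1 hn.2, h2⟩
  obtain ⟨n0, hn0⟩ := eventually_atTop.1 hE2
  by_cases hf : ∃ᶠ n in atTop, e n = E ∧ ¬ fl n
  · let p : ℕ → Prop := fun n => n0 ≤ n ∧ e n = E ∧ ¬ fl n
    have hp : (Set.ofPred p).Infinite := by
      rw [← Nat.frequently_atTop_iff_infinite]
      exact (hf.and_eventually (eventually_ge_atTop n0)).mono fun n hn => ⟨hn.2, hn.1⟩
    have hmono : StrictMono (Nat.nth p) := Nat.nth_strictMono hp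
    have hpn : ∀ j, p (Nat.nth p j) := Nat.nth_mem_of_infinite hp
    refine ⟨fun j => Nat.nth p j + 1, fun i j hij => Nat.succ_lt_succ (hmono hij), fun j => ?_⟩
    have hlt : Nat.nth p j < Nat.nth p (j + 1) := hmono (Nat.lt_succ_self j)
    have hbetween : ∀ m, Nat.nth p j < m → m < Nat.nth p (j + 1) → ¬ p m := by
      intro m h1 h2 h3
      rw [← Nat.nth_count h3] at h1 h2
      have h4 := hmono.lt_iff_lt.1 h1
      have h5 := hmono.lt_iff_lt.1 h2
      omega
    have key : ∀ k, Nat.nth p j + 1 + k ≤ Nat.nth p (j + 1) →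
        (x (Nat.nth p j + 1 + k)).p.a E = (x (Nat.nth p j + 1)).p.s ∧
        (x (Nat.nth p j + 1 + k)).p.g E = seg x (Nat.nth p j + 1) k := by
      intro k
      induction k with
      | zero =>
        intro _
        have h1 := hpn j
        refine (hE (Nat.nth p j)).step.fresh E ?_
        rintro (h2 | ⟨h2, -⟩)
        · have := h1.2.1; omega
        · exact h1.2.2 h2
      | succ k ih =>
        intro hk
        obtain ⟨ih1, ih2⟩ := ih (by omega)
        have h1 := hbetween (Nat.nth p j + 1 + k) (by omega) (by omega)
        have h2 := hn0 (Nat.nth p j + 1 + k) (by have := (hpn j).1; omega)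
        have h3 : E < e (Nat.nth p j + 1 + k) ∨
            fl (Nat.nth p j + 1 + k) ∧ E = e (Nat.nth p j + 1 + k) := by
          rcases h2.lt_or_eq with h | h
          · exact Or.inl h
          · refine Or.inr ⟨?_, h⟩
            by_contra hc
            exact h1 ⟨by have := (hpn j).1; omega, h.symm, hc⟩
        obtain ⟨h4, h5⟩ := (hE (Nat.nth p j + 1 + k)).step.kept E h3
        rw [ih1] at h4
        rw [ih2] at h5
        exact ⟨h4, h5⟩
    obtain ⟨k, hk⟩ := Nat.exists_eq_add_of_lt hlt
    have hk1 : Nat.nth p (j + 1) = Nat.nth p j + 1 + k := by omega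
    obtain ⟨h1, h2⟩ := key k (by omega)
    show A.Valid (x (Nat.nth p j + 1)).p.s (seg x (Nat.nth p j + 1)
      (Nat.nth p (j + 1) + 1 - (Nat.nth p j + 1))) (x (Nat.nth p (j + 1) + 1)).p.s
    rw [hk1, show Nat.nth p j + 1 + k + 1 - (Nat.nth p j + 1) = k + 1 by omega]
    have hst := (hE (Nat.nth p j + 1 + k)).step.state (by rw [← hk1]; exact (hpn (j + 1)).2.2)
    rw [hst]
    obtain ⟨Sn, hg⟩ := (hok (Nat.nth p j + 1 + k)).adm
    have hv := hg.fit.valid E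
    rw [h1, h2] at hv
    exact A.valid_ext _ _ _ _ hv (hE (Nat.nth p j + 1 + k)).succ
  · exfalso
    -- all further events at `E` are flashes, so the bound of the `E`-th name decreases forever
    rw [not_frequently, eventually_atTop] at hf
    obtain ⟨n1, hn1⟩ := hf
    have hstep : ∀ n, ∀ b : {b // Bounds (x n) b}, ∃ b' : {b // Bounds (x (n + 1)) b},
        (∀ i < e n, b'.1 i = b.1 i) ∧ (fl n → b'.1 (e n) < b.1 (e n)) := by
      rintro n ⟨b, hb⟩
      obtain ⟨b', h1, h2, h3, -⟩ := hb.step (hok n) (hE n)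
      exact ⟨⟨b', h1⟩, h2, h3⟩
    choose nb hnb1 hnb2 using hstep
    have hinit : Bounds (x 0) fun _ => Finset.univ.sup (x 0).v + 1 := by
      intro i t _
      have : (x 0).v t < Finset.univ.sup (x 0).v + 1 :=
        Order.lt_add_one_iff.2 (Finset.le_sup (Finset.mem_univ t))
      exact ⟨this.le, fun _ => this⟩
    let b : ∀ n, {b // Bounds (x n) b} := fun n => Nat.rec ⟨_, hinit⟩ nb n
    have hb : ∀ n, b (n + 1) = nb n (b n) := fun n => rfl
    have hge : ∀ n ≥ n0 + n1, (b (n + 1)).1 E ≤ (b n).1 E ∧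
        (e n = E → (b (n + 1)).1 E < (b n).1 E) := by
      intro n hn
      have h1 := hn0 n (by omega)
      have h2 := hn1 n (by omega)
      rw [hb]
      rcases h1.lt_or_eq with h3 | h3
      · exact ⟨(hnb1 n (b n) E h3).le, fun h => by omega⟩
      · have h4 : fl n := by
          by_contra hc
          exact h2 ⟨h3.symm, hc⟩
        have h5 := hnb2 n (b n) h4
        rw [← h3] at h5
        exact ⟨h5.le, fun _ => h5⟩
    obtain ⟨o, ⟨n, hn, rfl⟩, hmin⟩ := (wellFounded_lt (α := Ordinal)).has_min
      {o | ∃ n ≥ n0 + n1, (b n).1 E = o} ⟨_, n0 + n1, le_rfl, rfl⟩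
    have hanti : ∀ m ≥ n, (b m).1 E ≤ (b n).1 E := by
      intro m hm
      induction m, hm using Nat.le_induction with
      | base => exact le_rfl
      | succ m hm ih => exact (hge m (by omega)).1.trans ih
    obtain ⟨m, hm, hm'⟩ := frequently_atTop.1 hE1 n
    exact hmin _ ⟨m + 1, by omega, rfl⟩ (((hge m (by omega)).2 hm').trans_le (hanti m hm))

/-- Along the traces of the new tree there are ranks below `ω_ 1`. The rank is bounded by an
ordinal whose digits are, alternately, the old rank of the trace at the anchors (or a constant
`K` as long as the anchor is older than the trace) and the bounds of the names. -/
theorem exists_trace_rank [Finite T] [Finite G] : ∃ h : A.St → I → Ordinal.{0},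
    (∀ x, x.OK → ∀ w ∈ A.Δ (A.τ x.p.s), h x w < ω_ 1) ∧
    ∀ x x' w w', x.OK → w ∈ A.Δ (A.τ x.p.s) → Edge x x' → A.Tr x.p.s x'.r w w' →
      h x' w' < h x w := by
  classical
  suffices hs : ∃ h : A.St × I → Ordinal.{0},
      (∀ y, (y.1.OK ∧ y.2 ∈ A.Δ (A.τ y.1.p.s)) → h y < ω_ 1) ∧
      ∀ y y', (y.1.OK ∧ y.2 ∈ A.Δ (A.τ y.1.p.s)) →
        (Edge y.1 y'.1 ∧ A.Tr y.1.p.s y'.1.r y.2 y'.2) → h y' < h y by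
    obtain ⟨h, h1, h2⟩ := hs
    exact ⟨fun x w => h (x, w), fun x hx w hw => h1 (x, w) ⟨hx, hw⟩,
      fun x x' w w' hx hw h3 h4 => h2 (x, w) (x', w') ⟨hx, hw⟩ ⟨h3, h4⟩⟩
  refine exists_rank _ _ ?_
  rintro ⟨x0, w0⟩ ⟨hx0, hw0⟩
  dsimp only at hx0 hw0
  obtain ⟨Θ, hΘ, hΘv⟩ : ∃ Θ < ω_ 1, ∀ t ∈ A.Δ (A.τ x0.p.s), x0.v t < Θ := by
    refine ⟨(⨆ t : A.Δ (A.τ x0.p.s), x0.v t) + 1, isSuccLimit_omega_one.add_one_lt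
      (iSup_lt_omega_one fun t => hx0.lt t t.2), fun t ht => Order.lt_add_one_iff.2 ?_⟩
    exact Ordinal.le_iSup (fun t : A.Δ (A.τ x0.p.s) => x0.v t) ⟨t, ht⟩
  -- a bound for the ranks at the start of the trace and at all states to which a flash can lead as long
  -- as the anchors are those of `x0`; there are only finitely many, as responses are canonical
  obtain ⟨K, hK, hKw, hKr⟩ : ∃ K < ω_ 1, A.u x0.p.s w0 ≤ K ∧
      ∀ F, ∀ e ≤ Fintype.card I, ∀ q, A.resp F e (cut x0.p.a e) = some q →
        ∀ w ∈ A.Δ (A.τ q.s), A.u q.s w ≤ K := by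
    let ρ : Shape I T G × Fin (Fintype.card I + 1) × I → Ordinal := fun z =>
      match A.resp z.1 z.2.1 (cut x0.p.a z.2.1) with
      | none => 0
      | some q => if z.2.2 ∈ A.Δ (A.τ q.s) then A.u q.s z.2.2 else 0
    have hρ : ∀ z, ρ z < ω_ 1 := by
      intro z
      simp only [ρ]
      split
      · exact omega_pos 1
      · split_ifs with h
        · exact (A.mem_Δ _ _).1 h
        · exact omega_pos 1
    have hc : Countable (Shape I T G × Fin (Fintype.card I + 1) × I) := Finite.to_countable
    refine ⟨max (A.u x0.p.s w0) (⨆ z, ρ z), max_lt ((A.mem_Δ _ _).1 hw0)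
      (iSup_lt_omega_one hρ), le_max_left _ _, fun F e he q hq w hw => le_max_of_le_right ?_⟩
    refine le_trans (le_of_eq ?_) (Ordinal.le_iSup ρ (F, ⟨e, by omega⟩, w))
    simp only [ρ, hq, if_pos hw]
  let B : Ordinal := max K Θ + 1
  have hB : B < ω_ 1 := isSuccLimit_omega_one.add_one_lt (max_lt hK hΘ)
  let mix : (ℕ → Ordinal.{0}) → (ℕ → Ordinal.{0}) → ℕ → Ordinal.{0} := fun a b j =>
    if j % 2 = 0 then a (j / 2) else b (j / 2)
  have hmixB : ∀ a b, (∀ i, a i ≤ K) → (∀ i, b i ≤ Θ) → ∀ j, mix a b j < B := by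
    intro a b ha hb j
    refine Order.lt_add_one_iff.2 ?_
    simp only [mix]
    split_ifs
    · exact (ha _).trans (le_max_left _ _)
    · exact (hb _).trans (le_max_right _ _)
  let len := 2 * (Fintype.card I + 1)
  -- all obligations whose new rank may exceed `Θ` are frozen until the trace ends
  let Inv : A.St × I → Ordinal.{0} → Prop := fun y z => ∃ a b : ℕ → Ordinal.{0},
    z = odigits B (mix a b) len ∧ y.1.OK ∧ Bounds y.1 b ∧ (∀ i, b i ≤ Θ) ∧ (∀ i, a i ≤ K) ∧
    A.u y.1.p.s y.2 ≤ K ∧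
    (∀ i, (a i = K ∧ y.1.p.a i = x0.p.a i) ∨
      ∃ v, A.tr (y.1.p.g i) v y.2 ∧ a i = A.u (y.1.p.a i) v) ∧
    ∀ t, A.Thread y.1.p t → y.1.v t ≤ Θ ∨ y.2 ∈ y.1.p.Z t
  refine ⟨Inv, odigits B (mix (fun _ => K) fun _ => Θ) len,
    odigits_lt_omega_one hB (hmixB _ _ (fun _ => le_rfl) fun _ => le_rfl) _,
    ⟨_, _, rfl, hx0, ?_, fun _ => le_rfl, fun _ => le_rfl, hKw, fun i => Or.inl ⟨rfl, rfl⟩,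
      fun t ht => Or.inl (hΘv t (ht.mem_Δ hx0.adm)).le⟩, ?_⟩
  · intro i t ht
    have := hΘv t (Thread.mem_Δ hx0.adm (Or.inl ⟨i, ht⟩))
    exact ⟨this.le, fun _ => this⟩
  rintro ⟨x, w⟩ z ⟨x', w'⟩ ⟨a, b, rfl, hx, hb, hbΘ, haK, hwK, ha, hth⟩ ⟨⟨org, e, fl, hE⟩, hTr⟩
  dsimp only at hx hb hwK ha hth hE hTr
  have hlt := A.tr_lt _ _ _ _ hE.succ hTr
  have hwω : A.u x.p.s w < ω_ 1 := hwK.trans_lt hK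
  have hwΔ : w ∈ A.Δ (A.τ x.p.s) := (A.mem_Δ _ _).2 hwω
  have he := hE.step.le_card hx.adm
  have hx' := hE.ok hx
  have hth' : ∀ t, A.Thread x'.p t → x'.v t ≤ Θ ∨ w' ∈ x'.p.Z t := by
    intro t ht
    obtain ⟨htΔ, ho⟩ := hE.step.of_thread ht
    rw [hE.step.Z]
    rcases ho with ⟨ι, hs⟩ | ho
    · have hle : x'.v t ≤ x.v ι := by
        cases ho : org t with
        | none => rw [ho] at hs; exact hs.elim
        | base => rw [ho] at hs; exact hs.elim
        | pers κ =>
          rw [ho] at hs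
          obtain rfl : κ = ι := hs
          exact (hE.pers t htΔ κ ho).le
        | born κ =>
          rw [ho] at hs
          obtain rfl : κ = ι := hs
          exact (hE.born t htΔ κ ho).le
      rcases hth ι (hE.src t ι hs) with h1 | h1
      · exact Or.inl (hle.trans h1)
      · exact Or.inr ⟨htΔ, Or.inl ⟨ι, hs, w, h1, hTr⟩⟩
    · exact Or.inr ⟨htΔ, Or.inr ⟨ho, w, hwΔ, hTr⟩⟩
  obtain ⟨b', hb', hbe, hbf, hbB⟩ := hb.step hx hE
  have hbΘ' : ∀ i, b' i ≤ Θ := by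
    intro i
    by_cases hi : i < e
    · rw [hbe i hi]; exact hbΘ i
    · refine hbB i (not_lt.1 hi) Θ fun t ht => ?_
      refine (hth' t (Or.inl ⟨i, ht⟩)).resolve_right fun h => ?_
      obtain ⟨Sn, hg⟩ := hx'.adm
      rw [hg.fit.excl i t ht] at h
      exact h
  obtain ⟨Sn, hg⟩ := hx.adm
  obtain ⟨Sn', hg'⟩ := hx'.adm
  have hkept : ∀ i, (i < e ∨ fl ∧ i = e) → (a i = K ∧ x'.p.a i = x0.p.a i) ∨
      ∃ v, A.tr (x'.p.g i) v w' ∧ a i = A.u (x'.p.a i) v := by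
    intro i hi
    obtain ⟨h1, h2⟩ := hE.step.kept i hi
    rw [h1, h2]
    rcases ha i with h3 | ⟨v, h3, h4⟩
    · exact Or.inl h3
    · exact Or.inr ⟨v, A.tr_ext _ _ _ _ _ _ h3 hTr, h4⟩
  have hwK' : A.u x'.p.s w' ≤ K := by
    by_cases f : fl
    · by_cases hall : ∀ i ≤ e, x.p.a i = x0.p.a i
      · obtain ⟨F, hF⟩ := hE.step.canon f
        have hcut : cut x.p.a e = cut x0.p.a e := by
          funext j
          unfold cut
          split_ifs with hj
          · exact hall j hj
          · exact hall 0 (Nat.zero_le _)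
        rw [hcut] at hF
        refine hKr F e he _ hF w' ?_
        rw [hE.step.type, A.mem_Δ]
        exact hlt.trans hwω
      · push Not at hall
        obtain ⟨i, hi, hne⟩ := hall
        have hi' : i < e ∨ fl ∧ i = e := by
          rcases hi.lt_or_eq with h | h
          · exact Or.inl h
          · exact Or.inr ⟨f, h⟩
        rcases hkept i hi' with ⟨-, h1⟩ | ⟨v, h1, h2⟩
        · rw [(hE.step.kept i hi').1] at h1
          exact absurd h1 hne
        · exact (A.tr_le _ _ _ _ _ (hg'.fit.valid i) h1).trans (h2 ▸ haK i)
    · rw [hE.step.state f]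
      exact hlt.le.trans hwK
  let a' : ℕ → Ordinal := fun i => if i < e ∨ fl ∧ i = e then a i else A.u x'.p.s w'
  have ha' : ∀ i, a' i ≤ K := by
    intro i
    simp only [a']
    split_ifs
    · exact haK i
    · exact hwK'
  -- at a flash the digit for the bound of the name decreases, at any other event the digit for the
  -- rank of the trace at the anchor
  refine ⟨odigits B (mix a' b') len, ?_, a', b', rfl, hx', hb', hbΘ', ha', hwK', ?_, hth'⟩
  · have hlow : ∀ j < 2 * e, mix a' b' j = mix a b j := by
      intro j hj
      have h1 : j / 2 < e := by omega
      simp only [mix, a', if_pos (Or.inl h1 : j / 2 < e ∨ fl ∧ j / 2 = e), hbe _ h1]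
    by_cases f : fl
    · refine odigits_lt (i := 2 * e + 1) (hmixB _ _ ha' hbΘ') (by simp only [len]; omega) ?_ ?_
      · intro j hj
        rcases (Nat.lt_succ_iff.1 hj).lt_or_eq with h1 | rfl
        · exact hlow j h1
        · simp [mix, a', f]
      · have h1 : (2 * e + 1) / 2 = e := by omega
        have h2 : (2 * e + 1) % 2 = 1 := by omega
        simp only [mix, h1, h2, one_ne_zero, if_false]
        exact hbf f
    · refine odigits_lt (i := 2 * e) (hmixB _ _ ha' hbΘ') (by simp only [len]; omega) hlow ?_
      have h1 : 2 * e / 2 = e := by omega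
      have h2 : 2 * e % 2 = 0 := by omega
      have h3 : ¬ (e < e ∨ fl ∧ e = e) := by simp [f]
      have h6 : a' e = A.u x'.r w' := by
        show (if _ then _ else _) = _
        rw [if_neg h3, hE.step.state f]
      simp only [mix, h1, h2, if_true]
      rw [h6]
      rcases ha e with ⟨h4, -⟩ | ⟨v, h4, h5⟩
      · rw [h4]; exact hlt.trans_le hwK
      · rw [h5]; exact hlt.trans_le (A.tr_le _ _ _ _ _ (hg.fit.valid e) h4)
  · intro i
    by_cases hi : i < e ∨ fl ∧ i = e
    · simp only [a', if_pos hi]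
      exact hkept i hi
    · simp only [a', if_neg hi]
      obtain ⟨h1, h2⟩ := hE.step.fresh i hi
      exact Or.inr ⟨w', by rw [h2]; exact A.tr_one w', by rw [h1]⟩

/-- The initial annotated position. -/
theorem exists_start {s : A.S} {ι : I} (hι : ι ∈ A.Δ (A.τ s))
    (hu : ω * ((levBound I T G : Ordinal) + 1) ≤ A.u s ι) {κ : Ordinal} (hκ : κ < ω_ 1) :
    ∃ x : A.St, x.OK ∧ x.p.s = s ∧ x.v ι = κ := by
  classical
  have hf : ∀ t, ∃ a : COrd, a.val = if t ∈ A.Δ (A.τ s) then (if t = ι then κ else 0)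
      else ω_ 1 := by
    intro t
    refine COrd.exists_val ?_
    split_ifs
    · exact hκ.le
    · exact zero_le
    · exact le_rfl
  choose f hf using hf
  let p : Pos A.S I G := ⟨s, fun _ => ∅, 1, fun i => if i = 0 then {ι} else ∅, fun _ => s,
    fun _ => A.one⟩
  have hM : ∀ i, ∀ t ∈ p.M i, i = 0 ∧ t = ι := by
    intro i t ht
    by_cases h : i = 0
    · simp only [p, h, if_true] at ht
      exact ⟨h, ht⟩
    · simp only [p, h, if_false] at ht
      exact ht.elim
  have hι0 : ι ∈ p.M 0 := rfl
  refine ⟨⟨p, s, f⟩, ⟨⟨fun _ => ∅, Good.intro ⟨fun i => A.valid_one s, fun i _ => ⟨rfl, rfl⟩,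
    ?_, ?_, fun _ _ _ => rfl, ?_, ?_, ?_, ?_⟩ ?_⟩, ?_, ?_, ?_⟩, rfl, ?_⟩
  · intro i hi
    have h : i ≠ 0 := by
      have : 1 ≤ i := hi
      omega
    simp only [p, h, if_false]
  · intro i hi
    obtain rfl : i = 0 := by
      have : i < 1 := hi
      omega
    refine ⟨ι, hι0, fun j hj ht => ?_⟩
    have := (hM j ι ht).1
    omega
  · intro i t ht
    rw [(hM i t ht).2]
    exact hι
  · intro t ht
    exact absurd ht not_nonempty_empty
  · intro i t ht
    rw [(hM i t ht).2]
    refine le_trans ?_ hu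
    have := A.lvl_le p (fun _ => ∅) ι
    gcongr
  · intro t ht
    exact absurd ht not_nonempty_empty
  · intro i F hF
    exact hF.elim
  · intro t ht
    show (f t).val = _
    rw [hf, if_neg ht]
  · intro t ht
    show (f t).val < _
    rw [hf, if_pos ht]
    split_ifs
    · exact hκ
    · exact omega_pos 1
  · intro t ht hv
    by_cases h : t = ι
    · exact Or.inl ⟨0, by rw [h]; exact hι0⟩
    · refine absurd ?_ hv
      show (f t).val = _
      rw [hf, if_pos ht, if_neg h]
  · show (f ι).val = _
    rw [hf, if_pos hι, if_pos rfl]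

end Arena

/-! ### Ranks for parity conditions -/

section ParityRank

open Filter

universe w

variable {V : Type w}

/-- If from every point of `D` one can stay in `D` until a point of `P` is passed, then there is
an infinite chain in `D` that passes `P` infinitely often. -/
theorem exists_chain_frequently {r : V → V → Prop} {D P : V → Prop}
    (h : ∀ v, D v → ∃ a b, Relation.ReflTransGen (fun v w => r v w ∧ D w) v a ∧ P a ∧ r a b ∧ D b)
    {v0 : V} (h0 : D v0) :
    ∃ z : ℕ → V, (∀ n, D (z n) ∧ r (z n) (z (n + 1))) ∧ ∃ᶠ n in atTop, P (z n) := by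
  classical
  -- `Reach n v`: one can pass `P` after `n` steps from `v`; a step that decreases the least such
  -- `n` is chosen each time
  let Reach : ℕ → V → Prop := fun n => Nat.rec (motive := fun _ => V → Prop)
    (fun v => P v ∧ ∃ b, r v b ∧ D b) (fun _ R v => ∃ w, (r v w ∧ D w) ∧ R w) n
  have hreach : ∀ v, D v → ∃ n, Reach n v := by
    intro v hv
    obtain ⟨a, b, h1, h2, h3, h4⟩ := h v hv
    clear hv
    induction h1 using Relation.ReflTransGen.head_induction_on with
    | refl => exact ⟨0, h2, b, h3, h4⟩
    | head h5 _ ih =>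
      obtain ⟨n, hn⟩ := ih
      exact ⟨n + 1, _, h5, hn⟩
  have hnext : ∀ v : {v // D v}, ∃ w : {v // D v}, r v w ∧
      (P v ∨ ∀ n, Reach n v → ∃ m < n, Reach m w) := by
    rintro ⟨v, hv⟩
    obtain ⟨n, h1, hmin⟩ : ∃ n, Reach n v ∧ ∀ m, Reach m v → n ≤ m :=
      ⟨sInf {n | Reach n v}, Nat.sInf_mem (s := {n | Reach n v}) (hreach v hv),
        fun m hm => Nat.sInf_le hm⟩
    rcases n with _ | n
    · obtain ⟨h2, b, h3, h4⟩ := h1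
      exact ⟨⟨b, h4⟩, h3, Or.inl h2⟩
    · obtain ⟨w, ⟨h2, h3⟩, h4⟩ := h1
      exact ⟨⟨w, h3⟩, h2, Or.inr fun m hm => ⟨n, hmin m hm, h4⟩⟩
  choose nx hnx1 hnx2 using hnext
  let z : ℕ → {v // D v} := fun n => nx^[n] ⟨v0, h0⟩
  have hz : ∀ n, z (n + 1) = nx (z n) := fun n => Function.iterate_succ_apply' nx n _
  refine ⟨fun n => z n, fun n => ⟨(z n).2, by beta_reduce; rw [hz]; exact hnx1 _⟩, ?_⟩
  rw [frequently_atTop]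
  have key : ∀ m n, Reach m (z n).1 → ∃ k ≥ n, P (z k).1 := by
    intro m
    induction m using Nat.strong_induction_on with
    | _ m ih =>
      intro n hm
      rcases hnx2 (z n) with h1 | h1
      · exact ⟨n, le_rfl, h1⟩
      · obtain ⟨m', hm', h2⟩ := h1 m hm
        rw [← hz] at h2
        obtain ⟨k, hk, hk'⟩ := ih m' hm' (n + 1) h2
        exact ⟨k, by omega, hk'⟩
  intro n
  obtain ⟨m, hm⟩ := hreach (z n).1 (z n).2
  exact key m n hm

/-- If no infinite chain has the odd number `p` as its least priority occurring infinitely often,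
then there are ranks that do not increase as long as the priorities are at least `p`, and
decrease at priority `p`. -/
theorem exists_parity_rank {r : V → V → Prop} {Ω : V → ℕ}
    (hr : ∀ z : ℕ → V, (∀ n, r (z n) (z (n + 1))) → ¬ SetGame.ParWin Ω 1 z) {p : ℕ}
    (hp : p % 2 = 1) : ∃ ρ : V → Ordinal.{w}, ∀ v v', r v v' → p ≤ Ω v →
      ρ v' ≤ ρ v ∧ (Ω v = p → ρ v' < ρ v) := by
  classical
  -- the rank counts how often priority `p` can be passed while the priorities are at least `p`
  let q : V → V → Prop := fun v w => r v w ∧ p ≤ Ω v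
  let R : V → V → Prop := fun v' v => ∃ a b, Relation.ReflTransGen q v a ∧ Ω a = p ∧ r a b ∧
    Relation.ReflTransGen q b v'
  have hcons : ∀ v w v', r v w → p ≤ Ω v → R v' w → R v' v := by
    rintro v w v' h1 h2 ⟨a, b, h3, h4⟩
    exact ⟨a, b, h3.head ⟨h1, h2⟩, h4⟩
  have hwf : WellFounded R := by
    refine ⟨fun v => ?_⟩
    by_contra hv
    have hup : ∀ v v', Relation.ReflTransGen q v v' → ¬ Acc R v' → ¬ Acc R v := by
      intro v v' h1 h2
      induction h1 using Relation.ReflTransGen.head_induction_on with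
      | refl => exact h2
      | @head v w h3 _ ih =>
        intro h
        exact ih ⟨_, fun v' hv' => h.inv (hcons v w v' h3.1 h3.2 hv')⟩
    have hgood : ∀ v, ¬ Acc R v → ∃ a b, Relation.ReflTransGen
        (fun v w => (r v w ∧ p ≤ Ω v) ∧ ¬ Acc R w) v a ∧ Ω a = p ∧ (r a b ∧ p ≤ Ω a) ∧
          ¬ Acc R b := by
      intro v hv
      obtain ⟨v', ⟨a, b, h1, h2, h3, h4⟩, h5⟩ : ∃ v', R v' v ∧ ¬ Acc R v' := by
        by_contra hc
        push Not at hc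
        exact hv ⟨_, hc⟩
      have h6 := hup _ _ h4 h5
      have h7 : ¬ Acc R a := hup a b (.single ⟨h3, h2.ge⟩) h6
      refine ⟨a, b, ?_, h2, ⟨h3, h2.ge⟩, h6⟩
      clear hv
      induction h1 using Relation.ReflTransGen.head_induction_on with
      | refl => exact .refl
      | head h8 h9 ih => exact ih.head ⟨h8, hup _ _ h9 h7⟩
    obtain ⟨z, h1, h2⟩ := exists_chain_frequently (r := fun v w => r v w ∧ p ≤ Ω v) hgood hv
    exact hr z (fun n => (h1 n).2.1) ⟨p, hp, h2, Eventually.of_forall fun n => (h1 n).2.2⟩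
  refine ⟨fun v => (hwf.apply v).rank, fun v v' h1 h2 => ⟨?_, fun h3 => ?_⟩⟩
  · beta_reduce
    rw [Acc.rank_eq]
    refine Ordinal.iSup_le fun ⟨w, hw⟩ => Order.succ_le_of_lt ?_
    exact Acc.rank_lt_of_rel (hwf.apply v) (hcons v v' w h1 h2 hw)
  · exact Acc.rank_lt_of_rel (hwf.apply v) ⟨v, v', .refl, h3, h1, .refl⟩

end ParityRank

/-! ### Summaries of claims -/

open Ordinal in
/-- Claims that are passed on along paths of an arena, locally (`Loc`) or along edges (`Mod`),
with priorities and ranks witnessing that the least priority occurring infinitely often in a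
chain of claims is even. -/
structure Claims {I X T : Type} (A : PreArena I X T) (C : Type) (P : ℕ) where
  Loc : A.S → C → C → Prop
  Mod : A.S → A.S → C → C → Prop
  Ω : C → ℕ
  Ω_lt : ∀ c, Ω c < P
  ρ : ℕ → A.S → C → Ordinal.{0}
  loc : ∀ p s c c', p % 2 = 1 → Loc s c c' → p ≤ Ω c →
    ρ p s c' ≤ ρ p s c ∧ (Ω c = p → ρ p s c' < ρ p s c)
  mod : ∀ p s r c c', p % 2 = 1 → A.succ s r → Mod s r c c' → p ≤ Ω c →
    ρ p r c' ≤ ρ p s c ∧ (Ω c = p → ρ p r c' < ρ p s c)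

namespace Claims

variable {I X T C : Type} {P : ℕ} {A : PreArena I X T} (K : Claims A C P)

/-- A local chain of claims of priorities at least `p`, with a flag telling whether `p` occurs. -/
inductive LPath (s : A.S) (p : ℕ) : C → C → Bool → Prop
  | nil (c : C) : LPath s p c c false
  | cons {c c' c'' : C} {b : Bool} (h : K.Loc s c c') (hp : p ≤ K.Ω c) (h' : LPath s p c' c'' b) :
    LPath s p c c'' (b || decide (K.Ω c = p))

theorem LPath.rank {s : A.S} {p : ℕ} (hp : p % 2 = 1) {c c' : C} {b : Bool}
    (h : K.LPath s p c c' b) : K.ρ p s c' ≤ K.ρ p s c ∧ (b → K.ρ p s c' < K.ρ p s c) := by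
  induction h with
  | nil c => exact ⟨le_rfl, by simp⟩
  | cons h hc _ ih =>
    obtain ⟨h1, h2⟩ := K.loc p s _ _ hp h hc
    refine ⟨ih.1.trans h1, fun hb => ?_⟩
    rw [Bool.or_eq_true, decide_eq_true_eq] at hb
    rcases hb with hb | hb
    · exact (ih.2 hb).trans_le h1
    · exact ih.1.trans_lt (h2 hb)

/-- A local chain followed by a step along an edge. -/
def EPath (s r : A.S) (p : ℕ) (c c' : C) (b : Bool) : Prop :=
  ∃ d b', K.LPath s p c d b' ∧ K.Mod s r d c' ∧ p ≤ K.Ω d ∧ b = (b' || decide (K.Ω d = p))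

theorem EPath.rank {s r : A.S} {p : ℕ} (hp : p % 2 = 1) (hs : A.succ s r) {c c' : C} {b : Bool}
    (h : K.EPath s r p c c' b) : K.ρ p r c' ≤ K.ρ p s c ∧ (b → K.ρ p r c' < K.ρ p s c) := by
  obtain ⟨d, b', h1, h2, h3, rfl⟩ := h
  obtain ⟨h4, h5⟩ := h1.rank K hp
  obtain ⟨h6, h7⟩ := K.mod p s r d c' hp hs h2 h3
  refine ⟨h6.trans h4, fun hb => ?_⟩
  rw [Bool.or_eq_true, decide_eq_true_eq] at hb
  rcases hb with hb | hb
  · exact h6.trans_lt (h5 hb)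
  · exact (h7 hb).trans_le h4

/-- A summary of a path: which claims lead to which ones, for each priority `p` that is not
undercut, and whether `p` occurs; and which traces there are. -/
abbrev Summary (I C : Type) (P : ℕ) : Type := Set (C × C × Fin P × Bool) × Set (I × I)

/-- The arena of summaries. -/
def arena : Arena I X T (Summary I C P) where
  toPreArena := A
  one := ({z | z.1 = z.2.1 ∧ z.2.2.2 = false}, {z | z.1 = z.2})
  ext g s r := ({z | ∃ c b b', (z.1, c, z.2.2.1, b) ∈ g.1 ∧ K.EPath s r z.2.2.1 c z.2.1 b' ∧
      z.2.2.2 = (b || b')}, {z | ∃ w, (z.1, w) ∈ g.2 ∧ A.Tr s r w z.2})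
  Valid a g s := (∀ z ∈ g.1, z.2.2.1.1 % 2 = 1 → K.ρ z.2.2.1 s z.2.1 ≤ K.ρ z.2.2.1 a z.1 ∧
      (z.2.2.2 → K.ρ z.2.2.1 s z.2.1 < K.ρ z.2.2.1 a z.1)) ∧
    ∀ z ∈ g.2, A.u s z.2 ≤ A.u a z.1
  tr g ι ι' := (ι, ι') ∈ g.2
  valid_one s := by
    refine ⟨?_, ?_⟩
    · rintro ⟨c, c', p, b⟩ ⟨h1, h2⟩ _
      obtain rfl : c = c' := h1
      obtain rfl : b = false := h2
      exact ⟨le_rfl, by simp⟩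
    · rintro ⟨c, c'⟩ h1
      obtain rfl : c = c' := h1
      exact le_rfl
  valid_ext a g s r h hs := by
    refine ⟨?_, ?_⟩
    · rintro ⟨c, c', p, b⟩ ⟨d, b1, b2, h1, h2, rfl⟩ hp
      obtain ⟨h3, h4⟩ := h.1 _ h1 hp
      obtain ⟨h5, h6⟩ := h2.rank K hp hs
      refine ⟨h5.trans h3, fun hb => ?_⟩
      rw [Bool.or_eq_true] at hb
      rcases hb with hb | hb
      · exact h5.trans_lt (h4 hb)
      · exact (h6 hb).trans_le h3
    · rintro ⟨c, c'⟩ ⟨w, h1, h2⟩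
      exact (A.tr_lt _ _ _ _ hs h2).le.trans (h.2 _ h1)
  tr_one ι := rfl
  tr_ext g s r ι ι' ι'' h h' := ⟨ι', h, h'⟩
  tr_le a g s ι ι' h h' := h.2 _ h'

variable [Fintype I]

/-- The step relation between claims at annotated positions. -/
def GStep (v v' : K.arena.St × C) : Prop :=
  (v'.1 = v.1 ∧ K.Loc v.1.p.s v.2 v'.2) ∨
    (Arena.Edge v.1 v'.1 ∧ K.Mod v.1.p.s v'.1.r v.2 v'.2)

open Filter

/-- In an infinite chain of claims at annotated positions, the least priority occurring
infinitely often is even. -/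
theorem not_parWin {z : ℕ → K.arena.St × C} (h0 : (z 0).1.OK)
    (hz : ∀ n, K.GStep (z n) (z (n + 1))) : ¬ SetGame.ParWin (fun v => K.Ω v.2) 1 z := by
  classical
  have hok : ∀ n, (z n).1.OK := by
    intro n
    induction n with
    | zero => exact h0
    | succ n ih =>
      rcases hz n with ⟨h1, -⟩ | ⟨⟨org, e, fl, h1⟩, -⟩
      · rw [h1]; exact ih
      · exact h1.ok ih
  rintro ⟨p, hp, hf, hev⟩
  obtain ⟨n0, hn0⟩ := eventually_atTop.1 hev
  wlog hn : n0 = 0 generalizing z n0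
  · refine this (z := fun n => z (n + n0)) (by simpa using hok n0) (fun n => ?_)
      (fun n => hok _) ?_ ?_ 0 ?_ rfl
    · have := hz (n + n0)
      rwa [show n + n0 + 1 = n + 1 + n0 by omega] at this
    · rw [frequently_atTop] at hf ⊢
      intro a
      obtain ⟨b, hb, hb'⟩ := hf (a + n0)
      exact ⟨b - n0, by omega, by simpa only [Nat.sub_add_cancel (show n0 ≤ b by omega)] using hb'⟩
    · exact Eventually.of_forall fun n => hn0 _ (by omega)
    · exact fun n _ => hn0 _ (by omega)
  subst hn
  have hΩ : ∀ n, p ≤ K.Ω (z n).2 := fun n => hn0 n (Nat.zero_le _)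
  obtain ⟨np, hnp⟩ := hf.exists
  have hpP : p < P := hnp ▸ K.Ω_lt _
  -- the contradiction: a sequence of ordinals that decreases infinitely often
  have hdesc : ∀ o : ℕ → Ordinal.{0}, (∀ n, o (n + 1) ≤ o n) →
      (∀ n, ∃ m ≥ n, o (m + 1) < o m) → False := by
    intro o h1 h2
    obtain ⟨_, ⟨n, rfl⟩, hmin⟩ := (wellFounded_lt (α := Ordinal.{0})).has_min (range o) ⟨_, 0, rfl⟩
    obtain ⟨m, hm, hm'⟩ := h2 n
    exact hmin _ ⟨m + 1, rfl⟩ (hm'.trans_le (antitone_nat_of_succ_le h1 hm))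
  let md : ℕ → Prop := fun n => Arena.Edge (z n).1 (z (n + 1)).1 ∧
    K.Mod (z n).1.p.s (z (n + 1)).1.r (z n).2 (z (n + 1)).2
  have hloc : ∀ n, ¬ md n → (z (n + 1)).1 = (z n).1 ∧
      K.Loc (z n).1.p.s (z n).2 (z (n + 1)).2 := fun n hn => (hz n).resolve_right hn
  -- `md n` says that the step `n` is modal; `E j` is the index after the `j`-th modal step
  by_cases hinf : (Set.ofPred md).Infinite
  · have hmono := Nat.nth_strictMono hinf
    have hmd := Nat.nth_mem_of_infinite hinf
    let E : ℕ → ℕ := fun j => Nat.casesOn j 0 fun j => Nat.nth md j + 1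
    have hE0 : E 0 = 0 := rfl
    have hES : ∀ j, E (j + 1) = Nat.nth md j + 1 := fun j => rfl
    have hEle : ∀ j, E j ≤ Nat.nth md j := by
      intro j
      cases j with
      | zero => exact Nat.zero_le _
      | succ j => rw [hES]; exact hmono (Nat.lt_succ_self j)
    have hbetween : ∀ j m, E j ≤ m → m < Nat.nth md j → ¬ md m := by
      intro j m h1 h2 h3
      rw [← Nat.nth_count h3] at h1 h2
      have h5 := hmono.lt_iff_lt.1 h2
      cases j with
      | zero => omega
      | succ j =>
        rw [hES] at h1
        have h4 := hmono.lt_iff_lt.1 (Nat.lt_of_succ_le h1)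
        omega
    have hconst : ∀ j k, E j + k ≤ Nat.nth md j → (z (E j + k)).1 = (z (E j)).1 := by
      intro j k
      induction k with
      | zero => intro _; rfl
      | succ k ih =>
        intro hk
        rw [← ih (by omega)]
        exact (hloc _ (hbetween j (E j + k) (by omega) (by omega))).1
    let y : ℕ → K.arena.St := fun j => (z (E j)).1
    have hlp : ∀ j k, k ≤ Nat.nth md j - E j → ∃ b, K.LPath (y j).p.s p
        (z (Nat.nth md j - k)).2 (z (Nat.nth md j)).2 b ∧
        ∀ i, Nat.nth md j - k ≤ i → i < Nat.nth md j → K.Ω (z i).2 = p → b = true := by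
      intro j k
      induction k with
      | zero => exact fun _ => ⟨false, .nil _, fun i h1 h2 => by omega⟩
      | succ k ih =>
        intro hk
        obtain ⟨b, h1, h2⟩ := ih (by omega)
        have h3 := hloc (Nat.nth md j - (k + 1)) (hbetween j _ (by omega) (by omega))
        have h4 := hconst j (Nat.nth md j - (k + 1) - E j) (by omega)
        rw [show E j + (Nat.nth md j - (k + 1) - E j) = Nat.nth md j - (k + 1) by omega] at h4
        have h5 := h3.2
        rw [h4, show Nat.nth md j - (k + 1) + 1 = Nat.nth md j - k by omega] at h5
        refine ⟨_, .cons h5 (hΩ _) h1, fun i h6 h7 h8 => ?_⟩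
        rcases h6.eq_or_lt with h9 | h9
        · rw [h9, h8]; simp
        · rw [h2 i (by omega) h7 h8, Bool.true_or]
    have hep : ∀ j, ∃ b, K.EPath (y j).p.s (y (j + 1)).r p (z (E j)).2 (z (E (j + 1))).2 b ∧
        ∀ i, E j ≤ i → i < E (j + 1) → K.Ω (z i).2 = p → b = true := by
      intro j
      obtain ⟨b, h1, h2⟩ := hlp j (Nat.nth md j - E j) le_rfl
      have h3 := hEle j
      rw [show Nat.nth md j - (Nat.nth md j - E j) = E j by omega] at h1 h2
      have h4 := hconst j (Nat.nth md j - E j) (by omega)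
      rw [show E j + (Nat.nth md j - E j) = Nat.nth md j by omega] at h4
      have h5 := (hmd j).2
      rw [h4] at h5
      refine ⟨_, ⟨_, b, h1, h5, hΩ _, rfl⟩, fun i h6 h7 h8 => ?_⟩
      rw [hES] at h7
      rcases (Nat.lt_succ_iff.1 h7).eq_or_lt with h9 | h9
      · rw [← h9, h8]; simp
      · rw [h2 i h6 h9 h8, Bool.true_or]
    choose b hb1 hb2 using hep
    have hy : ∀ j, Arena.Edge (y j) (y (j + 1)) := by
      intro j
      have h3 := hEle j
      have h4 := hconst j (Nat.nth md j - E j) (by omega)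
      rw [show E j + (Nat.nth md j - E j) = Nat.nth md j by omega] at h4
      have h5 := (hmd j).1
      rwa [h4] at h5
    have hseg : ∀ a k, ∃ b', ((z (E a)).2, (z (E (a + k))).2, (⟨p, hpP⟩ : Fin P), b') ∈
        (Arena.seg y a k).1 ∧ ∀ j, a ≤ j → j < a + k → b j = true → b' = true := by
      intro a k
      induction k with
      | zero => exact ⟨false, ⟨rfl, rfl⟩, fun j h1 h2 => by omega⟩
      | succ k ih =>
        obtain ⟨b', h1, h2⟩ := ih
        refine ⟨b' || b (a + k), ⟨_, _, _, h1, hb1 (a + k), rfl⟩, fun j h3 h4 h5 => ?_⟩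
        rcases (Nat.lt_succ_iff.1 (show j < a + k + 1 by omega)).eq_or_lt with h6 | h6
        · rw [← h6, h5, Bool.or_true]
        · rw [h2 j h3 h6 h5, Bool.true_or]
    obtain ⟨t, ht, hv⟩ := Arena.exists_segments (x := y) (hok _) hy
    have hstep : ∀ j, K.ρ p (y (t (j + 1))).p.s (z (E (t (j + 1)))).2 ≤
        K.ρ p (y (t j)).p.s (z (E (t j))).2 ∧
        ((∃ i, t j ≤ i ∧ i < t (j + 1) ∧ b i = true) →
          K.ρ p (y (t (j + 1))).p.s (z (E (t (j + 1)))).2 <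
            K.ρ p (y (t j)).p.s (z (E (t j))).2) := by
      intro j
      obtain ⟨b', h1, h2⟩ := hseg (t j) (t (j + 1) - t j)
      have h3 : t j + (t (j + 1) - t j) = t (j + 1) := by
        have := ht (show j < j + 1 by omega)
        omega
      rw [h3] at h1 h2
      obtain ⟨h4, h5⟩ := (hv j).1 _ h1 hp
      exact ⟨h4, fun ⟨i, h6, h7, h8⟩ => h5 (h2 i h6 h7 h8)⟩
    have hloc' : ∀ (f : ℕ → ℕ), StrictMono f → ∀ i a, f a ≤ i →
        ∃ j ≥ a, f j ≤ i ∧ i < f (j + 1) := by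
      intro f hf i a ha
      have hex : ∃ j, i < f (j + 1) := ⟨i, hf.id_le (i + 1)⟩
      refine ⟨Nat.find hex, ?_, ?_, Nat.find_spec hex⟩
      · by_contra hc
        have h1 := Nat.find_spec hex
        have h2 := hf.monotone (show Nat.find hex + 1 ≤ a by omega)
        omega
      · rcases hj : Nat.find hex with _ | j
        · exact (hf.monotone (Nat.zero_le a)).trans ha
        · exact not_lt.1 (Nat.find_min hex (by omega))
    have hEmono : StrictMono E := strictMono_nat_of_lt_succ fun j =>
      (hEle j).trans_lt (by rw [hES]; exact Nat.lt_succ_self _)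
    refine hdesc (fun j => K.ρ p (y (t j)).p.s (z (E (t j))).2) (fun j => (hstep j).1) fun n => ?_
    obtain ⟨i, hi, hi'⟩ := frequently_atTop.1 hf (E (t n))
    obtain ⟨j, hj, h1, h2⟩ := hloc' E hEmono i (t n) hi
    obtain ⟨m, hm, h3, h4⟩ := hloc' t ht j n hj
    exact ⟨m, hm, (hstep m).2 ⟨j, h3, h4, hb2 j i h1 h2 hi'⟩⟩
  · rw [← Nat.frequently_atTop_iff_infinite, not_frequently, eventually_atTop] at hinf
    obtain ⟨n1, hn1⟩ := hinf
    have hconst : ∀ k, (z (n1 + k)).1 = (z n1).1 := by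
      intro k
      induction k with
      | zero => rfl
      | succ k ih => rw [← ih]; exact (hloc _ (hn1 _ (Nat.le_add_right _ _))).1
    have hstep : ∀ k, K.ρ p (z n1).1.p.s (z (n1 + k + 1)).2 ≤ K.ρ p (z n1).1.p.s (z (n1 + k)).2 ∧
        (K.Ω (z (n1 + k)).2 = p → K.ρ p (z n1).1.p.s (z (n1 + k + 1)).2 <
          K.ρ p (z n1).1.p.s (z (n1 + k)).2) := by
      intro k
      have h1 := (hloc (n1 + k) (hn1 _ (by omega))).2
      rw [hconst k] at h1
      exact K.loc p _ _ _ hp h1 (hΩ _)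
    refine hdesc (fun k => K.ρ p (z n1).1.p.s (z (n1 + k)).2) (fun k => (hstep k).1) fun n => ?_
    obtain ⟨i, hi, hi'⟩ := frequently_atTop.1 hf (n1 + n)
    refine ⟨i - n1, by omega, ?_⟩
    have := (hstep (i - n1)).2 (by rwa [show n1 + (i - n1) = i by omega])
    exact this

end Claims

/-! ### Substitution and the Fischer-Ladner closure -/

namespace MuCalc

universe u v

variable {Var : Type u} {P : Type v}

namespace Formula

/-- One step in the closure: passing to a member of a connective or unfolding. -/
inductive Step : Formula Var P → Formula Var P → Prop
  | disj {n : ℕ} (Γ : Fin n → Formula Var P) (i : Fin n) : Step (.disj Γ) (Γ i)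
  | conj {n : ℕ} (Γ : Fin n → Formula Var P) (i : Fin n) : Step (.conj Γ) (Γ i)
  | nabla {n : ℕ} (Γ : Fin n → Formula Var P) (i : Fin n) : Step (.nabla Γ) (Γ i)
  | mu (x : Var) (ψ : Formula Var P) : Step (.mu x ψ) (subst x (.mu x ψ) ψ)
  | nu (x : Var) (ψ : Formula Var P) : Step (.nu x ψ) (subst x (.nu x ψ) ψ)

theorem Closed.subst_closed {x : Var} {χ ψ : Formula Var P} (h1 : χ.Closed)
    (h2 : ψ.freeVars \ {x} = ∅) : (subst x χ ψ).Closed := by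
  have := freeVars_subst x χ ψ
  rw [h2, h1] at this
  exact subset_empty_iff.1 (by simpa using this)

theorem Closed.step {φ φ' : Formula Var P} (h : φ.Closed) (hs : Step φ φ') : φ'.Closed := by
  cases hs with
  | disj Γ i => exact iUnion_eq_empty.1 h i
  | conj Γ i => exact iUnion_eq_empty.1 h i
  | nabla Γ i => exact iUnion_eq_empty.1 h i
  | mu x ψ => exact h.subst_closed h
  | nu x ψ => exact h.subst_closed h

theorem _root_.MuCalc.EqSystem.Clos.step {A : EqSystem Var P} {φ φ' : Formula Var P}
    (h : φ ∈ A.Clos) (hs : Step φ φ') : φ' ∈ A.Clos := by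
  cases hs with
  | disj Γ i => exact .disj h i
  | conj Γ i => exact .conj h i
  | nabla Γ i => exact .nabla h i
  | mu x ψ => exact .mu h
  | nu x ψ => exact .nu h

/-- The number of symbols. -/
def size : Formula Var P → ℕ
  | prop _ => 1
  | nprop _ => 1
  | var _ => 1
  | disj Γ => 1 + ∑ i, size (Γ i)
  | conj Γ => 1 + ∑ i, size (Γ i)
  | nabla Γ => 1 + ∑ i, size (Γ i)
  | mu _ φ => 1 + size φ
  | nu _ φ => 1 + size φ

open Classical in
/-- Simultaneous substitution of `e x` for the free occurrences of all variables `x`. -/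
noncomputable def msubst : Formula Var P → (Var → Formula Var P) → Formula Var P
  | prop p, _ => prop p
  | nprop p, _ => nprop p
  | var x, e => e x
  | disj Γ, e => disj fun i => msubst (Γ i) e
  | conj Γ, e => conj fun i => msubst (Γ i) e
  | nabla Γ, e => nabla fun i => msubst (Γ i) e
  | mu x φ, e => mu x (msubst φ (Function.update e x (var x)))
  | nu x φ, e => nu x (msubst φ (Function.update e x (var x)))

theorem freeVars_msubst (ψ : Formula Var P) (e : Var → Formula Var P) {y : Var}
    (hy : y ∈ (ψ.msubst e).freeVars) : ∃ z ∈ ψ.freeVars, y ∈ (e z).freeVars := by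
  classical
  induction ψ generalizing e with
  | prop p => exact hy.elim
  | nprop p => exact hy.elim
  | var x => exact ⟨x, rfl, hy⟩
  | disj Γ ih | conj Γ ih | nabla Γ ih =>
    simp only [msubst, freeVars, mem_iUnion] at hy ⊢
    obtain ⟨i, hi⟩ := hy
    obtain ⟨z, hz, hz'⟩ := ih i e hi
    exact ⟨z, ⟨i, hz⟩, hz'⟩
  | mu x φ ih | nu x φ ih =>
    obtain ⟨h1, h2⟩ := hy
    obtain ⟨z, hz, hz'⟩ := ih _ h1
    by_cases h : z = x
    · subst h
      rw [Function.update_self] at hz'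
      exact absurd hz' h2
    · rw [Function.update_of_ne h] at hz'
      exact ⟨z, ⟨hz, h⟩, hz'⟩

theorem closed_msubst {ψ : Formula Var P} {e : Var → Formula Var P}
    (h : ∀ z ∈ ψ.freeVars, (e z).Closed) : (ψ.msubst e).Closed := by
  refine eq_empty_of_forall_notMem fun y hy => ?_
  obtain ⟨z, hz, hz'⟩ := freeVars_msubst ψ e hy
  rw [h z hz] at hz'
  exact hz'

theorem msubst_var (ψ : Formula Var P) : ψ.msubst var = ψ := by
  classical
  induction ψ with
  | prop p => rfl
  | nprop p => rfl
  | var x => rfl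
  | disj Γ ih | conj Γ ih | nabla Γ ih =>
    simp only [msubst]
    congr 1
    funext i
    exact ih i
  | mu x φ ih | nu x φ ih =>
    simp only [msubst]
    rw [Function.update_eq_self, ih]

theorem subst_of_notMem {x : Var} {χ ψ : Formula Var P} (h : x ∉ ψ.freeVars) :
    subst x χ ψ = ψ := by
  induction ψ with
  | prop p => rfl
  | nprop p => rfl
  | var y => exact if_neg fun h' => h h'.symm
  | disj Γ ih | conj Γ ih | nabla Γ ih =>
    simp only [subst]
    congr 1
    funext i
    exact ih i fun hi => h (mem_iUnion.2 ⟨i, hi⟩)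
  | mu y φ ih | nu y φ ih =>
    simp only [subst]
    split_ifs with hy
    · rfl
    · rw [ih fun hx => h ⟨hx, fun h' => hy h'.symm⟩]

open Classical in
theorem subst_msubst (x : Var) (χ ψ : Formula Var P) (e : Var → Formula Var P)
    (h : ∀ z ∈ ψ.freeVars, z ≠ x → x ∉ (e z).freeVars) :
    subst x χ (ψ.msubst (Function.update e x (var x))) = ψ.msubst (Function.update e x χ) := by
  induction ψ generalizing e with
  | prop p => rfl
  | nprop p => rfl
  | var y =>
    simp only [msubst]
    by_cases hy : y = x
    · subst hy
      simp [subst]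
    · rw [Function.update_of_ne hy, Function.update_of_ne hy]
      exact subst_of_notMem (h y rfl hy)
  | disj Γ ih | conj Γ ih | nabla Γ ih =>
    simp only [msubst, subst]
    congr 1
    funext i
    exact ih i e fun z hz => h z (mem_iUnion.2 ⟨i, hz⟩)
  | mu y φ ih | nu y φ ih =>
    simp only [msubst, subst]
    by_cases hy : y = x
    · subst hy
      simp
    · rw [if_neg hy, Function.update_comm (Ne.symm hy), ih, Function.update_comm (Ne.symm hy)]
      intro z hz hzx
      by_cases hzy : z = y
      · subst hzy
        rw [Function.update_self]
        exact fun h' => hzx (Eq.symm h')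
      · rw [Function.update_of_ne hzy]
        exact h z ⟨hz, hzy⟩ hzx

theorem size_le_msubst (ψ : Formula Var P) (e : Var → Formula Var P) {z : Var}
    (hz : z ∈ ψ.freeVars) : (e z).size ≤ (ψ.msubst e).size := by
  classical
  induction ψ generalizing e with
  | prop p => exact hz.elim
  | nprop p => exact hz.elim
  | var x =>
    rw [show z = x from hz]
    exact le_rfl
  | disj Γ ih | conj Γ ih | nabla Γ ih =>
    obtain ⟨i, hi⟩ := mem_iUnion.1 hz
    simp only [msubst, size]
    have h1 := ih i e hi
    have h2 := Finset.single_le_sum (f := fun i => ((Γ i).msubst e).size) (fun _ _ => Nat.zero_le _)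
      (Finset.mem_univ i)
    omega
  | mu x φ ih | nu x φ ih =>
    have h1 := ih (Function.update e x (var x)) hz.1
    rw [Function.update_of_ne hz.2] at h1
    simp only [msubst, size]
    omega

open Classical in
/-- The formulas that arise from `ψ` under the substitution `e` by steps inside `ψ`. -/
noncomputable def sub : Formula Var P → (Var → Formula Var P) → Set (Formula Var P)
  | prop p, _ => {prop p}
  | nprop p, _ => {nprop p}
  | var x, e => {e x}
  | disj Γ, e => insert (msubst (disj Γ) e) (⋃ i, sub (Γ i) e)
  | conj Γ, e => insert (msubst (conj Γ) e) (⋃ i, sub (Γ i) e)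
  | nabla Γ, e => insert (msubst (nabla Γ) e) (⋃ i, sub (Γ i) e)
  | mu x φ, e => insert (msubst (mu x φ) e) (sub φ (Function.update e x (msubst (mu x φ) e)))
  | nu x φ, e => insert (msubst (nu x φ) e) (sub φ (Function.update e x (msubst (nu x φ) e)))

theorem sub_finite (ψ : Formula Var P) (e : Var → Formula Var P) : (sub ψ e).Finite := by
  induction ψ generalizing e with
  | prop p => exact finite_singleton _
  | nprop p => exact finite_singleton _
  | var x => exact finite_singleton _
  | disj Γ ih | conj Γ ih | nabla Γ ih => exact (finite_iUnion fun i => ih i e).insert _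
  | mu x φ ih | nu x φ ih => exact (ih _).insert _

theorem mem_sub_self (ψ : Formula Var P) (e : Var → Formula Var P) : ψ.msubst e ∈ sub ψ e := by
  cases ψ with
  | prop p => rfl
  | nprop p => rfl
  | var x => rfl
  | disj Γ => exact mem_insert _ _
  | conj Γ => exact mem_insert _ _
  | nabla Γ => exact mem_insert _ _
  | mu x φ => exact mem_insert _ _
  | nu x φ => exact mem_insert _ _

open Classical in
theorem closed_update {x : Var} {ψ η : Formula Var P} {e : Var → Formula Var P}
    (he : ∀ z ∈ ψ.freeVars \ {x}, (e z).Closed) (hη : η.Closed) :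
    ∀ z ∈ ψ.freeVars, (Function.update e x η z).Closed := by
  intro z hz
  by_cases h : z = x
  · rw [h, Function.update_self]; exact hη
  · rw [Function.update_of_ne h]; exact he z ⟨hz, h⟩

open Classical in
theorem unfold_msubst {x : Var} {ψ η : Formula Var P} {e : Var → Formula Var P}
    (he : ∀ z ∈ ψ.freeVars \ {x}, (e z).Closed) :
    subst x η (ψ.msubst (Function.update e x (var x))) = ψ.msubst (Function.update e x η) := by
  refine subst_msubst x η ψ e fun z hz hzx => ?_
  rw [he z ⟨hz, hzx⟩]
  exact notMem_empty x

theorem sub_step {ψ : Formula Var P} {e : Var → Formula Var P}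
    (he : ∀ z ∈ ψ.freeVars, (e z).Closed) {φ φ' : Formula Var P} (hφ : φ ∈ sub ψ e)
    (hs : Step φ φ') : φ' ∈ sub ψ e ∨ ∃ z ∈ ψ.freeVars, Step (e z) φ' := by
  classical
  induction ψ generalizing e with
  | prop p =>
    obtain rfl : φ = prop p := hφ
    cases hs
  | nprop p =>
    obtain rfl : φ = nprop p := hφ
    cases hs
  | var x =>
    obtain rfl : φ = e x := hφ
    exact Or.inr ⟨x, rfl, hs⟩
  | disj Γ ih | conj Γ ih | nabla Γ ih =>
    rcases hφ with rfl | hφ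
    · simp only [msubst] at hs
      cases hs with
      | _ _ i => exact Or.inl (Or.inr (mem_iUnion.2 ⟨i, mem_sub_self _ _⟩))
    · obtain ⟨i, hi⟩ := mem_iUnion.1 hφ
      rcases ih i (fun z hz => he z (mem_iUnion.2 ⟨i, hz⟩)) hi with h | ⟨z, hz, h⟩
      · exact Or.inl (Or.inr (mem_iUnion.2 ⟨i, h⟩))
      · exact Or.inr ⟨z, mem_iUnion.2 ⟨i, hz⟩, h⟩
  | mu x ψ ih =>
    have hη := closed_msubst he
    have hunf : ∀ χ, Step (msubst (mu x ψ) e) χ → χ ∈ sub (mu x ψ) e := by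
      intro χ hχ
      simp only [msubst] at hχ
      cases hχ
      rw [unfold_msubst he]
      exact Or.inr (mem_sub_self _ _)
    rcases hφ with rfl | hφ
    · exact Or.inl (hunf _ hs)
    · rcases ih (closed_update he hη) hφ with h | ⟨z, hz, h⟩
      · exact Or.inl (Or.inr h)
      · by_cases hzx : z = x
        · rw [hzx, Function.update_self] at h
          exact Or.inl (hunf _ h)
        · rw [Function.update_of_ne hzx] at h
          exact Or.inr ⟨z, ⟨hz, hzx⟩, h⟩
  | nu x ψ ih =>
    have hη := closed_msubst he
    have hunf : ∀ χ, Step (msubst (nu x ψ) e) χ → χ ∈ sub (nu x ψ) e := by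
      intro χ hχ
      simp only [msubst] at hχ
      cases hχ
      rw [unfold_msubst he]
      exact Or.inr (mem_sub_self _ _)
    rcases hφ with rfl | hφ
    · exact Or.inl (hunf _ hs)
    · rcases ih (closed_update he hη) hφ with h | ⟨z, hz, h⟩
      · exact Or.inl (Or.inr h)
      · by_cases hzx : z = x
        · rw [hzx, Function.update_self] at h
          exact Or.inl (hunf _ h)
        · rw [Function.update_of_ne hzx] at h
          exact Or.inr ⟨z, ⟨hz, hzx⟩, h⟩

/-- A closed formula has only finitely many iterated components. -/
theorem Closed.exists_finite {ψ : Formula Var P} (h : ψ.Closed) :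
    ∃ D : Set (Formula Var P), D.Finite ∧ ψ ∈ D ∧ ∀ φ ∈ D, ∀ φ', Step φ φ' → φ' ∈ D := by
  refine ⟨sub ψ var, sub_finite _ _, ?_, fun φ hφ φ' hs => ?_⟩
  · have := mem_sub_self ψ var
    rwa [msubst_var] at this
  · rcases sub_step (by rw [h]; simp) hφ hs with h' | ⟨z, hz, -⟩
    · exact h'
    · rw [h] at hz; exact hz.elim

end Formula

end MuCalc

/-! ### Certificates for truth and falsity -/

namespace MuCalc

universe u v

variable {Var : Type u} {P : Type v}

namespace Formula

/-- Fixpoint formulas. -/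
def IsFix : Formula Var P → Prop
  | mu _ _ => True
  | nu _ _ => True
  | _ => False

/-- Modal formulas. -/
def IsNabla : Formula Var P → Prop
  | nabla _ => True
  | _ => False

/-- Priorities of formulas of size at most `M`: larger fixpoint formulas are less significant,
and other formulas are insignificant. -/
def prio (M : ℕ) : Formula Var P → ℕ
  | mu x φ => if (mu x φ).size ≤ M then 2 * (mu x φ).size + 1 else 2 * M + 4
  | nu x φ => if (nu x φ).size ≤ M then 2 * (nu x φ).size + 2 else 2 * M + 4
  | _ => 2 * M + 4

theorem prio_le (M : ℕ) (φ : Formula Var P) : φ.prio M ≤ 2 * M + 4 := by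
  cases φ <;> simp only [prio, le_refl] <;> split_ifs <;> omega

theorem IsFix.prio_le {M : ℕ} {φ : Formula Var P} (h : φ.IsFix) (hM : φ.size ≤ M) :
    φ.prio M ≤ 2 * φ.size + 2 := by
  cases φ <;> first | exact h.elim | (simp only [prio, if_pos hM]; omega)

/-- The priority shift for certificates of falsity, which exchanges the roles of the fixpoints. -/
def shift (b : Bool) : ℕ := if b then 0 else 1

/-- `p` if `b` is true, and the negation of `p` if `b` is false. -/
def Holds : Bool → Prop → Prop
  | true, p => p
  | false, p => ¬ p

/-- A certificate for the truth (`b = true`) or falsity (`b = false`) of the formulas in `K s` at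
the states `s`: each claim is reduced to others by the relation `St`. -/
structure Cert (S : Frame P) (M : ℕ) (b : Bool) (K : S.State → Formula Var P → Prop)
    (St : S.State × Formula Var P → S.State × Formula Var P → Prop) : Prop where
  size : ∀ s φ, K s φ → φ.size ≤ M
  mem : ∀ s φ s' φ', K s φ → St (s, φ) (s', φ') → K s' φ'
  prop : ∀ s p, K s (.prop p) → Holds b (s ∈ S.label p)
  nprop : ∀ s p, K s (.nprop p) → Holds b (s ∉ S.label p)
  disj : ∀ s n (Γ : Fin n → Formula Var P), K s (.disj Γ) →
    (b = true → ∃ i, St (s, .disj Γ) (s, Γ i)) ∧ (b = false → ∀ i, St (s, .disj Γ) (s, Γ i))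
  conj : ∀ s n (Γ : Fin n → Formula Var P), K s (.conj Γ) →
    (b = true → ∀ i, St (s, .conj Γ) (s, Γ i)) ∧ (b = false → ∃ i, St (s, .conj Γ) (s, Γ i))
  nabla : ∀ s n (Γ : Fin n → Formula Var P), K s (.nabla Γ) →
    (b = true → (∃ r ∈ S.succs s, ∀ i, St (s, .nabla Γ) (r, Γ i)) ∨
      ∃ i, ∀ r ∈ S.succs s, St (s, .nabla Γ) (r, Γ i)) ∧
    (b = false → (∀ r ∈ S.succs s, ∃ i, St (s, .nabla Γ) (r, Γ i)) ∧
      ∀ i, ∃ r ∈ S.succs s, St (s, .nabla Γ) (r, Γ i))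
  mu : ∀ s x ψ, K s (.mu x ψ) → St (s, .mu x ψ) (s, subst x (.mu x ψ) ψ)
  nu : ∀ s x ψ, K s (.nu x ψ) → St (s, .nu x ψ) (s, subst x (.nu x ψ) ψ)

/-- Chains of claims of priorities at least `q`. -/
def Chain {S : Frame P} (M : ℕ) (St : S.State × Formula Var P → S.State × Formula Var P → Prop)
    (q : ℕ) : S.State × Formula Var P → S.State × Formula Var P → Prop :=
  Relation.ReflTransGen fun v w => St v w ∧ q ≤ v.2.prio M

/-- Certificates are correct if ranks decrease along their chains. The formula `ψ` is read under a
substitution `e` of closed fixpoint formulas for its free variables; the valuation `V` need be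
right only at claims about `e z` that are reached without passing a formula more significant than
`e z`. -/
theorem Cert.holds {S : Frame P} {M : ℕ} {b : Bool} {K : S.State → Formula Var P → Prop}
    {St : S.State × Formula Var P → S.State × Formula Var P → Prop} (hC : Cert S M b K St)
    (hρ : ∀ p, (p + shift b) % 2 = 1 → ∃ ρ : S.State × Formula Var P → Ordinal.{max u v},
      ∀ v w, St v w → p ≤ v.2.prio M → ρ w ≤ ρ v ∧ (v.2.prio M = p → ρ w < ρ v))
    (ψ : Formula Var P) : ∀ (e : Var → Formula Var P) (V : Var → Set S.State),
    (∀ z ∈ ψ.freeVars, (e z).Closed ∧ (e z).IsFix) → ∀ s, K s (ψ.msubst e) →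
    (∀ z ∈ ψ.freeVars, ∀ t, Chain M St ((e z).prio M) (s, ψ.msubst e) (t, e z) → K t (e z) →
      Holds b (t ∈ V z)) → Holds b (s ∈ ψ.den S V) := by
  classical
  induction ψ with
  | prop p => exact fun e V _ s hs _ => hC.prop s p hs
  | nprop p => exact fun e V _ s hs _ => hC.nprop s p hs
  | var x => exact fun e V _ s hs h => h x rfl s .refl hs
  | disj Γ ih =>
    intro e V he s hs h
    have key : ∀ i, St (s, msubst (.disj Γ) e) (s, (Γ i).msubst e) →
        Holds b (s ∈ (Γ i).den S V) := fun i hi =>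
      ih i e V (fun z hz => he z (mem_iUnion.2 ⟨i, hz⟩)) s (hC.mem _ _ _ _ hs hi)
        fun z hz t ht hK => h z (mem_iUnion.2 ⟨i, hz⟩) t (ht.head ⟨hi, prio_le _ _⟩) hK
    obtain ⟨h1, h2⟩ := hC.disj s _ _ hs
    cases b with
    | true =>
      obtain ⟨i, hi⟩ := h1 rfl
      exact mem_iUnion.2 ⟨i, key i hi⟩
    | false =>
      intro hc
      obtain ⟨i, hi⟩ := mem_iUnion.1 hc
      exact key i (h2 rfl i) hi
  | conj Γ ih =>
    intro e V he s hs h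
    have key : ∀ i, St (s, msubst (.conj Γ) e) (s, (Γ i).msubst e) →
        Holds b (s ∈ (Γ i).den S V) := fun i hi =>
      ih i e V (fun z hz => he z (mem_iUnion.2 ⟨i, hz⟩)) s (hC.mem _ _ _ _ hs hi)
        fun z hz t ht hK => h z (mem_iUnion.2 ⟨i, hz⟩) t (ht.head ⟨hi, prio_le _ _⟩) hK
    obtain ⟨h1, h2⟩ := hC.conj s _ _ hs
    cases b with
    | true => exact mem_iInter.2 fun i => key i (h1 rfl i)
    | false =>
      intro hc
      obtain ⟨i, hi⟩ := h2 rfl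
      exact key i hi (mem_iInter.1 hc i)
  | nabla Γ ih =>
    intro e V he s hs h
    have key : ∀ i r, St (s, msubst (.nabla Γ) e) (r, (Γ i).msubst e) →
        Holds b (r ∈ (Γ i).den S V) := fun i r hi =>
      ih i e V (fun z hz => he z (mem_iUnion.2 ⟨i, hz⟩)) r (hC.mem _ _ _ _ hs hi)
        fun z hz t ht hK => h z (mem_iUnion.2 ⟨i, hz⟩) t (ht.head ⟨hi, prio_le _ _⟩) hK
    obtain ⟨h1, h2⟩ := hC.nabla s _ _ hs
    cases b with
    | true =>
      rcases h1 rfl with ⟨r, hr, h3⟩ | ⟨i, hi⟩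
      · refine Or.inr ⟨r, ?_, hr⟩
        rintro _ ⟨i, rfl⟩
        exact key i r (h3 i)
      · exact Or.inl ⟨_, ⟨i, rfl⟩, fun r hr => key i r (hi r hr)⟩
    | false =>
      obtain ⟨h3, h4⟩ := h2 rfl
      rintro (⟨_, ⟨i, rfl⟩, hi⟩ | ⟨r, hr, hr'⟩)
      · obtain ⟨r, hr, h5⟩ := h4 i
        exact key i r h5 (hi hr)
      · obtain ⟨i, hi⟩ := h3 r hr'
        exact key i r hi (hr _ ⟨i, rfl⟩)
  | mu x ψ ih | nu x ψ ih =>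
    intro e V he s hs h
    generalize hη : msubst _ e = η at hs h
    have hcl : η.Closed := hη ▸ closed_msubst fun z hz => (he z hz).1
    have hfix : η.IsFix := by rw [← hη]; trivial
    -- the unfolding of the fixpoint formula `η`
    have hstep : ∀ t, K t η → St (t, η) (t, ψ.msubst (Function.update e x η)) := by
      intro t ht
      rw [← unfold_msubst fun z hz => (he z hz).1]
      subst hη
      first | exact hC.mu _ _ _ ht | exact hC.nu _ _ _ ht
    have hprio : ∀ z ∈ ψ.freeVars, z ≠ x → (e z).prio M ≤ η.prio M := by
      intro z hz hzx
      have h1 := size_le_msubst ψ (Function.update e x (var x)) hz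
      rw [Function.update_of_ne hzx] at h1
      have h2 : η.size = 1 + (ψ.msubst (Function.update e x (var x))).size := by rw [← hη]; rfl
      have h3 := hC.size _ _ hs
      have h4 := (he z ⟨hz, hzx⟩).2.prio_le (M := M) (by omega)
      have h5 : 2 * η.size + 1 ≤ η.prio M := by
        subst hη
        simp only [msubst, prio] at h3 ⊢
        rw [if_pos h3] <;> omega
      omega
    let Reach : S.State → Prop := fun t => K t η ∧ Chain M St (η.prio M) (s, η) (t, η)
    have hR : Reach s := ⟨hs, .refl⟩
    have key : ∀ t, Reach t → ∀ U : Set S.State,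
        (∀ t', Reach t' → Chain M St (η.prio M) (t, ψ.msubst (Function.update e x η)) (t', η) →
          Holds b (t' ∈ U)) → Holds b (t ∈ ψ.den S (Function.update V x U)) := by
      intro t ht U hU
      have hst := hstep t ht.1
      refine ih _ _ (fun z hz => ?_) t (hC.mem _ _ _ _ ht.1 hst) fun z hz t' hch hK => ?_
      · by_cases hzx : z = x
        · rw [hzx, Function.update_self]; exact ⟨hcl, hfix⟩
        · rw [Function.update_of_ne hzx]; exact he z ⟨hz, hzx⟩
      · by_cases hzx : z = x
        · subst hzx
          rw [Function.update_self] at hch hK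
          rw [Function.update_self]
          exact hU t' ⟨hK, ht.2.trans (hch.head ⟨hst, le_rfl⟩)⟩ hch
        · rw [Function.update_of_ne hzx] at hch hK
          rw [Function.update_of_ne hzx]
          have h1 := hprio z hz hzx
          refine h z ⟨hz, hzx⟩ t' (Relation.ReflTransGen.trans ?_ (hch.head ⟨hst, h1⟩)) hK
          have hle : ∀ v w, (St v w ∧ η.prio M ≤ v.2.prio M) → St v w ∧ (e z).prio M ≤ v.2.prio M :=
            fun v w hvw => ⟨hvw.1, h1.trans hvw.2⟩
          exact Relation.ReflTransGen.mono hle _ _ ht.2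
    have least : (η.prio M + shift b) % 2 = 1 → ∀ U : Set S.State,
        (∀ t, Reach t → Holds b (t ∈ ψ.den S (Function.update V x U)) → Holds b (t ∈ U)) →
        Holds b (s ∈ U) := by
      intro hodd U hU
      obtain ⟨ρ, hρ⟩ := hρ _ hodd
      have hmono : ∀ v w, Chain M St (η.prio M) v w → ρ w ≤ ρ v := by
        intro v w hvw
        induction hvw with
        | refl => exact le_rfl
        | tail _ h2 ih => exact (hρ _ _ h2.1 h2.2).1.trans ih
      have : ∀ o t, Reach t → ρ (t, η) = o → Holds b (t ∈ U) := by
        intro o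
        induction o using WellFoundedLT.induction with
        | ind o ih' =>
          rintro t ht rfl
          refine hU t ht (key t ht U fun t' ht' hch => ih' _ ?_ t' ht' rfl)
          exact (hmono _ _ hch).trans_lt ((hρ _ _ (hstep t ht.1) le_rfl).2 rfl)
      exact this _ s hR rfl
    have hsz := hC.size _ _ hs
    subst hη
    cases b with
    | true =>
      first
      | refine mem_sInter.2 fun U hU => least ?_ U fun t _ ht => hU ht
        simp only [msubst, prio] at hsz ⊢
        rw [if_pos hsz]
        simp only [shift, if_true]
        omega
      | exact mem_sUnion.2 ⟨{t | Reach t}, fun t ht => key t ht _ fun t' ht' _ => ht', hR⟩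
    | false =>
      first
      | intro hc
        obtain ⟨U, hU, hsU⟩ := mem_sUnion.1 hc
        refine least ?_ U (fun t _ ht htU => ht (hU htU)) hsU
        simp only [msubst, prio] at hsz ⊢
        rw [if_pos hsz]
        simp only [shift]
        simp
        omega
      | intro hc
        let U : Set S.State := {t | ¬ Reach t}
        have hU : U ∈ {U | ψ.den S (Function.update V x U) ⊆ U} := fun t ht hR' =>
          key t hR' U (fun t' ht' _ => fun h' : ¬ Reach t' => h' ht') ht
        exact mem_sInter.1 hc U hU hR

end Formula

end MuCalc

/-! ### The truth game and its transfer to other frames -/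

theorem SetGame.ParWin.unique {V : Type*} {Ω : V → ℕ} {e e' : ℕ} {z : ℕ → V}
    (h : SetGame.ParWin Ω e z) (h' : SetGame.ParWin Ω e' z) : e = e' := by
  obtain ⟨m, rfl, h1, h2⟩ := h
  obtain ⟨m', rfl, h1', h2'⟩ := h'
  obtain ⟨n, h3, h4⟩ := (h1.and_eventually h2').exists
  obtain ⟨n', h3', h4'⟩ := (h1'.and_eventually h2).exists
  have : m = m' := by omega
  rw [this]

theorem SetGame.ParWin.of_add {V : Type*} {Ω : V → ℕ} {k e : ℕ} {z : ℕ → V}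
    (h : SetGame.ParWin (fun v => Ω v + k) ((e + k) % 2) z) : SetGame.ParWin Ω (e % 2) z := by
  obtain ⟨m, hm, h1, h2⟩ := h
  obtain ⟨n, hn⟩ := h1.exists
  dsimp only at hn
  refine ⟨m - k, by omega, h1.mono fun n hn => ?_, h2.mono fun n hn => ?_⟩
  · dsimp only at hn
    omega
  · dsimp only at hn
    omega

theorem SetGame.ParWin.congr {V V' : Type*} {Ω : V → ℕ} {Ω' : V' → ℕ} {e : ℕ} {z : ℕ → V}
    {z' : ℕ → V'} (h : SetGame.ParWin Ω e z) (hz : ∀ n, Ω' (z' n) = Ω (z n)) :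
    SetGame.ParWin Ω' e z' := by
  simpa only [SetGame.ParWin, hz] using h

namespace MuCalc

universe u v

variable {Var : Type u} {P : Type v}

open Formula

/-- The condition on a set `Z` of claims under which it suffices for the truth of `φ` at `s`. -/
def Eff (S : Frame P) (Z : Set (S.State × Formula Var P)) (s : S.State) : Formula Var P → Prop
  | .prop p => s ∈ S.label p
  | .nprop p => s ∉ S.label p
  | .var _ => False
  | .disj Γ => ∃ i, (s, Γ i) ∈ Z
  | .conj Γ => ∀ i, (s, Γ i) ∈ Z
  | .nabla Γ => (∃ r ∈ S.succs s, ∀ i, (r, Γ i) ∈ Z) ∨ ∃ i, ∀ r ∈ S.succs s, (r, Γ i) ∈ Z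
  | .mu x ψ => (s, subst x (.mu x ψ) ψ) ∈ Z
  | .nu x ψ => (s, subst x (.nu x ψ) ψ) ∈ Z

theorem Eff.mono {S : Frame P} {Z Z' : Set (S.State × Formula Var P)} (h : Z ⊆ Z') {s : S.State}
    {φ : Formula Var P} (hφ : Eff S Z s φ) : Eff S Z' s φ := by
  cases φ with
  | prop p => exact hφ
  | nprop p => exact hφ
  | var x => exact hφ
  | disj Γ =>
    obtain ⟨i, hi⟩ := hφ
    exact ⟨i, h hi⟩
  | conj Γ => exact fun i => h (hφ i)
  | nabla Γ =>
    rcases hφ with ⟨r, hr, h1⟩ | ⟨i, hi⟩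
    · exact Or.inl ⟨r, hr, fun i => h (h1 i)⟩
    · exact Or.inr ⟨i, fun r hr => h (hi r hr)⟩
  | mu x ψ => exact h hφ
  | nu x ψ => exact h hφ

/-- Positional strategies of both players in the truth game of a frame: `W` is the set of true
claims, `Z true` the strategy that verifies them and `Z false` the one that refutes the others. -/
structure Strat (S : Frame P) (Var : Type u) (M : ℕ) where
  W : Set (S.State × Formula Var P)
  Z : Bool → S.State × Formula Var P → Set (S.State × Formula Var P)
  eff : ∀ v ∈ W, Eff S (Z true v) v.1 v.2
  eff' : ∀ v ∉ W, ¬ Eff S (Z false v)ᶜ v.1 v.2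
  sub : ∀ b v, Holds b (v ∈ W) → ∀ w ∈ Z b v, Holds b (w ∈ W)
  good : ∀ b, ∀ z : ℕ → S.State × Formula Var P, Holds b (z 0 ∈ W) →
    (∀ n, z (n + 1) ∈ Z b (z n)) → SetGame.ParWin (fun v => v.2.prio M) (shift b) z

theorem exists_strat (S : Frame P) (M : ℕ) : Nonempty (Strat S Var M) := by
  obtain ⟨W, Z, D, h1, h2⟩ := SetGame.determinacy (2 * M + 5) 0 (S.State × Formula Var P)
    (fun v => {Z | Eff S Z v.1 v.2}) (fun v => v.2.prio M) (fun v Y Y' h hs => Eff.mono hs h)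
    (fun v => ⟨Nat.zero_le _, by have := prio_le M v.2; omega⟩)
  refine ⟨⟨W, fun b => if b then Z else D, fun v hv => by simpa using h1.mem v hv,
    fun v hv => by simpa [SetGame.dual] using h2.mem v hv, ?_, ?_⟩⟩
  · intro b v hv w hw
    cases b with
    | true => exact h1.sub v hv (by simpa using hw)
    | false => exact h2.sub v hv (by simpa using hw)
  · intro b z h0 hz
    cases b with
    | true => exact h1.good z h0 (by simpa using hz)
    | false => exact h2.good z h0 (by simpa using hz)

namespace Strat

variable {S : Frame P} {M : ℕ} (σ : Strat S Var M) (F : Set (Formula Var P))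

/-- Local steps of the strategies among the formulas of `F`. -/
def Loc (s : S.State) (b : Bool) (φ φ' : Formula Var P) : Prop :=
  Holds b ((s, φ) ∈ σ.W) ∧ φ ∈ F ∧ Step φ φ' ∧ ¬ φ.IsNabla ∧ (s, φ') ∈ σ.Z b (s, φ)

/-- Modal steps of the strategies among the formulas of `F`. -/
def Mod (s r : S.State) (b : Bool) (φ φ' : Formula Var P) : Prop :=
  Holds b ((s, φ) ∈ σ.W) ∧ φ ∈ F ∧ Step φ φ' ∧ φ.IsNabla ∧ (r, φ') ∈ σ.Z b (s, φ)

/-- The strategies lifted along a map `π` to another frame, where `lab t` is the state of the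
original frame that the edge to `t` stands for. -/
def TStep {S' : Frame P} (π lab : S'.State → S.State) (b : Bool)
    (v w : S'.State × Formula Var P) : Prop :=
  (w.1 = v.1 ∧ σ.Loc F (π v.1) b v.2 w.2) ∨
    (S'.R v.1 w.1 ∧ σ.Mod F (π v.1) (lab w.1) b v.2 w.2)

/-- A formula of `F` is true at a state of another frame iff it is true at its image, provided
edges lead to states of the type that they stand for and the lifted strategies are winning. -/
theorem mem_den_iff {S' : Frame P} {π lab : S'.State → S.State}
    (hF : ∀ φ ∈ F, φ.Closed ∧ φ.size ≤ M ∧ ∀ φ', Step φ φ' → φ' ∈ F)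
    (hlabel : ∀ t p, t ∈ S'.label p ↔ π t ∈ S.label p)
    (hR : ∀ t t', S'.R t t' → S.R (π t) (lab t'))
    (hR' : ∀ t, ∀ r ∈ S.succs (π t), ∃ t', S'.R t t' ∧ lab t' = r)
    (htype : ∀ t t', S'.R t t' → ∀ φ ∈ F, (lab t', φ) ∈ σ.W ↔ (π t', φ) ∈ σ.W)
    (hbad : ∀ b, ∀ z : ℕ → S'.State × Formula Var P,
      (∀ n, σ.TStep F π lab b (z n) (z (n + 1))) →
        ¬ SetGame.ParWin (fun v => v.2.prio M + shift b) 1 z)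
    (t : S'.State) {φ : Formula Var P} (hφ : φ ∈ F) :
    t ∈ φ.den S' (fun _ => ∅) ↔ (π t, φ) ∈ σ.W := by
  let K : Bool → S'.State → Formula Var P → Prop := fun b t φ =>
    Holds b ((π t, φ) ∈ σ.W) ∧ φ ∈ F
  have hmem : ∀ b t φ t' φ', K b t φ → σ.TStep F π lab b (t, φ) (t', φ') → K b t' φ' := by
    rintro b t φ t' φ' ⟨h1, h2⟩ (⟨h3, h4⟩ | ⟨h3, h4⟩)
    · obtain rfl : t' = t := h3
      exact ⟨σ.sub _ _ h1 _ h4.2.2.2.2, (hF φ h2).2.2 _ h4.2.2.1⟩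
    · have h5 : φ' ∈ F := (hF φ h2).2.2 _ h4.2.2.1
      have h6 := σ.sub _ _ h1 _ h4.2.2.2.2
      refine ⟨?_, h5⟩
      rwa [← htype t t' h3 φ' h5]
  have hcert : ∀ b, Cert S' M b (K b) (σ.TStep F π lab b) := by
    intro b
    have hloc : ∀ t φ φ', K b t φ → Step φ φ' → ¬ φ.IsNabla → (π t, φ') ∈ σ.Z b (π t, φ) →
        σ.TStep F π lab b (t, φ) (t, φ') := fun t φ φ' h1 h2 h3 h4 =>
      Or.inl ⟨rfl, h1.1, h1.2, h2, h3, h4⟩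
    have hmod : ∀ t t' φ φ', K b t φ → S'.R t t' → Step φ φ' → φ.IsNabla →
        (lab t', φ') ∈ σ.Z b (π t, φ) → σ.TStep F π lab b (t, φ) (t', φ') :=
      fun t t' φ φ' h1 h h2 h3 h4 => Or.inr ⟨h, h1.1, h1.2, h2, h3, h4⟩
    refine ⟨fun t φ h => (hF φ h.2).2.1, hmem b, ?_, ?_, ?_, ?_, ?_, ?_, ?_⟩
    · intro t p h
      cases b with
      | true => exact (hlabel t p).2 (σ.eff _ h.1)
      | false => exact fun h' => σ.eff' _ h.1 ((hlabel t p).1 h')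
    · intro t p h
      cases b with
      | true => exact fun h' => σ.eff _ h.1 ((hlabel t p).1 h')
      | false => exact fun h' => σ.eff' _ h.1 fun h'' => h' ((hlabel t p).2 h'')
    · intro t n Γ h
      refine ⟨?_, ?_⟩ <;> rintro rfl
      · obtain ⟨i, hi⟩ := σ.eff _ h.1
        exact ⟨i, hloc _ _ _ h (.disj Γ i) id hi⟩
      · intro i
        refine hloc _ _ _ h (.disj Γ i) id ?_
        by_contra hc
        exact σ.eff' _ h.1 ⟨i, hc⟩
    · intro t n Γ h
      refine ⟨?_, ?_⟩ <;> rintro rfl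
      · intro i
        exact hloc _ _ _ h (.conj Γ i) id (σ.eff _ h.1 i)
      · by_contra hc
        push Not at hc
        refine σ.eff' _ h.1 fun i => ?_
        exact fun h' => hc i (hloc _ _ _ h (.conj Γ i) id h')
    · intro t n Γ h
      refine ⟨?_, ?_⟩ <;> rintro rfl
      · rcases σ.eff _ h.1 with ⟨r, hr, h1⟩ | ⟨i, h1⟩
        · obtain ⟨t', h2, rfl⟩ := hR' t r hr
          exact Or.inl ⟨t', h2, fun i => hmod _ _ _ _ h h2 (.nabla Γ i) trivial (h1 i)⟩
        · exact Or.inr ⟨i, fun t' h2 =>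
            hmod _ _ _ _ h h2 (.nabla Γ i) trivial (h1 _ (hR _ _ h2))⟩
      · refine ⟨fun t' h2 => ?_, fun i => ?_⟩
        · by_contra hc
          push Not at hc
          refine σ.eff' _ h.1 (Or.inl ⟨lab t', hR _ _ h2, fun i h' => hc i ?_⟩)
          exact hmod _ _ _ _ h h2 (.nabla Γ i) trivial h'
        · by_contra hc
          push Not at hc
          refine σ.eff' _ h.1 (Or.inr ⟨i, fun r hr h' => ?_⟩)
          obtain ⟨t', h2, rfl⟩ := hR' t r hr
          exact hc t' h2 (hmod _ _ _ _ h h2 (.nabla Γ i) trivial h')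
    · intro t x ψ h
      refine hloc _ _ _ h (.mu x ψ) id ?_
      cases b with
      | true => exact σ.eff _ h.1
      | false =>
        by_contra hc
        exact σ.eff' _ h.1 hc
    · intro t x ψ h
      refine hloc _ _ _ h (.nu x ψ) id ?_
      cases b with
      | true => exact σ.eff _ h.1
      | false =>
        by_contra hc
        exact σ.eff' _ h.1 hc
  have hρ : ∀ b p, (p + shift b) % 2 = 1 →
      ∃ ρ : S'.State × Formula Var P → Ordinal.{max u v}, ∀ v w, σ.TStep F π lab b v w →
        p ≤ v.2.prio M → ρ w ≤ ρ v ∧ (v.2.prio M = p → ρ w < ρ v) := by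
    intro b p hp
    obtain ⟨ρ, hρ⟩ := exists_parity_rank (hbad b) hp
    refine ⟨ρ, fun v w h1 h2 => ?_⟩
    obtain ⟨h3, h4⟩ := hρ v w h1 (by omega)
    exact ⟨h3, fun h => h4 (by omega)⟩
  have main : ∀ b, Holds b ((π t, φ) ∈ σ.W) → Holds b (t ∈ φ.den S' fun _ => ∅) := by
    intro b hb
    refine (hcert b).holds (hρ b) φ Formula.var _ ?_ t ?_ ?_
    · rw [(hF φ hφ).1]; simp
    · rw [msubst_var]; exact ⟨hb, hφ⟩
    · rw [(hF φ hφ).1]; simp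
  constructor
  · intro h
    by_contra hc
    exact main false hc h
  · exact main true

theorem not_parWin {b : Bool} {z : ℕ → S.State × Formula Var P}
    (hz : ∀ n, σ.TStep F id id b (z n) (z (n + 1))) :
    ¬ SetGame.ParWin (fun v => v.2.prio M + shift b) 1 z := by
  intro hbad
  have h0 : Holds b (z 0 ∈ σ.W) := by
    rcases hz 0 with h | h
    · exact h.2.1
    · exact h.2.1
  have h1 := σ.good b z h0 fun n => by
    rcases hz n with ⟨h1, h2⟩ | ⟨-, h2⟩
    · have := h2.2.2.2.2
      rw [show (id (z n).1 : S.State) = (z (n + 1)).1 from h1.symm] at this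
      rw [show z n = ((z (n + 1)).1, (z n).2) from Prod.ext h1.symm rfl]
      exact this
    · exact h2.2.2.2.2
  cases b with
  | true =>
    have h2 := SetGame.ParWin.of_add (k := 0) (e := 1) (by simpa [shift] using hbad)
    have := h1.unique h2
    simp [shift] at this
  | false =>
    have h2 := SetGame.ParWin.of_add (k := 1) (e := 0) (by simpa [shift] using hbad)
    have := h1.unique h2
    simp [shift] at this

theorem mem_den_iff_self (hF : ∀ φ ∈ F, φ.Closed ∧ φ.size ≤ M ∧ ∀ φ', Step φ φ' → φ' ∈ F)
    (s : S.State) {φ : Formula Var P} (hφ : φ ∈ F) :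
    s ∈ φ.den S (fun _ => ∅) ↔ (s, φ) ∈ σ.W := by
  refine σ.mem_den_iff F (π := id) (lab := id) hF (fun _ _ => Iff.rfl) (fun _ _ h => h)
    (fun t r hr => ⟨r, hr, rfl⟩) (fun _ _ _ _ _ => Iff.rfl) (fun b z hz => σ.not_parWin F hz) s hφ

end Strat

end MuCalc

/-! ### The greatest well-annotation -/

namespace MuCalc

universe u v

variable {Var : Type u} {P : Type v} {A : EqSystem Var P} {S : Frame P}

open Formula AnnSet Ordinal

/-- The requirements that a well-annotation imposes on an annotated formula `φ ^ α` at `s`. -/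
def StepOK (A : EqSystem Var P) (S : Frame P) (Θ : S.State → AnnSet Var P) (s : S.State)
    (φ : Formula Var P) (α : Ordinal.{0}) : Prop :=
  α < ω_ 1 ∧ φ ∈ A.Clos ∧ (φ.Closed → s ∈ φ.den S fun _ => ∅) ∧ match φ with
    | .var x => ∀ h : x ∈ A.X, ∃ β < α, (A.E ⟨x, h⟩, β) ∈ Θ s
    | .disj Γ => ∃ β ≤ α, ∃ i, (Γ i, β) ∈ Θ s
    | .conj Γ => ∀ i, ∃ β ≤ α, (Γ i, β) ∈ Θ s
    | .nabla Γ => (∃ r ∈ S.succs s, ∀ i, ∃ β ≤ α, (Γ i, β) ∈ Θ r) ∨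
        ∃ i, ∀ r ∈ S.succs s, ∃ β ≤ α, (Γ i, β) ∈ Θ r
    | _ => True

theorem AnnSet.le_ann_range_iff {Θ : AnnSet Var P} {n : ℕ} {Γ : Fin n → Formula Var P}
    {α : Ordinal.{0}} : Le Θ (ann (range Γ) α) ↔ ∀ i, ∃ β ≤ α, (Γ i, β) ∈ Θ := by
  constructor
  · exact fun h i => h (Γ i) α ⟨mem_range_self i, rfl⟩
  · rintro h _ _ ⟨⟨i, rfl⟩, rfl⟩
    exact h i

theorem AnnSet.le_ann_singleton_iff {Θ : AnnSet Var P} {φ : Formula Var P} {α : Ordinal.{0}} :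
    Le Θ (ann {φ} α) ↔ ∃ β ≤ α, (φ, β) ∈ Θ := by
  constructor
  · exact fun h => h φ α ⟨rfl, rfl⟩
  · rintro h _ _ ⟨rfl, rfl⟩
    exact h

theorem isWellAnnotation_iff {Θ : S.State → AnnSet Var P} :
    IsWellAnnotation A S Θ ↔ ∀ s φ α, (φ, α) ∈ Θ s → StepOK A S Θ s φ α := by
  constructor
  · intro h s φ α hφ
    refine ⟨h.countable s φ α hφ, h.mem_clos s φ α hφ, h.closed s φ α hφ, ?_⟩
    cases φ with
    | var x => exact fun hx => h.var s ⟨x, hx⟩ α hφ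
    | disj Γ =>
      obtain ⟨β, hβ, ⟨_, _⟩, ⟨⟨i, rfl⟩, rfl⟩, h2⟩ := h.disj s _ Γ α hφ
      exact ⟨_, hβ, i, h2⟩
    | conj Γ => exact le_ann_range_iff.1 (h.conj s _ Γ α hφ)
    | nabla Γ =>
      rcases h.nabla s _ Γ α hφ with ⟨r, hr, h1⟩ | ⟨_, ⟨i, rfl⟩, h1⟩
      · exact Or.inl ⟨r, hr, le_ann_range_iff.1 h1⟩
      · exact Or.inr ⟨i, fun r hr => le_ann_singleton_iff.1 (h1 r hr)⟩
    | _ => trivial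
  · intro h
    refine ⟨fun s φ α hφ => (h s φ α hφ).1, fun s φ α hφ => (h s φ α hφ).2.1,
      fun s φ α hφ => (h s φ α hφ).2.2.1, fun s x α hφ => (h s _ α hφ).2.2.2 x.2,
      fun s n Γ α hφ => ?_, fun s n Γ α hφ => le_ann_range_iff.2 (h s _ α hφ).2.2.2,
      fun s n Γ α hφ => ?_⟩
    · obtain ⟨β, hβ, i, h1⟩ := (h s _ α hφ).2.2.2
      exact ⟨β, hβ, (Γ i, β), ⟨mem_range_self i, rfl⟩, h1⟩
    · rcases (h s _ α hφ).2.2.2 with ⟨r, hr, h1⟩ | ⟨i, h1⟩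
      · exact Or.inl ⟨r, hr, le_ann_range_iff.2 h1⟩
      · exact Or.inr ⟨_, mem_range_self i, fun r hr => le_ann_singleton_iff.2 (h1 r hr)⟩

/-- A change of the annotations and of the bound that respects the requirements. -/
theorem StepOK.imp {Θ Θ' : S.State → AnnSet Var P} {s : S.State} {φ : Formula Var P}
    {α α' : Ordinal.{0}} (h : StepOK A S Θ s φ α) (hα : α ≤ α') (hα' : α' < ω_ 1)
    (hΘ : ∀ t ψ β, (ψ, β) ∈ Θ t → ∃ γ ≤ β, (ψ, γ) ∈ Θ' t) : StepOK A S Θ' s φ α' := by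
  have key : ∀ t ψ, (∃ β ≤ α, (ψ, β) ∈ Θ t) → ∃ β ≤ α', (ψ, β) ∈ Θ' t := by
    rintro t ψ ⟨β, hβ, h⟩
    obtain ⟨γ, hγ, h'⟩ := hΘ t ψ β h
    exact ⟨γ, hγ.trans (hβ.trans hα), h'⟩
  refine ⟨hα', h.2.1, h.2.2.1, ?_⟩
  have h1 := h.2.2.2
  cases φ with
  | var x =>
    intro hx
    obtain ⟨β, hβ, h2⟩ := h1 hx
    obtain ⟨γ, hγ, h'⟩ := hΘ s _ β h2
    exact ⟨γ, (hγ.trans_lt hβ).trans_le hα, h'⟩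
  | disj Γ =>
    obtain ⟨β, hβ, i, h2⟩ := h1
    obtain ⟨γ, hγ, h3⟩ := key s _ ⟨β, hβ, h2⟩
    exact ⟨γ, hγ, i, h3⟩
  | conj Γ => exact fun i => key s _ (h1 i)
  | nabla Γ =>
    rcases h1 with ⟨r, hr, h2⟩ | ⟨i, h2⟩
    · exact Or.inl ⟨r, hr, fun i => key r _ (h2 i)⟩
    · exact Or.inr ⟨i, fun r hr => key r _ (h2 r hr)⟩
  | _ => trivial

/-- The union of all well-annotations. -/
def Ann (A : EqSystem Var P) (S : Frame P) (s : S.State) (φ : Formula Var P)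
    (α : Ordinal.{0}) : Prop :=
  ∃ Θ, IsWellAnnotation A S Θ ∧ (φ, α) ∈ Θ s

theorem ann_iff_stepOK {s : S.State} {φ : Formula Var P} {α : Ordinal.{0}} :
    Ann A S s φ α ↔ StepOK A S (fun t => {p | Ann A S t p.1 p.2}) s φ α := by
  have h1 : ∀ s φ α, Ann A S s φ α → StepOK A S (fun t => {p | Ann A S t p.1 p.2}) s φ α := by
    rintro s φ α ⟨Θ, hΘ, h⟩
    have h1 := isWellAnnotation_iff.1 hΘ s φ α h
    exact h1.imp le_rfl h1.1 fun t ψ β h => ⟨β, le_rfl, Θ, hΘ, h⟩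
  refine ⟨h1 s φ α, fun h => ⟨fun t => {p | StepOK A S (fun t => {p | Ann A S t p.1 p.2}) t p.1 p.2},
    isWellAnnotation_iff.2 fun t ψ β h => ?_, h⟩⟩
  have h : StepOK A S (fun t => {p | Ann A S t p.1 p.2}) t ψ β := h
  exact h.imp le_rfl h.1 fun t' ψ' β' h' => ⟨β', le_rfl, h1 _ _ _ h'⟩

theorem Ann.lt {s : S.State} {φ : Formula Var P} {α : Ordinal.{0}} (h : Ann A S s φ α) :
    α < ω_ 1 := (ann_iff_stepOK.1 h).1

theorem Ann.mem_clos {s : S.State} {φ : Formula Var P} {α : Ordinal.{0}} (h : Ann A S s φ α) :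
    φ ∈ A.Clos := (ann_iff_stepOK.1 h).2.1

theorem Ann.mem_den {s : S.State} {φ : Formula Var P} {α : Ordinal.{0}} (h : Ann A S s φ α)
    (hφ : φ.Closed) : s ∈ φ.den S fun _ => ∅ := (ann_iff_stepOK.1 h).2.2.1 hφ

theorem Ann.mono {s : S.State} {φ : Formula Var P} {α β : Ordinal.{0}} (h : Ann A S s φ α)
    (hαβ : α ≤ β) (hβ : β < ω_ 1) : Ann A S s φ β :=
  ann_iff_stepOK.2 ((ann_iff_stepOK.1 h).imp hαβ hβ fun _ _ γ h' => ⟨γ, le_rfl, h'⟩)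

theorem ann_closed_iff {s : S.State} {φ : Formula Var P} {α : Ordinal.{0}} (hC : φ ∈ A.Clos)
    (hφ : φ.Closed) : Ann A S s φ α ↔ α < ω_ 1 ∧ s ∈ φ.den S fun _ => ∅ := by
  refine ⟨fun h => ⟨h.lt, h.mem_den hφ⟩, fun ⟨h1, h2⟩ => ?_⟩
  refine ⟨fun t => {p | p.2 < ω_ 1 ∧ p.1 ∈ A.Clos ∧ p.1.Closed ∧ t ∈ p.1.den S fun _ => ∅},
    isWellAnnotation_iff.2 ?_, h1, hC, hφ, h2⟩
  rintro t ψ β ⟨h1, h2, h3, h4⟩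
  refine ⟨h1, h2, fun _ => h4, ?_⟩
  have key : ∀ t χ, Step ψ χ → t ∈ χ.den S (fun _ => ∅) → ∃ γ ≤ β, (χ, γ) ∈
      {p : Formula Var P × Ordinal.{0} | p.2 < ω_ 1 ∧ p.1 ∈ A.Clos ∧ p.1.Closed ∧
        t ∈ p.1.den S fun _ => ∅} := fun t χ hχ ht => ⟨β, le_rfl, h1, EqSystem.Clos.step h2 hχ, h3.step hχ, ht⟩
  cases ψ with
  | var x => exact ((singleton_ne_empty x) h3).elim
  | disj Γ =>
    obtain ⟨i, hi⟩ := mem_iUnion.1 h4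
    obtain ⟨γ, hγ, h⟩ := key t _ (.disj Γ i) hi
    exact ⟨γ, hγ, i, h⟩
  | conj Γ => exact fun i => key t _ (.conj Γ i) (mem_iInter.1 h4 i)
  | nabla Γ =>
    rcases h4 with ⟨_, ⟨i, rfl⟩, h5⟩ | ⟨r, h5, hr⟩
    · exact Or.inr ⟨i, fun r hr => key r _ (.nabla Γ i) (h5 hr)⟩
    · exact Or.inl ⟨r, hr, fun i => key r _ (.nabla Γ i) (h5 _ ⟨i, rfl⟩)⟩
  | _ => trivial

theorem ann_var_iff {s : S.State} (x : A.X) {α : Ordinal.{0}} :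
    Ann A S s (.var (x : Var)) α ↔ α < ω_ 1 ∧ ∃ β < α, Ann A S s (A.E x) β := by
  rw [ann_iff_stepOK]
  exact ⟨fun h => ⟨h.1, h.2.2.2 x.2⟩, fun h =>
    ⟨h.1, .var x, fun h' => ((singleton_ne_empty (x : Var)) h').elim, fun _ => h.2⟩⟩

theorem ann_disj_iff {s : S.State} {n : ℕ} {Γ : Fin n → Formula Var P} {α : Ordinal.{0}}
    (hC : .disj Γ ∈ A.Clos) : Ann A S s (.disj Γ) α ↔ ∃ i, Ann A S s (Γ i) α := by
  constructor
  · intro h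
    obtain ⟨h1, -, -, β, hβ, i, h2⟩ := ann_iff_stepOK.1 h
    exact ⟨i, Ann.mono h2 hβ h1⟩
  · rintro ⟨i, h⟩
    exact ann_iff_stepOK.2 ⟨h.lt, hC, fun h' => mem_iUnion.2 ⟨i, h.mem_den (h'.step (.disj Γ i))⟩,
      α, le_rfl, i, h⟩

theorem ann_conj_iff {s : S.State} {n : ℕ} {Γ : Fin n → Formula Var P} {α : Ordinal.{0}}
    (hC : .conj Γ ∈ A.Clos) :
    Ann A S s (.conj Γ) α ↔ α < ω_ 1 ∧ ∀ i, Ann A S s (Γ i) α := by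
  constructor
  · intro h
    obtain ⟨h1, -, -, h2⟩ := ann_iff_stepOK.1 h
    refine ⟨h1, fun i => ?_⟩
    obtain ⟨β, hβ, h3⟩ := h2 i
    exact Ann.mono h3 hβ h1
  · rintro ⟨h1, h2⟩
    exact ann_iff_stepOK.2 ⟨h1, hC, fun h' =>
      mem_iInter.2 fun i => (h2 i).mem_den (h'.step (.conj Γ i)), fun i => ⟨α, le_rfl, h2 i⟩⟩

theorem ann_nabla_iff {s : S.State} {n : ℕ} {Γ : Fin n → Formula Var P} {α : Ordinal.{0}}
    (hC : .nabla Γ ∈ A.Clos) : Ann A S s (.nabla Γ) α ↔ α < ω_ 1 ∧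
      ((∃ r, S.R s r ∧ ∀ i, Ann A S r (Γ i) α) ∨ ∃ i, ∀ r, S.R s r → Ann A S r (Γ i) α) := by
  constructor
  · intro h
    obtain ⟨h1, -, -, h2⟩ := ann_iff_stepOK.1 h
    have key : ∀ r i, (∃ β ≤ α, Ann A S r (Γ i) β) → Ann A S r (Γ i) α :=
      fun r i ⟨β, hβ, h⟩ => h.mono hβ h1
    refine ⟨h1, ?_⟩
    rcases h2 with ⟨r, hr, h3⟩ | ⟨i, h3⟩
    · exact Or.inl ⟨r, hr, fun i => key r i (h3 i)⟩
    · exact Or.inr ⟨i, fun r hr => key r i (h3 r hr)⟩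
  · rintro ⟨h1, h2⟩
    refine ann_iff_stepOK.2 ⟨h1, hC, fun h' => ?_, ?_⟩
    · have hc := fun i => h'.step (.nabla Γ i)
      rcases h2 with ⟨r, hr, h3⟩ | ⟨i, h3⟩
      · exact Or.inr ⟨r, by rintro _ ⟨i, rfl⟩; exact (h3 i).mem_den (hc i), hr⟩
      · exact Or.inl ⟨_, ⟨i, rfl⟩, fun r hr => (h3 r hr).mem_den (hc i)⟩
    · rcases h2 with ⟨r, hr, h3⟩ | ⟨i, h3⟩
      · exact Or.inl ⟨r, hr, fun i => ⟨α, le_rfl, h3 i⟩⟩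
      · exact Or.inr ⟨i, fun r hr => ⟨α, le_rfl, h3 r hr⟩⟩

theorem Ann.exists_isLeast {s : S.State} {φ : Formula Var P} {α : Ordinal.{0}}
    (h : Ann A S s φ α) : ∃ β ≤ α, IsLeast {β | Ann A S s φ β} β := by
  have h1 := csInf_mem (s := {β | Ann A S s φ β}) ⟨α, h⟩
  exact ⟨_, csInf_le' h, h1, fun _ hβ => csInf_le' hβ⟩

/-- The least annotations of the greatest well-annotation form a conservative one. -/
theorem isConservative_isLeast : IsConservative A S fun s =>
    {p | IsLeast {β | Ann A S s p.1 β} p.2} := by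
  refine ⟨isWellAnnotation_iff.2 fun s φ α h => ?_, fun s φ α β h h' => h.unique h', ?_⟩
  · exact (ann_iff_stepOK.1 h.1).imp le_rfl h.1.lt fun t ψ β h' => Ann.exists_isLeast h'
  · exact fun Θ' hΘ' s φ α h => Ann.exists_isLeast ⟨Θ', hΘ', h⟩

/-- There is only one conservative well-annotation. -/
theorem IsConservative.mem_iff {Θ : S.State → AnnSet Var P} (h : IsConservative A S Θ)
    {s : S.State} {φ : Formula Var P} {α : Ordinal.{0}} :
    (φ, α) ∈ Θ s ↔ IsLeast {β | Ann A S s φ β} α := by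
  have key : ∀ β, IsLeast {β | Ann A S s φ β} β → (φ, β) ∈ Θ s := by
    intro β hβ
    obtain ⟨γ, hγ, h1⟩ := h.minimal _ isConservative_isLeast.wellAnnotation s φ β hβ
    rwa [hγ.antisymm (hβ.2 ⟨Θ, h.wellAnnotation, h1⟩)] at h1
  refine ⟨fun h1 => ?_, key α⟩
  obtain ⟨β, -, hβ⟩ := Ann.exists_isLeast ⟨Θ, h.wellAnnotation, h1⟩
  rwa [h.unique s φ α β h1 (key β hβ)]

theorem IsConservative.mem_forget_iff {Θ : S.State → AnnSet Var P} (h : IsConservative A S Θ)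
    {s : S.State} {φ : Formula Var P} : φ ∈ (Θ s).forget ↔ ∃ α, Ann A S s φ α := by
  constructor
  · rintro ⟨α, hα⟩
    exact ⟨α, (h.mem_iff.1 hα).1⟩
  · rintro ⟨α, hα⟩
    obtain ⟨β, -, hβ⟩ := hα.exists_isLeast
    exact ⟨β, h.mem_iff.2 hβ⟩

end MuCalc

/-! ### Conjunctive systems -/

namespace MuCalc

universe u v

variable {Var : Type u} {P : Type v}

open Formula AnnSet Ordinal

/-- The right-hand sides of a conjunctive system, with variables replaced by indices: the variable
`e x` has `k x` conjuncts, and the conjunct `ι` consists of the closed formulas `Γ ι` and the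
modality applied to the variables `Y ι`. -/
structure ConjData (A : EqSystem Var P) where
  N : ℕ
  e : Fin N ≃ A.X
  k : Fin N → ℕ
  n : (Σ x, Fin (k x)) → ℕ
  m : (Σ x, Fin (k x)) → ℕ
  Γ : ∀ ι, Fin (n ι) → Formula Var P
  Y : ∀ ι, Fin (m ι) → Fin N
  closed : ∀ ι j, (Γ ι j).Closed
  eqn : ∀ x, A.E (e x) = .conj fun i =>
    (Formula.disj (Γ ⟨x, i⟩)).or (.nabla fun j => .var (e (Y ⟨x, i⟩ j) : Var))

theorem EqSystem.IsConjunctive.nonempty_conjData {A : EqSystem Var P} (hA : A.IsConjunctive) :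
    Nonempty (ConjData A) := by
  choose k n m Γ Y hΓ hE using hA
  let e := (Fintype.equivFin A.X).symm
  exact ⟨⟨Fintype.card A.X, e, fun x => k (e x), fun ι => n (e ι.1) ι.2, fun ι => m (e ι.1) ι.2,
    fun ι => Γ (e ι.1) ι.2, fun ι j => e.symm (Y (e ι.1) ι.2 j), fun ι => hΓ (e ι.1) ι.2,
    fun x => by simp only [Equiv.apply_symm_apply]; exact hE (e x)⟩⟩

namespace ConjData

variable {A : EqSystem Var P} (B : ConjData A)

/-- The conjuncts of all right-hand sides. -/
abbrev I : Type := Σ x, Fin (B.k x)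

/-- The modal part of a conjunct. -/
def box (ι : B.I) : Formula Var P := .nabla fun j => .var (B.e (B.Y ι j) : Var)

/-- A conjunct as a formula. -/
def clause (ι : B.I) : Formula Var P := (Formula.disj (B.Γ ι)).or (B.box ι)

theorem E_eq (x : Fin B.N) : A.E (B.e x) = .conj fun i => B.clause ⟨x, i⟩ := B.eqn x

theorem clause_mem (ι : B.I) : B.clause ι ∈ A.Clos := by
  have h := EqSystem.Clos.eqn (A := A) (B.e ι.1)
  rw [B.E_eq] at h
  exact h.conj ι.2

theorem disj_mem (ι : B.I) : .disj (B.Γ ι) ∈ A.Clos :=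
  EqSystem.Clos.step (B.clause_mem ι) (.disj _ 0)

theorem box_mem (ι : B.I) : B.box ι ∈ A.Clos :=
  EqSystem.Clos.step (B.clause_mem ι) (.disj _ 1)

theorem closed_disj (ι : B.I) : (Formula.disj (B.Γ ι)).Closed :=
  iUnion_eq_empty.2 (B.closed ι)

/-- The members of the closure of a conjunctive system, where `Q` is any set of formulas that
is closed under steps and contains the closed disjuncts. -/
theorem mem_clos_cases {Q : Formula Var P → Prop} (hQ : ∀ ι, Q (.disj (B.Γ ι)))
    (hstep : ∀ φ φ', Q φ → Step φ φ' → Q φ') {φ : Formula Var P} (h : φ ∈ A.Clos) :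
    (∃ x, φ = .var (B.e x : Var)) ∨ (∃ x, φ = A.E (B.e x)) ∨ (∃ ι, φ = B.clause ι) ∨
      (∃ ι, φ = B.box ι) ∨ Q φ := by
  have key : ∀ φ φ', ((∃ x, φ = .var (B.e x : Var)) ∨ (∃ x, φ = A.E (B.e x)) ∨
      (∃ ι, φ = B.clause ι) ∨ (∃ ι, φ = B.box ι) ∨ Q φ) → Step φ φ' →
      ((∃ x, φ' = .var (B.e x : Var)) ∨ (∃ x, φ' = A.E (B.e x)) ∨
      (∃ ι, φ' = B.clause ι) ∨ (∃ ι, φ' = B.box ι) ∨ Q φ') := by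
    rintro φ φ' (⟨x, rfl⟩ | ⟨x, rfl⟩ | ⟨ι, rfl⟩ | ⟨ι, rfl⟩ | h) hs
    · cases hs
    · rw [B.E_eq] at hs
      cases hs with
      | conj _ i => exact Or.inr (Or.inr (Or.inl ⟨_, rfl⟩))
    · cases hs with
      | disj _ i =>
        fin_cases i
        · exact Or.inr (Or.inr (Or.inr (Or.inr (hQ ι))))
        · exact Or.inr (Or.inr (Or.inr (Or.inl ⟨ι, rfl⟩)))
    · cases hs with
      | nabla _ i => exact Or.inl ⟨_, rfl⟩
    · exact Or.inr (Or.inr (Or.inr (Or.inr (hstep _ _ h hs))))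
  induction h with
  | var x => exact Or.inl ⟨B.e.symm x, by rw [Equiv.apply_symm_apply]⟩
  | eqn x => exact Or.inr (Or.inl ⟨B.e.symm x, by rw [Equiv.apply_symm_apply]⟩)
  | disj _ i ih => exact key _ _ ih (.disj _ i)
  | conj _ i ih => exact key _ _ ih (.conj _ i)
  | nabla _ i ih => exact key _ _ ih (.nabla _ i)
  | mu _ ih => exact key _ _ ih (.mu _ _)
  | nu _ ih => exact key _ _ ih (.nu _ _)

theorem clos_finite (B : ConjData A) : A.Clos.Finite := by
  choose D hD h1 h2 using fun ι => Closed.exists_finite (B.closed_disj ι)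
  refine ((((finite_range fun x => (.var (B.e x : Var) : Formula Var P)).union
    (finite_range fun x => A.E (B.e x))).union (finite_range B.clause)).union
    ((finite_range B.box).union (finite_iUnion hD))).subset fun φ hφ => ?_
  have hstep : ∀ φ φ', φ ∈ ⋃ ι, D ι → Step φ φ' → φ' ∈ ⋃ ι, D ι := by
    intro φ φ' h hs
    obtain ⟨ι, h⟩ := mem_iUnion.1 h
    exact mem_iUnion.2 ⟨ι, h2 ι φ h φ' hs⟩
  rcases B.mem_clos_cases (fun ι => mem_iUnion.2 ⟨ι, h1 ι⟩) hstep hφ with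
    ⟨x, rfl⟩ | ⟨x, rfl⟩ | ⟨x, rfl⟩ | ⟨x, rfl⟩ | h
  · exact Or.inl (Or.inl (Or.inl ⟨x, rfl⟩))
  · exact Or.inl (Or.inl (Or.inr ⟨x, rfl⟩))
  · exact Or.inl (Or.inr ⟨x, rfl⟩)
  · exact Or.inr (Or.inl ⟨x, rfl⟩)
  · exact Or.inr (Or.inr h)

variable (S : Frame P)

/-- The least annotation of the modal part of a conjunct, or `ω_ 1` if there is none. -/
noncomputable def rank (s : S.State) (ι : B.I) : Ordinal.{0} :=
  sInf (insert (ω_ 1) {α | Ann A S s (B.box ι) α})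

/-- The conjuncts of the right-hand side of `y` whose closed disjuncts all fail at `s`. -/
def Split (s : S.State) (y : Fin B.N) (ι : B.I) : Prop :=
  ι.1 = y ∧ ∀ j, s ∉ (B.Γ ι j).den S fun _ => ∅

variable {S}

theorem rank_le (s : S.State) (ι : B.I) : B.rank S s ι ≤ ω_ 1 := csInf_le' (mem_insert _ _)

theorem rank_le_iff {s : S.State} {ι : B.I} {α : Ordinal.{0}} (hα : α < ω_ 1) :
    B.rank S s ι ≤ α ↔ Ann A S s (B.box ι) α := by
  refine ⟨fun h => ?_, fun h => csInf_le' (mem_insert_of_mem _ h)⟩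
  rcases csInf_mem (insert_nonempty (ω_ 1) {α | Ann A S s (B.box ι) α}) with h1 | h1
  · exact absurd hα (not_lt.2 (h1 ▸ h))
  · exact Ann.mono h1 h hα

theorem rank_lt_iff {s : S.State} {ι : B.I} :
    B.rank S s ι < ω_ 1 ↔ ∃ α, Ann A S s (B.box ι) α :=
  ⟨fun h => ⟨_, (B.rank_le_iff h).1 le_rfl⟩,
    fun ⟨_, h⟩ => ((B.rank_le_iff h.lt).2 h).trans_lt h.lt⟩

theorem rank_le_iff_exists {s : S.State} {ι : B.I} {α : Ordinal.{0}} (hα : α < ω_ 1) :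
    B.rank S s ι ≤ α ↔ (∃ r, S.R s r ∧ ∀ y ∈ range (B.Y ι), Ann A S r (.var (B.e y : Var)) α) ∨
      ∃ y ∈ range (B.Y ι), ∀ r, S.R s r → Ann A S r (.var (B.e y : Var)) α := by
  rw [B.rank_le_iff hα, box, ann_nabla_iff (B.box_mem ι)]
  simp [hα]

theorem ann_clause_iff {s : S.State} {ι : B.I} {α : Ordinal.{0}} (hα : α < ω_ 1) :
    Ann A S s (B.clause ι) α ↔ (∃ j, s ∈ (B.Γ ι j).den S fun _ => ∅) ∨ B.rank S s ι ≤ α := by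
  rw [clause, Formula.or, ann_disj_iff (B.clause_mem ι), Fin.exists_fin_two, B.rank_le_iff hα]
  refine or_congr ?_ Iff.rfl
  change Ann A S s (.disj (B.Γ ι)) α ↔ _
  rw [ann_closed_iff (B.disj_mem ι) (B.closed_disj ι)]
  simp [hα, Formula.den]

theorem ann_eqn_iff {s : S.State} {y : Fin B.N} {α : Ordinal.{0}} (hα : α < ω_ 1) :
    Ann A S s (A.E (B.e y)) α ↔ ∀ ι, B.Split S s y ι → B.rank S s ι ≤ α := by
  have h := EqSystem.Clos.eqn (A := A) (B.e y)
  rw [B.E_eq] at h ⊢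
  rw [ann_conj_iff h]
  constructor
  · rintro ⟨-, h1⟩ ⟨_, i⟩ ⟨rfl, h2⟩
    rcases (B.ann_clause_iff hα).1 (h1 i) with ⟨j, h3⟩ | h3
    · exact absurd h3 (h2 j)
    · exact h3
  · refine fun h1 => ⟨hα, fun i => (B.ann_clause_iff hα).2 ?_⟩
    by_cases h2 : ∃ j, s ∈ (B.Γ ⟨y, i⟩ j).den S fun _ => ∅
    · exact Or.inl h2
    · exact Or.inr (h1 _ ⟨rfl, not_exists.1 h2⟩)

theorem ann_var_iff_rank {s : S.State} {y : Fin B.N} {α : Ordinal.{0}} :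
    Ann A S s (.var (B.e y : Var)) α ↔
      α < ω_ 1 ∧ 0 < α ∧ ∀ ι, B.Split S s y ι → B.rank S s ι < α := by
  rw [MuCalc.ann_var_iff]
  constructor
  · rintro ⟨h1, β, hβ, h2⟩
    exact ⟨h1, bot_le.trans_lt hβ, fun ι hι => ((B.ann_eqn_iff h2.lt).1 h2 ι hι).trans_lt hβ⟩
  · rintro ⟨h1, h2, h3⟩
    refine ⟨h1, ?_⟩
    rcases ({ι | B.Split S s y ι} : Set B.I).eq_empty_or_nonempty with h4 | h4
    · exact ⟨0, h2, (B.ann_eqn_iff (h2.trans h1)).2 fun ι hι => (h4 ▸ hι : ι ∈ (∅ : Set B.I)).elim⟩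
    · obtain ⟨ι, hι, hmax⟩ := exists_max_image _ (B.rank S s) (toFinite _) h4
      exact ⟨_, h3 ι hι, (B.ann_eqn_iff ((h3 ι hι).trans h1)).2 hmax⟩

/-- Which formulas can be annotated depends only on the truth of the closed formulas and on the
conjuncts of countable rank. -/
theorem Ann.exists_congr {S' : Frame P} {s : S.State} {t : S'.State}
    (h1 : ∀ φ ∈ A.Clos, φ.Closed → s ∈ φ.den S (fun _ => ∅) → t ∈ φ.den S' fun _ => ∅)
    (h2 : ∀ ι, B.rank S s ι < ω_ 1 → B.rank S' t ι < ω_ 1) {φ : Formula Var P}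
    (h : ∃ α, Ann A S s φ α) : ∃ α, Ann A S' t φ α := by
  obtain ⟨α, h⟩ := h
  have hE : ∀ y, (∃ α, Ann A S s (A.E (B.e y)) α) → ∃ α, Ann A S' t (A.E (B.e y)) α := by
    rintro y ⟨α, h⟩
    have h3 : ∀ ι, B.Split S' t y ι → B.rank S' t ι < ω_ 1 := fun ι hι =>
      h2 ι (((B.ann_eqn_iff h.lt).1 h ι ⟨hι.1, fun j hj =>
        hι.2 j (h1 _ (EqSystem.Clos.step (B.disj_mem ι) (.disj _ j)) (B.closed ι j) hj)⟩).trans_lt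
          h.lt)
    rcases ({ι | B.Split S' t y ι} : Set B.I).eq_empty_or_nonempty with h4 | h4
    · exact ⟨0, (B.ann_eqn_iff (omega_pos 1)).2 fun ι hι => (h4 ▸ hι : ι ∈ (∅ : Set B.I)).elim⟩
    · obtain ⟨ι, hι, hmax⟩ := exists_max_image _ (B.rank S' t) (toFinite _) h4
      exact ⟨_, (B.ann_eqn_iff (h3 ι hι)).2 hmax⟩
  rcases B.mem_clos_cases B.closed_disj (fun _ _ hφ => hφ.step) h.mem_clos with
    ⟨x, rfl⟩ | ⟨x, rfl⟩ | ⟨ι, rfl⟩ | ⟨ι, rfl⟩ | hφ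
  · obtain ⟨h3, β, -, h4⟩ := (MuCalc.ann_var_iff _).1 h
    obtain ⟨γ, hγ⟩ := hE x ⟨β, h4⟩
    exact ⟨_, (MuCalc.ann_var_iff _).2 ⟨isSuccLimit_omega_one.succ_lt hγ.lt, γ,
      Order.lt_succ γ, hγ⟩⟩
  · exact hE x ⟨α, h⟩
  · rcases (B.ann_clause_iff h.lt).1 h with ⟨j, h3⟩ | h3
    · exact ⟨0, (B.ann_clause_iff (omega_pos 1)).2 (Or.inl ⟨j,
        h1 _ (EqSystem.Clos.step (B.disj_mem ι) (.disj _ j)) (B.closed ι j) h3⟩)⟩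
    · have h4 := h2 ι (h3.trans_lt h.lt)
      exact ⟨_, (B.ann_clause_iff h4).2 (Or.inr le_rfl)⟩
  · exact B.rank_lt_iff.1 (h2 ι (B.rank_lt_iff.2 ⟨α, h⟩))
  · exact ⟨α, (ann_closed_iff h.mem_clos hφ).2 ⟨h.lt, h1 _ h.mem_clos hφ (h.mem_den hφ)⟩⟩

end ConjData

end MuCalc

/-! ### The arena of a frame -/

namespace MuCalc

universe u v

variable {Var : Type u} {P : Type v}

open Formula AnnSet Ordinal

namespace ConjData

variable {A : EqSystem Var P} (B : ConjData A) {S : Frame P}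

theorem exists_le_rank_of_not_ann {r : S.State} {y : Fin B.N} {α : Ordinal.{0}} (h0 : 0 < α)
    (hα : α < ω_ 1) (h : ¬ Ann A S r (.var (B.e y : Var)) α) :
    ∃ ι, B.Split S r y ι ∧ α ≤ B.rank S r ι := by
  rw [B.ann_var_iff_rank] at h
  by_contra hc
  push Not at hc
  exact h ⟨hα, h0, hc⟩

theorem exists_split_birth {s : S.State} {ι : B.I} {y : Fin B.N} {β : Ordinal.{0}}
    (hy : y ∈ range (B.Y ι)) (h0 : 0 < β) (hβ : β < B.rank S s ι) :
    ∃ r ι', S.R s r ∧ B.Split S r y ι' ∧ β ≤ B.rank S r ι' := by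
  have hβω := hβ.trans_le (B.rank_le s ι)
  have h : ¬ ∀ r, S.R s r → Ann A S r (.var (B.e y : Var)) β := fun h => not_le.2 hβ ((B.rank_le_iff_exists hβω).2 (Or.inr ⟨y, hy, h⟩))
  push Not at h
  obtain ⟨r, hr, h⟩ := h
  obtain ⟨ι', h1, h2⟩ := B.exists_le_rank_of_not_ann h0 hβω h
  exact ⟨r, ι', hr, h1, h2⟩

/-- A conjunct of maximal rank at `r` among those into which the variables of `ι` split. -/
theorem exists_split_persist (r : S.State) (ι : B.I) : ∃ ι', ∀ s l, S.R s r →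
    Order.IsSuccLimit l → l ≤ B.rank S s ι →
    (∃ y ∈ range (B.Y ι), B.Split S r y ι') ∧ l ≤ B.rank S r ι' := by
  have key : ∀ s l, S.R s r → Order.IsSuccLimit l → l ≤ B.rank S s ι → ∀ α < l, ∃ ι',
      (∃ y ∈ range (B.Y ι), B.Split S r y ι') ∧ α < B.rank S r ι' := by
    intro s l hr hl hle α hα
    have h1 := (hl.succ_lt hα).trans_le hle
    have h2 := h1.trans_le (B.rank_le s ι)
    have h : ¬ ∀ y ∈ range (B.Y ι), Ann A S r (.var (B.e y : Var)) (Order.succ α) := fun h =>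
      not_le.2 h1 ((B.rank_le_iff_exists h2).2 (Or.inl ⟨r, hr, h⟩))
    push Not at h
    obtain ⟨y, hy, h⟩ := h
    obtain ⟨ι', h3, h4⟩ := B.exists_le_rank_of_not_ann (bot_le.trans_lt (Order.lt_succ α)) h2 h
    exact ⟨ι', ⟨y, hy, h3⟩, (Order.lt_succ α).trans_le h4⟩
  rcases ({ι' | ∃ y ∈ range (B.Y ι), B.Split S r y ι'} : Set B.I).eq_empty_or_nonempty with
    h4 | h4
  · refine ⟨ι, fun s l hr hl hle => ?_⟩
    obtain ⟨ι', h, -⟩ := key s l hr hl hle 0 hl.bot_lt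
    exact (h4 ▸ (show ι' ∈ {ι' | ∃ y ∈ range (B.Y ι), B.Split S r y ι'} from h) :
      ι' ∈ (∅ : Set B.I)).elim
  · obtain ⟨ι', hι', hmax⟩ := exists_max_image _ (B.rank S r) (toFinite _) h4
    refine ⟨ι', fun s l hr hl hle => ⟨hι', le_of_forall_lt fun α hα => ?_⟩⟩
    obtain ⟨ι'', h5, h6⟩ := key s l hr hl hle α hα
    exact h6.trans_le (hmax _ h5)

end ConjData

/-- Indices for the closed formulas in the closure of a conjunctive system. -/
structure Coding (A : EqSystem Var P) extends ConjData A where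
  K : ℕ
  fm : Fin K → Formula Var P
  range_fm : range fm = {φ | φ ∈ A.Clos ∧ φ.Closed}
  M : ℕ
  size_le : ∀ c, (fm c).size ≤ M

theorem ConjData.exists_coding {A : EqSystem Var P} (B : ConjData A) :
    ∃ D : Coding A, D.toConjData = B := by
  have hfin : {φ | φ ∈ A.Clos ∧ φ.Closed}.Finite := B.clos_finite.subset fun φ h => h.1
  obtain ⟨K, fm, -, h⟩ := hfin.fin_param
  obtain ⟨M, hM⟩ := (finite_range fun c => (fm c).size).bddAbove
  exact ⟨⟨B, K, fm, h, M, fun c => hM ⟨c, rfl⟩⟩, rfl⟩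

namespace Coding

variable {A : EqSystem Var P} (B : Coding A)

theorem fm_mem (c : Fin B.K) : B.fm c ∈ A.Clos ∧ (B.fm c).Closed := by
  have := mem_range_self (f := B.fm) c
  rwa [B.range_fm] at this

theorem exists_fm {φ : Formula Var P} (h : φ ∈ A.Clos) (h' : φ.Closed) : ∃ c, B.fm c = φ := by
  have : φ ∈ range B.fm := by
    rw [B.range_fm]
    exact ⟨h, h'⟩
  exact this

theorem mem_range_fm : ∀ φ ∈ range B.fm, φ.Closed ∧ φ.size ≤ B.M ∧
    ∀ φ', Step φ φ' → φ' ∈ range B.fm := by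
  rintro _ ⟨c, rfl⟩
  refine ⟨(B.fm_mem c).2, B.size_le c, fun φ' h => ?_⟩
  exact B.exists_fm (EqSystem.Clos.step (B.fm_mem c).1 h) ((B.fm_mem c).2.step h)

variable (S : Frame P)

/-- The type of a state: the true closed formulas and the conjuncts of countable rank. -/
def type (s : S.State) : Set (Fin B.K) × Set B.I :=
  ({c | s ∈ (B.fm c).den S fun _ => ∅}, {ι | B.rank S s ι < ω_ 1})

/-- The conjuncts of the right-hand side of `y` none of whose closed disjuncts belongs to `T`. -/
def SplitAt (T : Set (Fin B.K) × Set B.I) (y : Fin B.N) (ι : B.I) : Prop :=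
  ι.1 = y ∧ ∀ j c, B.fm c = B.Γ ι j → c ∉ T.1

variable {S}

theorem splitAt_iff {s : S.State} {y : Fin B.N} {ι : B.I} {T : Set (Fin B.K) × Set B.I}
    (hT : ∀ c, c ∈ T.1 ↔ s ∈ (B.fm c).den S fun _ => ∅) : B.SplitAt T y ι ↔ B.Split S s y ι := by
  refine and_congr_right fun _ => forall_congr' fun j => ?_
  constructor
  · intro h hj
    obtain ⟨c, hc⟩ := B.exists_fm (EqSystem.Clos.step (B.disj_mem ι) (.disj _ j)) (B.closed ι j)
    exact h c hc ((hT c).2 (hc ▸ hj))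
  · rintro h c hc h'
    exact h (hc ▸ (hT c).1 h')

variable (S)

/-- The arena of a frame: the obligations are the conjuncts of the right-hand sides. -/
noncomputable def preArena : PreArena B.I (Fin B.N) (Set (Fin B.K) × Set B.I) where
  S := S.State
  succ := S.R
  τ := B.type S
  Δ T := T.2
  Y ι := range (B.Y ι)
  At := B.SplitAt
  u := B.rank S
  pers _ r ι := (B.exists_split_persist r ι).choose
  Tr s r ι ι' := B.rank S r ι' < B.rank S s ι
  mem_Δ _ _ := Iff.rfl
  u_le := B.rank_le
  pers_spec s r ι l hr hl hle := by
    obtain ⟨⟨y, hy, h1⟩, h2⟩ := (B.exists_split_persist r ι).choose_spec s l hr hl hle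
    exact ⟨⟨y, hy, (B.splitAt_iff fun _ => Iff.rfl).2 h1⟩, h2⟩
  birth_spec s ι y β hy h0 hβ := by
    obtain ⟨r, ι', h1, h2, h3⟩ := B.exists_split_birth hy h0 hβ
    exact ⟨r, ι', h1, (B.splitAt_iff fun _ => Iff.rfl).2 h2, h3⟩
  tr_lt _ _ _ _ _ h := h

variable {S} (σ : Strat S Var B.M)

/-- Steps of the strategies of both players of the truth game. -/
def CStep (v v' : S.State × (Fin B.K × Bool)) : Prop :=
  v'.2.2 = v.2.2 ∧
    σ.TStep (range B.fm) id id v.2.2 (v.1, B.fm v.2.1) (v'.1, B.fm v'.2.1)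

/-- The priorities of claims. -/
def prio (c : Fin B.K × Bool) : ℕ := (B.fm c.1).prio B.M + shift c.2

theorem prio_lt (c : Fin B.K × Bool) : B.prio c < 2 * B.M + 6 := by
  have h1 := (B.fm c.1).prio_le B.M
  have h2 : shift c.2 ≤ 1 := by
    unfold shift
    split_ifs <;> omega
  unfold prio
  omega

theorem exists_claim_rank (p : ℕ) : ∃ ρ : S.State × (Fin B.K × Bool) → Ordinal.{0}, p % 2 = 1 →
    ∀ v v', B.CStep σ v v' → p ≤ B.prio v.2 → ρ v' ≤ ρ v ∧ (B.prio v.2 = p → ρ v' < ρ v) := by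
  by_cases hp : p % 2 = 1
  · have hbad : ∀ z : ℕ → S.State × (Fin B.K × Bool), (∀ n, B.CStep σ (z n) (z (n + 1))) →
        ¬ SetGame.ParWin (fun v => B.prio v.2) 1 z := by
      intro z hz h
      have hb : ∀ n, (z n).2.2 = (z 0).2.2 := by
        intro n
        induction n with
        | zero => rfl
        | succ n ih => rw [(hz n).1, ih]
      refine σ.not_parWin (range B.fm) (b := (z 0).2.2)
        (z := fun n => ((z n).1, B.fm (z n).2.1)) (fun n => ?_) (h.congr fun n => ?_)
      · have := (hz n).2
        rwa [hb n] at this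
      · simp only [prio, hb n]
    obtain ⟨ρ, hρ⟩ := exists_parity_rank hbad hp
    exact ⟨ρ, fun _ => hρ⟩
  · exact ⟨fun _ => 0, fun h => absurd h hp⟩

/-- The claims about the truth or falsity of closed formulas, with the strategies of the truth
game. -/
noncomputable def claims : Claims (B.preArena S) (Fin B.K × Bool) (2 * B.M + 6) where
  Loc s c c' := c'.2 = c.2 ∧ σ.Loc (range B.fm) s c.2 (B.fm c.1) (B.fm c'.1)
  Mod s r c c' := c'.2 = c.2 ∧ σ.Mod (range B.fm) s r c.2 (B.fm c.1) (B.fm c'.1)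
  Ω := B.prio
  Ω_lt := B.prio_lt
  ρ p s c := (B.exists_claim_rank σ p).choose (s, c)
  loc p s c c' hp h hc :=
    (B.exists_claim_rank σ p).choose_spec hp (s, c) (s, c') ⟨h.1, Or.inl ⟨rfl, h.2⟩⟩ hc
  mod p s r c c' hp hr h hc :=
    (B.exists_claim_rank σ p).choose_spec hp (s, c) (r, c') ⟨h.1, Or.inr ⟨hr, h.2⟩⟩ hc

end Coding

end MuCalc

/-! ### Unravelling and ranks in the new tree -/

namespace MuCalc

universe u v

section Unravel

variable {V : Type} {P : Type v}

/-- The end of the path from `v₀` whose further vertices are listed in reverse order. -/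
def tip (v₀ : V) : List V → V
  | [] => v₀
  | v :: _ => v

/-- Paths from `v₀` along `E`, listed in reverse order without `v₀`. -/
def IsPath (E : V → V → Prop) (v₀ : V) : List V → Prop
  | [] => True
  | v :: l => E (tip v₀ l) v ∧ IsPath E v₀ l

/-- The tree of all paths from `v₀`. -/
def unravel (E : V → V → Prop) (v₀ : V) (L : P → Set V) : Frame P where
  State := {l // IsPath E v₀ l}
  nonempty := ⟨[], trivial⟩
  R l l' := ∃ v, l'.1 = v :: l.1
  label p := {l | tip v₀ l.1 ∈ L p}

variable {E : V → V → Prop} {v₀ : V} {L : P → Set V}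

theorem isTree_unravel : (unravel E v₀ L).IsTree ⟨[], trivial⟩ := by
  refine ⟨?_, ?_, ?_⟩
  · rintro ⟨l, hl⟩
    induction l with
    | nil => exact .refl
    | cons v l ih => exact (ih hl.2).tail ⟨v, rfl⟩
  · rintro s ⟨v, h⟩
    exact (List.cons_ne_nil v s.1 h.symm).elim
  · rintro s t r ⟨v, h⟩ ⟨w, h'⟩
    exact Subtype.ext (List.cons.inj (h.symm.trans h')).2

theorem unravel_edge {l l' : (unravel E v₀ L).State} (h : (unravel E v₀ L).R l l') :
    E (tip v₀ l.1) (tip v₀ l'.1) := by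
  obtain ⟨l, hl⟩ := l
  obtain ⟨l', hl'⟩ := l'
  obtain ⟨v, rfl⟩ : ∃ v, l' = v :: l := h
  exact hl'.1

theorem exists_unravel {l : (unravel E v₀ L).State} {v : V} (h : E (tip v₀ l.1) v) :
    ∃ l', (unravel E v₀ L).R l l' ∧ tip v₀ l'.1 = v :=
  ⟨⟨v :: l.1, h, l.2⟩, ⟨v, rfl⟩, rfl⟩

theorem unravel_induction {Q : V → Prop} (h0 : Q v₀) (h : ∀ v w, Q v → E v w → Q w)
    (l : (unravel E v₀ L).State) : Q (tip v₀ l.1) := by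
  obtain ⟨l, hl⟩ := l
  induction l with
  | nil => exact h0
  | cons v l ih => exact h _ _ (ih hl.2) hl.1

end Unravel

variable {Var : Type u} {P : Type v}

open Formula Ordinal

namespace Coding

variable {A : EqSystem Var P} (B : Coding A) {S : Frame P} (σ : Strat S Var B.M)

/-- The arena in which paths are summarized by claims and traces. -/
noncomputable abbrev arena : Arena B.I (Fin B.N) (Set (Fin B.K) × Set B.I)
    (Claims.Summary B.I (Fin B.K × Bool) (2 * B.M + 6)) := (B.claims σ).arena

/-- The new tree. -/
noncomputable def tree (x₀ : (B.arena σ).St) : Frame P :=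
  unravel Arena.Edge x₀ fun p => {x | x.p.s ∈ S.label p}

variable {σ} {x₀ : (B.arena σ).St}

/-- The annotated position at a state of the new tree. -/
def pos (t : (B.tree σ x₀).State) : (B.arena σ).St := tip x₀ t.1

/-- The original state of which a state of the new tree is a copy. -/
def orig (t : (B.tree σ x₀).State) : S.State := (B.pos t).p.s

/-- The original state for which the edge to a state of the new tree stands. -/
def goal (t : (B.tree σ x₀).State) : S.State := (B.pos t).r

theorem edge_pos {t t' : (B.tree σ x₀).State} (h : (B.tree σ x₀).R t t') :
    Arena.Edge (B.pos t) (B.pos t') := unravel_edge h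

theorem exists_pos {t : (B.tree σ x₀).State} {x : (B.arena σ).St}
    (h : Arena.Edge (B.pos t) x) : ∃ t', (B.tree σ x₀).R t t' ∧ B.pos t' = x := exists_unravel h

theorem ok_pos (h0 : x₀.OK) (t : (B.tree σ x₀).State) : (B.pos t).OK :=
  unravel_induction h0 (fun _ _ h ⟨_, _, _, h'⟩ => h'.ok h) t

theorem type_pos {t t' : (B.tree σ x₀).State} (h : (B.tree σ x₀).R t t') :
    B.type S (B.orig t') = B.type S (B.goal t') := by
  obtain ⟨_, _, _, h'⟩ := B.edge_pos h
  exact h'.step.type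

/-- Closed formulas are true in the new tree iff they are true at the original state. -/
theorem mem_den_tree_iff (h0 : x₀.OK) (t : (B.tree σ x₀).State) (c : Fin B.K) :
    t ∈ (B.fm c).den (B.tree σ x₀) (fun _ => ∅) ↔
      B.orig t ∈ (B.fm c).den S fun _ => ∅ := by
  rw [σ.mem_den_iff_self _ B.mem_range_fm _ ⟨c, rfl⟩]
  refine σ.mem_den_iff (range B.fm) (S' := B.tree σ x₀) (π := B.orig)
    (lab := B.goal) B.mem_range_fm (fun _ _ => Iff.rfl) (fun t t' h => ?_)
    (fun t r hr => ?_) (fun t t' h => ?_) (fun b z hz hbad => ?_) t ⟨c, rfl⟩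
  · obtain ⟨_, _, _, h'⟩ := B.edge_pos h
    exact h'.succ
  · obtain ⟨x, hx, hxr⟩ := Arena.exists_edge (B.ok_pos h0 t) hr
    obtain ⟨t', h1, h2⟩ := B.exists_pos hx
    exact ⟨t', h1, by rw [← hxr, ← h2]; rfl⟩
  · rintro _ ⟨c, rfl⟩
    rw [← σ.mem_den_iff_self _ B.mem_range_fm _ ⟨c, rfl⟩,
      ← σ.mem_den_iff_self _ B.mem_range_fm _ ⟨c, rfl⟩]
    have := congrArg (fun T => c ∈ T.1) (B.type_pos h)
    exact (iff_of_eq this).symm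
  · have hmem : ∀ n, ∃ c, B.fm c = (z n).2 := by
      intro n
      rcases hz n with ⟨-, h⟩ | ⟨-, h⟩
      · exact h.2.1
      · exact h.2.1
    choose c hc using hmem
    refine (B.claims σ).not_parWin (z := fun n => (B.pos (z n).1, (c n, b))) (B.ok_pos h0 _)
      (fun n => ?_) (hbad.congr fun n => ?_)
    · rcases hz n with ⟨h1, h2⟩ | ⟨h1, h2⟩
      · refine Or.inl ⟨by rw [h1], rfl, ?_⟩
        dsimp only
        rw [hc, hc]
        exact h2
      · refine Or.inr ⟨B.edge_pos h1, rfl, ?_⟩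
        dsimp only
        rw [hc, hc]
        exact h2
    · change (B.fm (c n)).prio B.M + shift b = _
      rw [hc]

theorem splitAt_pos_iff (h0 : x₀.OK) (t : (B.tree σ x₀).State) {y : Fin B.N} {ι : B.I} :
    B.SplitAt (B.type S (B.orig t)) y ι ↔ B.Split (B.tree σ x₀) t y ι :=
  B.splitAt_iff fun c => (B.mem_den_tree_iff h0 t c).symm

/-- Conjuncts of countable rank at a state have countable rank in the new tree. -/
theorem rank_tree_lt (h0 : x₀.OK) (t : (B.tree σ x₀).State) {ι : B.I}
    (hι : B.rank S (B.orig t) ι < ω_ 1) : B.rank (B.tree σ x₀) t ι < ω_ 1 := by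
  obtain ⟨h, h1, h2⟩ := (Arena.exists_trace_rank (A := B.arena σ))
  have hω : ∀ t ι, B.rank S (B.orig t) ι < ω_ 1 → 1 + h (B.pos t) ι < ω_ 1 := fun t ι hι =>
    isPrincipal_add_omega 1 (one_lt_omega0.trans omega0_lt_omega_one) (h1 _ (B.ok_pos h0 t) ι hι)
  suffices key : ∀ o t ι, h (B.pos t) ι = o → B.rank S (B.orig t) ι < ω_ 1 →
      B.rank (B.tree σ x₀) t ι ≤ 1 + o from (key _ t ι rfl hι).trans_lt (hω t ι hι)
  intro o
  induction o using WellFoundedLT.induction with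
  | ind o ih =>
    rintro t ι rfl hι
    have hann : ∀ t' y, (B.tree σ x₀).R t t' →
        Ann A S (B.goal t') (.var (B.e y : Var)) (B.rank S (B.orig t) ι) →
        Ann A (B.tree σ x₀) t' (.var (B.e y : Var)) (1 + h (B.pos t) ι) := by
      intro t' y hR hy
      refine B.ann_var_iff_rank.2 ⟨hω t ι hι, zero_lt_one.trans_le le_self_add, fun ι' hι' => ?_⟩
      have h3 : B.rank S (B.goal t') ι' < B.rank S (B.orig t) ι := by
        refine (B.ann_var_iff_rank.1 hy).2.2 ι' 
          ((B.splitAt_iff (T := B.type S (B.goal t')) fun _ => Iff.rfl).1 ?_)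
        rw [← B.type_pos hR]
        exact (B.splitAt_pos_iff h0 t').2 hι'
      have h4 : B.rank S (B.orig t') ι' < ω_ 1 := by
        have := congrArg (fun T => ι' ∈ T.2) (B.type_pos hR)
        exact (iff_of_eq this).2 (h3.trans hι)
      have h5 := h2 _ _ ι ι' (B.ok_pos h0 t) hι (B.edge_pos hR) h3
      exact (ih _ h5 t' ι' rfl h4).trans_lt ((add_lt_add_iff_left 1).2 h5)
    rw [B.rank_le_iff_exists (hω t ι hι)]
    rcases (B.rank_le_iff_exists hι).1 le_rfl with ⟨r, hr, h3⟩ | ⟨y, hy, h3⟩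
    · obtain ⟨x, hx, rfl⟩ := Arena.exists_edge (B.ok_pos h0 t) hr
      obtain ⟨t', h4, rfl⟩ := B.exists_pos hx
      exact Or.inl ⟨t', h4, fun y hy => hann t' y h4 (h3 y hy)⟩
    · refine Or.inr ⟨y, hy, fun t' hR => hann t' y hR (h3 _ ?_)⟩
      obtain ⟨_, _, _, h'⟩ := B.edge_pos hR
      exact h'.succ

/-- The ranks in the new tree are at least the intended ones. -/
theorem le_rank_tree (h0 : x₀.OK) (t : (B.tree σ x₀).State) (ι : B.I) :
    (B.pos t).v ι ≤ B.rank (B.tree σ x₀) t ι := by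
  suffices key : ∀ β t ι, β ≤ (B.pos t).v ι → β ≤ B.rank (B.tree σ x₀) t ι from key _ t ι le_rfl
  intro β
  induction β using WellFoundedLT.induction with
  | ind β ih =>
    intro t ι hβ
    by_contra hc
    push Not at hc
    have hα := hc.trans_le hβ
    have hαω := hα.trans_le (COrd.val_le _)
    have hok := B.ok_pos h0 t
    have hcontra : ∀ t' y ι', B.SplitAt (B.type S (B.orig t')) y ι' →
        B.rank (B.tree σ x₀) t ι ≤ (B.pos t').v ι' →
        ¬ Ann A (B.tree σ x₀) t' (.var (B.e y : Var)) (B.rank (B.tree σ x₀) t ι) :=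
      fun t' y ι' h1 h2 h3 => not_le.2 ((B.ann_var_iff_rank.1 h3).2.2 ι'
        ((B.splitAt_pos_iff h0 t').1 h1)) (ih _ hc t' ι' h2)
    rcases (B.rank_le_iff_exists hαω).1 le_rfl with ⟨t', hR, h1⟩ | ⟨y, hy, h1⟩
    · obtain ⟨_, _, _, hE⟩ := B.edge_pos hR
      obtain ⟨y, hy, ι', h2, h3⟩ := hE.persist hok (bot_le.trans_lt hα)
      exact hcontra t' y ι' h2 (hα.le.trans h3) (h1 y hy)
    · have hpos : 0 < B.rank (B.tree σ x₀) t ι := by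
        obtain ⟨x, hx⟩ := hok.exists_edge_of_pos hy (bot_le.trans_lt hα)
        obtain ⟨t', h2, -⟩ := B.exists_pos hx
        exact (B.ann_var_iff_rank.1 (h1 t' h2)).2.1
      obtain ⟨x, hx, ι', h2, h3⟩ := Arena.exists_edge_birth hok hy hpos hα
      obtain ⟨t', h4, rfl⟩ := B.exists_pos hx
      exact hcontra t' y ι' h2 h3 (h1 t' h4)

end Coding

end MuCalc

/-! ### Raising the rank of a conjunct -/

namespace MuCalc

universe u v

variable {Var : Type u} {P : Type v}

open Formula Ordinal

namespace Coding

variable {A : EqSystem Var P} (B : Coding A)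

/-- The height above which ranks of conjuncts can be raised. -/
noncomputable def bound : ℕ := Arena.levBound B.I (Set (Fin B.K) × Set B.I)
  (Claims.Summary B.I (Fin B.K × Bool) (2 * B.M + 6))

/-- The rank of a conjunct at a state can be raised arbitrarily if it is high enough: some tree
has a root with the same annotated formulas at which the rank is at least `κ`. -/
theorem exists_tree (S : Frame P) (s : S.State) {ι : B.I} (hι : B.rank S s ι < ω_ 1)
    (hu : ω * ((B.bound : Ordinal) + 1) ≤ B.rank S s ι) {κ : Ordinal} (hκ : κ < ω_ 1) :
    ∃ (T : Frame P) (ρ : T.State), T.IsTree ρ ∧ κ ≤ B.rank T ρ ι ∧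
      (∀ y, B.Split T ρ y ι ↔ B.Split S s y ι) ∧
      ∀ φ, (∃ α, Ann A T ρ φ α) ↔ ∃ α, Ann A S s φ α := by
  obtain ⟨σ⟩ := exists_strat (Var := Var) S B.M
  obtain ⟨x₀, h0, hs, hv⟩ := Arena.exists_start (A := B.arena σ) (s := s) (ι := ι) hι hu hκ
  let ρ : (B.tree σ x₀).State := ⟨[], trivial⟩
  have hρ : B.orig ρ = s := hs
  have hden : ∀ c, ρ ∈ (B.fm c).den (B.tree σ x₀) (fun _ => ∅) ↔
      s ∈ (B.fm c).den S fun _ => ∅ := by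
    intro c
    rw [B.mem_den_tree_iff h0, hρ]
  have hrank : ∀ ι', B.rank (B.tree σ x₀) ρ ι' < ω_ 1 ↔ B.rank S s ι' < ω_ 1 := by
    intro ι'
    refine ⟨fun h => ?_, fun h => B.rank_tree_lt h0 ρ (by rwa [hρ])⟩
    by_contra hc
    have h1 := h0.off ι' fun h' => hc (by rwa [← hs])
    exact not_lt.2 (h1 ▸ B.le_rank_tree h0 ρ ι') h
  have hlit : ∀ φ ∈ A.Clos, φ.Closed →
      (ρ ∈ φ.den (B.tree σ x₀) (fun _ => ∅) ↔ s ∈ φ.den S fun _ => ∅) := by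
    intro φ h h'
    obtain ⟨c, rfl⟩ := B.exists_fm h h'
    exact hden c
  refine ⟨B.tree σ x₀, ρ, isTree_unravel, hv ▸ B.le_rank_tree h0 ρ ι, fun y => ?_, fun φ => ?_⟩
  · rw [← B.splitAt_pos_iff h0 ρ, hρ]
    exact B.splitAt_iff fun _ => Iff.rfl
  · exact ⟨ConjData.Ann.exists_congr B.toConjData (fun φ h h' => (hlit φ h h').1)
      fun ι' => (hrank ι').1, ConjData.Ann.exists_congr B.toConjData
      (fun φ h h' => (hlit φ h h').2) fun ι' => (hrank ι').2⟩

end Coding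

end MuCalc

theorem mainTheorem3 {Var : Type*} {P : Type*} (A : MuCalc.EqSystem Var P)
    (hA : A.IsConjunctive) (κ : Ordinal.{0}) (hκ : κ < Ordinal.omega 1)
    (Γ : Set (MuCalc.Formula Var P)) (hΓ : Γ ⊆ A.Clos) (x : Var) (hx : x ∈ A.X)
    (h : MuCalc.O A (.var x) Γ ≤ κ) :
    MuCalc.O A (.var x) Γ < Ordinal.omega0 ^ 2 := by
  obtain ⟨B₀⟩ := hA.nonempty_conjData
  obtain ⟨B, -⟩ := B₀.exists_coding
  obtain ⟨y, rfl⟩ : ∃ y, (B.e y : Var) = x := ⟨B.e.symm ⟨x, hx⟩, by simp⟩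
  by_contra hc
  have hpos : (0 : Ordinal.{0}) < Ordinal.omega0 * ((B.bound : Ordinal.{0}) + 1) :=
    mul_pos Ordinal.omega0_pos (zero_lt_one.trans_le le_add_self)
  have hlt : Ordinal.omega0 * ((B.bound : Ordinal.{0}) + 1) < Ordinal.omega0 ^ 2 := by
    rw [pow_two]
    refine mul_lt_mul_of_pos_left ?_ Ordinal.omega0_pos
    exact_mod_cast Ordinal.natCast_lt_omega0 (B.bound + 1)
  obtain ⟨κ₀, ⟨hκ₀, S, s, Θ, -, hΘ, rfl, hmem⟩, hlt⟩ :=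
    exists_lt_of_lt_csSup' (hlt.trans_le (not_lt.1 hc))
  have hleast := hΘ.mem_iff.1 hmem
  -- a failing conjunct of high rank, which exists as `κ₀` is the least annotation of the variable
  obtain ⟨ι, hι, hu⟩ := B.exists_le_rank_of_not_ann hpos (hlt.trans hκ₀)
    fun h' => not_le.2 hlt (hleast.2 h')
  have hιω := ((B.ann_var_iff_rank.1 hleast.1).2.2 ι hι).trans hκ₀
  obtain ⟨T, ρ, hT, hrank, hsplit, hann⟩ := B.exists_tree S s hιω hu
    (isSuccLimit_omega_one.succ_lt hκ)
  obtain ⟨α, hα⟩ := (hann _).2 ⟨κ₀, hleast.1⟩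
  obtain ⟨β, -, hβ⟩ := hα.exists_isLeast
  have hlt' := hrank.trans_lt ((B.ann_var_iff_rank.1 hβ.1).2.2 ι ((hsplit y).2 hι))
  refine not_le.2 ((Order.lt_succ κ).trans hlt') (le_trans (le_csSup ⟨Ordinal.omega 1, ?_⟩ ?_) h)
  · exact fun γ hγ => hγ.1.le
  · refine ⟨hβ.1.lt, T, ρ, _, hT, MuCalc.isConservative_isLeast, ?_, hβ⟩
    ext φ
    rw [hΘ.mem_forget_iff, MuCalc.isConservative_isLeast.mem_forget_iff, hann]
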